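/- Let $F$ be a totally real number field of degree $d$ with ring of integers $O_F$, and let $B$ be a totally indefinite quaternion algebra over $F$, i.e. $B\otimes_{F,\varphi}\mathbb R\simeq \mathrm{Mat}_2(\mathbb R)$ for every embedding $\varphi:F\hookrightarrow\mathbb R$. Let $b\mapsto\bar b=\mathrm{Tr}_{B/F}(b)-b$ be the canonical involution, let $*$ be a positive involution of $B$ (that is, $\mathrm{Tr}_{B/\mathbb Q}(bb^*)>0$ for all $b\neq 0$, where $\mathrm{Tr}_{B/F}$ is the reduced trace and $\mathrm{Tr}_{B/\mathbb Q}=\mathrm{Tr}_{F/\mathbb Q}\circ\mathrm{Tr}_{B/F}$), and let $O_B$ be a maximal $O_F$-order of $B$ that is stable under $*$. There is an element $\gamma\in B^\times$, unique up to $F^\times$, with $\gamma+\bar\gamma=0$ and $b^*=\gamma\bar b\gamma^{-1}$ for all $b\in B$. Let $m\ge 1$ be an integer, and suppose that either $m$ is even, or $\mathrm{ord}_{\Pi_v}(\gamma)$ is odd for every finite place $v$ of $F$ that is ramified in $B$; here $\Pi_v$ is a uniformizer of the division algebra $B_v=B\otimes_F F_v$ and $\mathrm{ord}_{\Pi_v}$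 is the $\Pi_v$-adic valuation. Let $p$ be a prime number, $k$ an algebraically closed field of characteristic $p$, and $\sigma$ the Frobenius automorphism of the ring of Witt vectors $W(k)$. Then there exists a principally polarized superspecial $O_B\otimes\mathbb Z_p$-Dieudonné module over $k$ of $W(k)$-rank $4dm$ that satisfies the determinant condition. Explicitly, there exist * a free $W(k)$-module $M$ of rank $4dm$ with a $\sigma$-linear operator $\mathsf F$ and a $\sigma^{-1}$-linear operator $\mathsf V$ such that $\mathsf F\mathsf V=\mathsf V\mathsf F=p$; * an action of the $\mathbb Z_p$-algebra $O_B\otimes\mathbb Z_p$ on $M$ by $W(k)$-linear endomorphisms commuting with $\mathsf F$ and $\mathsf V$; * a perfect alternating $W(k)$-bilinear form $\langle\,,\rangle:M\times M\to W(k)$ with $\langle \mathsf Fx,y\rangle=\langle x,\mathsf Vy\rangle^{\sigma}$ and $\langle bx,y\rangle=\langle x,b^*y\rangle$ for all $x,y\in M$ and $b\in O_B\otimes\mathbb Z_p$ (where $*$ acts on $O_B\otimes\mathbb Z_p$ through the first factor), such that $M$ is superspecial, i.e. $$\dim_k M/\mathsf FM=\dim_k M/\mathsf VM=\dim_k M/(\mathsf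 FM+\mathsf VM),$$ and such that, for every $b\in O_B$, the characteristic polynomial of $b$ on the $k$-vector space $M/\mathsf VM$ is the reduction modulo $p$ of $\mathrm{char}(b)^m$, where $\mathrm{char}(b)=\mathrm{Nr}_{F/\mathbb Q}(\mathrm{char}_F(b))\in\mathbb Z[T]$ is the norm of the reduced characteristic polynomial $\mathrm{char}_F(b)\in O_F[T]$ of $b$. -/

import Mathlib

open scoped TensorProduct NumberField Polynomial

noncomputable section

namespace SuperspecialTypeC

/-! ### Quaternion algebras over number fields -/

section Quaternion

variable (F : Type*) [Field F] {B : Type*} [Ring B] [Algebra F B]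

/-- The reduced trace `Tr_{B/F}` of a quaternion algebra `B` over a field of characteristic
different from two: left multiplication by `b` on the four-dimensional space `B` has twice the
reduced trace of `b` as its trace. -/
def redTrace (b : B) : F := (2 : F)⁻¹ * LinearMap.trace F B (LinearMap.mulLeft F b)

/-- The reduced norm of a quaternion algebra; for two-by-two matrices this is the identity
`det A = (tr(A)² - tr(A²)) / 2`. -/
def redNorm (b : B) : F := (2 : F)⁻¹ * (redTrace F b ^ 2 - redTrace F (b ^ 2))

/-- The canonical involution `b ↦ Tr_{B/F}(b) - b`. -/
def canonInv (b : B) : B := algebraMap F B (redTrace F b) - b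

/-- The reduced characteristic polynomial `char_F(b)`. -/
def redCharpoly (b : B) : F[X] :=
  Polynomial.X ^ 2 - Polynomial.C (redTrace F b) * Polynomial.X + Polynomial.C (redNorm F b)

/-- `B` is totally indefinite: `B ⊗_F ℝ ≃ Mat₂(ℝ)` for every real embedding of `F`. -/
def IsTotallyIndefinite (B : Type*) [Ring B] [Algebra F B] : Prop :=
  ∀ φ : F →+* ℝ,
    letI : Algebra F ℝ := φ.toAlgebra
    Nonempty (ℝ ⊗[F] B ≃ₐ[ℝ] Matrix (Fin 2) (Fin 2) ℝ)

/-- The involution `star` of `B` is positive: `Tr_{B/ℚ}(b b^*) > 0` for all nonzero `b`, where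
`Tr_{B/ℚ}` is the reduced trace of `B` over `F` followed by the trace of `F` over `ℚ`. -/
def IsPositiveInvolution [NumberField F] (B : Type*) [Ring B] [Algebra F B] [StarRing B] :
    Prop :=
  ∀ b : B, b ≠ 0 → 0 < Algebra.trace ℚ F (redTrace F (b * star b))

/-- The elements `γ ∈ B^×` with `γ̄ + γ = 0` and `b^* = γ b̄ γ⁻¹` for all `b`. -/
def IsTwistingElement [StarRing B] (γ : Bˣ) : Prop :=
  canonInv F (γ : B) + (γ : B) = 0 ∧
    ∀ b : B, star b = (γ : B) * canonInv F b * ((γ⁻¹ : Bˣ) : B)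

attribute [local instance] Polynomial.algebra in
/-- `P ∈ ℤ[T]` is `char(b) = Nr_{F/ℚ} char_F(b)`, the reduced characteristic polynomial of `b`
from `B` to `ℚ`. Here `Nr_{F/ℚ}` is the norm of `F[T]` over `ℚ[T]`. -/
def IsAbsRedCharpoly [NumberField F] (b : B) (P : ℤ[X]) : Prop :=
  P.map (Int.castRingHom ℚ) = Algebra.norm ℚ[X] (redCharpoly F b)

end Quaternion

/-! ### Orders and finite places -/

section Order

variable {F : Type*} [Field F] [NumberField F] {B : Type*} [Ring B] [Algebra F B]

/-- An `O_F`-order of `B`: a subring containing `O_F`, finitely generated as an `O_F`-module,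
and spanning `B` over `F`. -/
def IsOrder (O : Subalgebra (𝓞 F) B) : Prop :=
  (Subalgebra.toSubmodule O).FG ∧ Submodule.span F (O : Set B) = ⊤

/-- A maximal `O_F`-order of `B`. -/
def IsMaximalOrder (O : Subalgebra (𝓞 F) B) : Prop := Maximal IsOrder O

variable (F B) in
/-- The completion `B_v = B ⊗_F F_v` at a finite place `v`. -/
abbrev LocalAlgebra (v : IsDedekindDomain.HeightOneSpectrum (𝓞 F)) : Type _ :=
  v.adicCompletion F ⊗[F] B

variable (B) in
/-- `v` is ramified in `B`: the quaternion algebra `B_v` is a division algebra. -/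
def IsRamified (v : IsDedekindDomain.HeightOneSpectrum (𝓞 F)) : Prop :=
  ∀ x : LocalAlgebra F B v, x ≠ 0 → IsUnit x

/-- The completion `O_{B_v} = O_B ⊗_{O_F} O_v`, as the `O_v`-submodule of `B_v` generated by
`O_B`. -/
def localOrder (O : Subalgebra (𝓞 F) B) (v : IsDedekindDomain.HeightOneSpectrum (𝓞 F)) :
    Submodule (v.adicCompletionIntegers F) (LocalAlgebra F B v) :=
  Submodule.span _ ((fun b : B => (1 : v.adicCompletion F) ⊗ₜ[F] b) '' (O : Set B))

/-- `u` is a unit of the ring `O_{B_v}`. -/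
def IsLocalUnit (O : Subalgebra (𝓞 F) B) (v : IsDedekindDomain.HeightOneSpectrum (𝓞 F))
    (u : (LocalAlgebra F B v)ˣ) : Prop :=
  (u : LocalAlgebra F B v) ∈ localOrder O v ∧
    ((u⁻¹ : (LocalAlgebra F B v)ˣ) : LocalAlgebra F B v) ∈ localOrder O v

/-- `ϖ` is a uniformizer of `B_v` (for `v` ramified in `B`): the non-units of `O_{B_v}`
are exactly the multiples `ϖ y` with `y ∈ O_{B_v}`. -/
def IsUniformizer (O : Subalgebra (𝓞 F) B) (v : IsDedekindDomain.HeightOneSpectrum (𝓞 F))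
    (ϖ : (LocalAlgebra F B v)ˣ) : Prop :=
  ∀ x : LocalAlgebra F B v,
    (x ∈ localOrder O v ∧ ¬ ∃ u, IsLocalUnit O v u ∧ (u : LocalAlgebra F B v) = x) ↔
      ∃ y ∈ localOrder O v, x = ϖ * y

/-- The normalized valuation of `x ∈ B_v^×` (for `v` ramified in `B`) is `n`:
`x = ϖ ^ n u` with `ϖ` a uniformizer and `u` a unit of `O_{B_v}`. -/
def HasOrd (O : Subalgebra (𝓞 F) B) (v : IsDedekindDomain.HeightOneSpectrum (𝓞 F))
    (x : (LocalAlgebra F B v)ˣ) (n : ℤ) : Prop :=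
  ∃ ϖ u : (LocalAlgebra F B v)ˣ, IsUniformizer O v ϖ ∧ IsLocalUnit O v u ∧ x = ϖ ^ n * u

/-- The image of `γ ∈ B^×` in `B_v^×`. -/
def toLocal (v : IsDedekindDomain.HeightOneSpectrum (𝓞 F)) : Bˣ →* (LocalAlgebra F B v)ˣ :=
  Units.map
    (Algebra.TensorProduct.includeRight : B →ₐ[F] LocalAlgebra F B v).toRingHom.toMonoidHom

/-- Either `m` is even, or `ord_{Π_v}(γ)` is odd for every finite place `v` of `F` ramified in
`B`, where `γ` is as in `IsTwistingElement`. Such a `γ` is unique up to `F^×`, so that the parity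
of `ord_{Π_v}(γ)` does not depend on it. -/
def ParityCondition [StarRing B] (O : Subalgebra (𝓞 F) B) (m : ℕ) : Prop :=
  Even m ∨ ∀ γ : Bˣ, IsTwistingElement F γ →
    ∀ v : IsDedekindDomain.HeightOneSpectrum (𝓞 F), IsRamified B v →
      ∃ n : ℤ, Odd n ∧ HasOrd O v (toLocal v γ) n

/-- The involution of a `star`-stable order, as a `ℤ`-linear map. -/
def orderStar [StarRing B] (O : Subalgebra (𝓞 F) B) (hO : ∀ b ∈ O, star b ∈ O) :
    O →ₗ[ℤ] O :=
  AddMonoidHom.toIntLinearMap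
    { toFun := fun b => ⟨star (b : B), hO b b.2⟩
      map_zero' := by ext; simp
      map_add' := fun a b => by ext; simp }

/-- The involution `* ⊗ id` of `O_B ⊗ ℤ_p`. -/
def padicStar (p : ℕ) [Fact p.Prime] [StarRing B] (O : Subalgebra (𝓞 F) B)
    (hO : ∀ b ∈ O, star b ∈ O) : O ⊗[ℤ] ℤ_[p] →+ O ⊗[ℤ] ℤ_[p] :=
  (TensorProduct.map (orderStar O hO) LinearMap.id).toAddMonoidHom

theorem padicStar_tmul (p : ℕ) [Fact p.Prime] [StarRing B] (O : Subalgebra (𝓞 F) B)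
    (hO : ∀ b ∈ O, star b ∈ O) (b : O) (z : ℤ_[p]) :
    padicStar p O hO (b ⊗ₜ[ℤ] z) = (⟨star (b : B), hO b b.2⟩ : O) ⊗ₜ[ℤ] z :=
  rfl

end Order

/-! ### Dieudonné modules -/

section Dieudonne

variable (p : ℕ) [Fact p.Prime] (k : Type*) [Field k] [CharP k p] [IsAlgClosed k]

/-- The Frobenius automorphism `σ` of `W(k)`. -/
abbrev frob : WittVector p k →+* WittVector p k :=
  (WittVector.frobeniusEquiv p k : WittVector p k →+* WittVector p k)

/-- The inverse `σ⁻¹` of the Frobenius automorphism of `W(k)`. -/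
abbrev frobInv : WittVector p k →+* WittVector p k :=
  ((WittVector.frobeniusEquiv p k).symm : WittVector p k →+* WittVector p k)

/-- The residue map `W(k) → k`. -/
instance residueAlgebra : Algebra (WittVector p k) k :=
  (WittVector.constantCoeff : WittVector p k →+* k).toAlgebra

/-- The canonical map `ℤ_p = W(𝔽_p) → W(k)`. -/
def padicToWitt : ℤ_[p] →+* WittVector p k :=
  (WittVector.map (ZMod.castHom (dvd_refl p) k)).comp
    ((WittVector.equiv p).symm : ℤ_[p] →+* WittVector p (ZMod p))

/-- A Dieudonné module over `k`: a finite free `W(k)`-module with a `σ`-linear operator `F` and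
a `σ⁻¹`-linear operator `V` such that `FV = VF = p`. -/
structure DieudonneModule (M : Type*) [AddCommGroup M] [Module (WittVector p k) M] where
  free : Module.Free (WittVector p k) M
  finite : Module.Finite (WittVector p k) M
  F : M →ₛₗ[frob p k] M
  V : M →ₛₗ[frobInv p k] M
  F_V : ∀ x, F (V x) = (p : WittVector p k) • x
  V_F : ∀ x, V (F x) = (p : WittVector p k) • x

namespace DieudonneModule

variable {p k} {M : Type*} [AddCommGroup M] [Module (WittVector p k) M]

/-- The submodule `FM`. -/
def rangeF (D : DieudonneModule p k M) : Submodule (WittVector p k) M := LinearMap.range D.F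

/-- The submodule `VM`. -/
def rangeV (D : DieudonneModule p k M) : Submodule (WittVector p k) M := LinearMap.range D.V

/-- The `k`-dimension of `M / N`, for a `W(k)`-submodule `N` containing `p M`. For such an `N`,
the quotient `M / N` is already a vector space over `k = W(k) / p`, and extension of scalars
along `W(k) → k` does not change it. -/
def quotDim (N : Submodule (WittVector p k) M) : ℕ :=
  Module.finrank k (k ⊗[WittVector p k] (M ⧸ N))

/-- A Dieudonné module is superspecial if
`dim M / FM = dim M / VM = dim M / (F, V)M`. -/
def IsSuperspecial (D : DieudonneModule p k M) : Prop :=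
  ∃ g : ℕ, quotDim D.rangeF = g ∧ quotDim D.rangeV = g ∧ quotDim (D.rangeF ⊔ D.rangeV) = g

/-- A principal polarization: a perfect alternating form with `⟨Fx, y⟩ = ⟨x, Vy⟩^σ`. -/
structure PrincipalPolarization (D : DieudonneModule p k M) where
  form : LinearMap.BilinForm (WittVector p k) M
  alt : form.IsAlt
  F_left : ∀ x y, form (D.F x) y = frob p k (form x (D.V y))
  perfect : form.IsPerfPair

/-- An action of a `ℤ_p`-algebra `O` on a Dieudonné module, commuting with `F` and `V`. -/
structure Action (D : DieudonneModule p k M) (O : Type*) [Ring O] [Algebra ℤ_[p] O] where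
  act : O →+* Module.End (WittVector p k) M
  act_padic : ∀ (z : ℤ_[p]) (x : M), act (algebraMap ℤ_[p] O z) x = padicToWitt p k z • x
  act_F : ∀ (b : O) (x : M), act b (D.F x) = D.F (act b x)
  act_V : ∀ (b : O) (x : M), act b (D.V x) = D.V (act b x)

/-- The `k`-linear action of `b ∈ O` on `M / VM`. -/
def Action.onLie {D : DieudonneModule p k M} {O : Type*} [Ring O] [Algebra ℤ_[p] O]
    (ι : D.Action O) (b : O) : Module.End k (k ⊗[WittVector p k] (M ⧸ D.rangeV)) :=
  LinearMap.baseChange k (D.rangeV.mapQ D.rangeV (ι.act b) (by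
    rintro _ ⟨x, rfl⟩
    exact ⟨ι.act b x, (ι.act_V b x).symm⟩))

/-- The characteristic polynomial of `b ∈ O` on the `k`-vector space `M / VM`. -/
def Action.lieCharpoly {D : DieudonneModule p k M} {O : Type*} [Ring O] [Algebra ℤ_[p] O]
    (ι : D.Action O) (b : O) : k[X] :=
  haveI := D.finite
  (ι.onLie b).charpoly

end DieudonneModule

end Dieudonne

/-! ### Dieudonné modules with an action of `O_B ⊗ ℤ_p` -/

section Padic

variable {F : Type*} [Field F] [NumberField F] {B : Type*} [Ring B] [Algebra F B]
  {p : ℕ} [Fact p.Prime] {k : Type*} [Field k] [CharP k p] [IsAlgClosed k]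
  {M : Type*} [AddCommGroup M] [Module (WittVector p k) M]

/-- The `ℤ_p`-algebra structure of `O_B ⊗ ℤ_p`. -/
instance padicOrderAlgebra (O : Subalgebra (𝓞 F) B) : Algebra ℤ_[p] (O ⊗[ℤ] ℤ_[p]) :=
  Algebra.TensorProduct.rightAlgebra

/-- The polarization satisfies `⟨bx, y⟩ = ⟨x, b^*y⟩` for all `b ∈ O_B ⊗ ℤ_p`. -/
def IsCompatible [StarRing B] (O : Subalgebra (𝓞 F) B) (hO : ∀ b ∈ O, star b ∈ O)
    {D : DieudonneModule p k M} (ι : D.Action (O ⊗[ℤ] ℤ_[p])) (φ : D.PrincipalPolarization) :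
    Prop :=
  ∀ (b : O ⊗[ℤ] ℤ_[p]) (x y : M),
    φ.form (ι.act b x) y = φ.form x (ι.act (padicStar p O hO b) y)

/-- The determinant condition: the characteristic polynomial of every `b ∈ O_B` on `M / VM` is
the reduction modulo `p` of `char(b) ^ m`. -/
def DeterminantCondition (O : Subalgebra (𝓞 F) B) (m : ℕ)
    {D : DieudonneModule p k M} (ι : D.Action (O ⊗[ℤ] ℤ_[p])) : Prop :=
  ∀ b : O, ∃ P : ℤ[X], IsAbsRedCharpoly F (b : B) P ∧
    ι.lieCharpoly (b ⊗ₜ[ℤ] (1 : ℤ_[p])) = (P ^ m).map (Int.castRingHom k)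

end Padic

end SuperspecialTypeC

end

open SuperspecialTypeC

universe u

noncomputable section

namespace SuperspecialTypeC

set_option linter.unusedSectionVars false

open WithZero IsDedekindDomain
open scoped Matrix

/-! The module comes from a model over ℤ_p: the lattice O_B ⊗ ℤ_p with O_B acting by left
multiplication, extended to W(k). Let ϖ ∈ O_B ⊗ ℤ_p satisfy ϖϖ̄ = p and ϖ² ∈ p(O_B ⊗ ℤ_p). Right
multiplication by ϖ composed with σ, and by ϖ̄ composed with σ⁻¹, serve as F and V. They commute
with left multiplication, FV = VF = p, and the condition on ϖ² gives FM = VM, so M is superspecial.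
Then V²M = pM, and V identifies M/VM with VM/pM up to a twist, so the characteristic polynomial of b
on M/pM is the square of the one on M/VM (`MatrixModel.lieCharpoly_sq`). On O_B it equals char(b)²,
and comparing monic square roots gives the determinant condition.

The form is Tr_{F/ℚ}(δ Tr(γ⁻¹ x^* y)). It is alternating, left multiplication by b has adjoint b^*,
and right multiplication by c has adjoint c̄, so F and V are adjoint. Perfectness at p is a question
at each v above p (`LocalOrder.exists_dual_scaling`, `exists_gram_matrix`). If the local order Λ is
split, it is self-dual for the trace form, and γ, which normalizes Λ, is a scalar times a unit, so a
suitable δ exists. If Λ is ramified, its trace dual consists of the x with π Nr(x) integral, and a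
scalar δ can absorb γ when γ has odd order; this is the parity condition. For m even no form on O_B
is needed: the sum of the lattice and its dual, with the hyperbolic form, is taken m/2 times.

It remains to find ϖ. Locally there are two cases, according to whether Λ has a nontrivial
idempotent modulo π. Without one, the reduced norm decides membership in Λ and behaves like a
valuation. With one, Λ resembles 2×2 matrices and ϖ is taken antidiagonal. All of this is done in
the localization of O_B inside B, up to congruence (`LocalOrder.exists_norm_approx`). The Chinese
remainder theorem then yields q ∈ O_B with Nr q = p + p²r (`exists_norm_approx_order`), and a factor
1 + ty with Tr y ≡ 1 modulo p and t ∈ O_F ⊗ ℤ_p found by Hensel's lemma makes the norm exactly p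
(`exists_frobenius_matrix`). Completions are needed only to read off the parity condition. -/

theorem charpoly_blockDiagonal_const {R n o : Type*} [CommRing R] [Fintype n] [DecidableEq n]
    [Fintype o] [DecidableEq o] (A : Matrix n n R) :
    (Matrix.blockDiagonal fun _ : o => A).charpoly = A.charpoly ^ Fintype.card o := by
  have h : (Matrix.blockDiagonal fun _ : o => A).charmatrix =
      Matrix.blockDiagonal fun _ : o => A.charmatrix := by
    ext ⟨i, k⟩ ⟨j, l⟩ : 1
    rw [Matrix.blockDiagonal_apply, Matrix.charmatrix_apply, Matrix.charmatrix_apply,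
      Matrix.blockDiagonal_apply, Matrix.diagonal_apply, Matrix.diagonal_apply]
    by_cases hk : k = l <;> by_cases hi : i = j <;> simp [hk, hi]
  rw [Matrix.charpoly, h, Matrix.det_blockDiagonal, Finset.prod_const, Finset.card_univ,
    Matrix.charpoly]

theorem toMatrix_stdBasis_mulLeft {R n : Type*} [CommRing R] [Fintype n] [DecidableEq n]
    (A : Matrix n n R) :
    LinearMap.toMatrix (Matrix.stdBasis R n n) (Matrix.stdBasis R n n) (LinearMap.mulLeft R A) =
      Matrix.blockDiagonal fun _ : n => A := by
  ext ⟨i, k⟩ ⟨j, l⟩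
  rw [LinearMap.toMatrix_apply, Matrix.stdBasis_eq_single, LinearMap.mulLeft_apply]
  have : ((Matrix.stdBasis R n n).repr (A * Matrix.single j l 1)) (i, k) =
      (A * Matrix.single j l 1 : Matrix n n R) i k := by
    simp [Matrix.stdBasis, Pi.basis]
  rw [this, Matrix.blockDiagonal_apply]
  by_cases h : k = l
  · subst h; simp
  · simp [h]

theorem charpoly_mulLeft_matrix {R n : Type*} [CommRing R] [Fintype n] [DecidableEq n]
    (A : Matrix n n R) : (LinearMap.mulLeft R A).charpoly = A.charpoly ^ Fintype.card n := by
  rw [← LinearMap.charpoly_toMatrix _ (Matrix.stdBasis R n n), toMatrix_stdBasis_mulLeft,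
    charpoly_blockDiagonal_const]

theorem trace_mulLeft_matrix {R n : Type*} [CommRing R] [Fintype n] [DecidableEq n]
    (A : Matrix n n R) : LinearMap.trace R _ (LinearMap.mulLeft R A) = Fintype.card n * A.trace := by
  rw [LinearMap.trace_eq_matrix_trace R (Matrix.stdBasis R n n), toMatrix_stdBasis_mulLeft,
    Matrix.trace_blockDiagonal, Finset.sum_const, Finset.card_univ, nsmul_eq_mul]

/-- `ψ` splits the quaternion algebra `B` over the field `F` embedded in `ℝ` by `φ`. -/
structure IsSplittingOver {F B : Type*} [Field F] [Ring B] [Algebra F B] [Module.Finite F B] (φ : F →+* ℝ)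
    (ψ : B →+* Matrix (Fin 2) (Fin 2) ℝ) : Prop where
  smul : ∀ c b, ψ (c • b) = φ c • ψ b
  trace : ∀ b, (ψ b).trace = φ (redTrace F b)
  charpoly : ∀ b, (LinearMap.mulLeft F b).charpoly.map φ = (ψ b).charpoly ^ 2
  span : Submodule.span ℝ (Set.range ψ) = ⊤

/-- Left multiplication on the split algebra is conjugate to the base change of left multiplication
on B, and on 2×2 matrices it acts separately on the two columns. This explains the square of the
characteristic polynomial and the factor 1/2 in `redTrace`. -/
theorem exists_isSplittingOver {F B : Type*} [Field F] [Ring B] [Algebra F B] 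
    [Module.Finite F B]
    (hind : IsTotallyIndefinite F B) (φ : F →+* ℝ) :
    ∃ ψ : B →+* Matrix (Fin 2) (Fin 2) ℝ, IsSplittingOver φ ψ := by
  let _ : Algebra F ℝ := φ.toAlgebra
  obtain ⟨e⟩ : Nonempty (ℝ ⊗[F] B ≃ₐ[ℝ] Matrix (Fin 2) (Fin 2) ℝ) := hind φ
  have hconj : ∀ b : B, LinearMap.mulLeft ℝ (e (1 ⊗ₜ b)) =
      e.toLinearEquiv.conj ((LinearMap.mulLeft F b).baseChange ℝ) := by
    intro b
    ext1 x
    obtain ⟨y, rfl⟩ := e.surjective x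
    have : (LinearMap.mulLeft F b).baseChange ℝ = LinearMap.mulLeft ℝ (1 ⊗ₜ[F] b) := by
      ext c; simp
    rw [this]
    simp [LinearEquiv.conj_apply]
  refine ⟨(e : ℝ ⊗[F] B →+* _).comp (Algebra.TensorProduct.includeRight : B →ₐ[F] ℝ ⊗[F] B),
    ?_, ?_, ?_, ?_⟩
  · intro c b
    have : (1 : ℝ) ⊗ₜ[F] (c • b) = (φ c) • ((1 : ℝ) ⊗ₜ[F] b) := by
      rw [← TensorProduct.smul_tmul, TensorProduct.smul_tmul', Algebra.smul_def]
      rfl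
    exact (congrArg e this).trans (map_smul e _ _)
  · intro b
    have h := trace_mulLeft_matrix (e (1 ⊗ₜ b))
    rw [hconj, LinearMap.trace_conj', LinearMap.trace_baseChange] at h
    simp only [redTrace, map_mul, map_inv₀, map_ofNat]
    simp only [Fintype.card_fin, Nat.cast_ofNat] at h
    have h2 : φ (LinearMap.trace F B (LinearMap.mulLeft F b)) =
      2 * (e ((1 : ℝ) ⊗ₜ[F] b)).trace := h
    rw [h2]
    simp
  · intro b
    have h := charpoly_mulLeft_matrix (e (1 ⊗ₜ b))
    rw [hconj, LinearEquiv.charpoly_conj, LinearMap.charpoly_baseChange] at h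
    rw [Fintype.card_fin] at h
    exact h
  · rw [eq_top_iff]
    rintro x -
    obtain ⟨y, rfl⟩ := e.surjective x
    induction y using TensorProduct.induction_on with
    | zero => simp
    | tmul r b =>
      have : (r ⊗ₜ[F] b) = r • ((1 : ℝ) ⊗ₜ[F] b) := by
        rw [TensorProduct.smul_tmul', smul_eq_mul, mul_one]
      rw [this, map_smul]
      exact Submodule.smul_mem _ _ (Submodule.subset_span ⟨b, rfl⟩)
    | add x y hx hy => rw [map_add]; exact add_mem hx hy

/-! ### Reduced trace, reduced norm and canonical involution -/

section Linear

variable {F B : Type*} [Field F] [Ring B] [Algebra F B]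

theorem redTrace_add (x y : B) : redTrace F (x + y) = redTrace F x + redTrace F y := by
  have : LinearMap.mulLeft F (x + y) = LinearMap.mulLeft F x + LinearMap.mulLeft F y := by
    ext; simp [add_mul]
  simp [redTrace, this, mul_add]

theorem redTrace_smul (c : F) (x : B) : redTrace F (c • x) = c * redTrace F x := by
  have : LinearMap.mulLeft F (c • x) = c • LinearMap.mulLeft F x := by
    ext; simp
  simp [redTrace, this, mul_left_comm]

theorem redTrace_neg (x : B) : redTrace F (-x) = -redTrace F x := by
  simpa using redTrace_smul (-1 : F) x

theorem redTrace_sub (x y : B) : redTrace F (x - y) = redTrace F x - redTrace F y := by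
  rw [sub_eq_add_neg, redTrace_add, redTrace_neg, sub_eq_add_neg]

theorem redTrace_mul_comm (x y : B) : redTrace F (x * y) = redTrace F (y * x) := by
  have : ∀ x y : B, LinearMap.mulLeft F (x * y) = LinearMap.mulLeft F x * LinearMap.mulLeft F y :=
    fun x y => LinearMap.mulLeft_mul F B x y
  simp only [redTrace, this, LinearMap.trace_mul_comm F (LinearMap.mulLeft F x)]

variable (F B) in
/-- The reduced trace as a linear form. -/
def redTraceLin : B →ₗ[F] F where
  toFun := redTrace F
  map_add' := redTrace_add
  map_smul' := redTrace_smul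

@[simp] theorem redTraceLin_apply (x : B) : redTraceLin F B x = redTrace F x := rfl

theorem canonInv_def (x : B) : canonInv F x = redTrace F x • 1 - x := by
  rw [canonInv, Algebra.algebraMap_eq_smul_one]

theorem canonInv_add (x y : B) : canonInv F (x + y) = canonInv F x + canonInv F y := by
  simp only [canonInv_def, redTrace_add, add_smul]; abel

theorem canonInv_smul (c : F) (x : B) : canonInv F (c • x) = c • canonInv F x := by
  simp only [canonInv_def, redTrace_smul, smul_sub, smul_smul]

theorem canonInv_neg (x : B) : canonInv F (-x) = - canonInv F x := by
  simpa using canonInv_smul (-1 : F) x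

end Linear

/-- The identities satisfied by the reduced trace and the reduced norm of a quaternion algebra. -/
class IsQuat (F B : Type*) [Field F] [Ring B] [Algebra F B] [Module.Finite F B] : Prop where
  finrank : Module.finrank F B = 4
  mul_canonInv : ∀ x : B, x * canonInv F x = redNorm F x • 1
  canonInv_mul : ∀ x y : B, canonInv F (x * y) = canonInv F y * canonInv F x
  redTrace_one : redTrace F (1 : B) = 2
  redNorm_one : redNorm F (1 : B) = 1
  redNorm_mul : ∀ x y : B, redNorm F (x * y) = redNorm F x * redNorm F y
  redNorm_add : ∀ x y : B,
    redNorm F (x + y) = redNorm F x + redNorm F y + redTrace F (x * canonInv F y)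
  nondeg : ∀ x : B, (∀ y, redTrace F (x * y) = 0) → x = 0
  charpoly : ∀ b : B, (LinearMap.mulLeft F b).charpoly = redCharpoly F b ^ 2

section Splitting

variable {F B : Type*} [Field F] [Ring B] [Algebra F B] [Module.Finite F B] {φ : F →+* ℝ}
  {ψ : B →+* Matrix (Fin 2) (Fin 2) ℝ}

theorem IsSplittingOver.norm (h : IsSplittingOver φ ψ) (b : B) :
    (ψ b).det = φ (redNorm F b) := by
  simp only [redNorm, map_mul, map_inv₀, map_ofNat, map_sub, map_pow, ← h.trace]
  rw [pow_two, Matrix.det_fin_two, Matrix.trace_fin_two, Matrix.trace_fin_two, pow_two]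
  simp [Matrix.mul_apply, Fin.sum_univ_two]
  ring

theorem IsSplittingOver.map_canonInv (h : IsSplittingOver φ ψ) (b : B) :
    ψ (canonInv F b) = (ψ b).adjugate := by
  rw [canonInv_def, map_sub, h.smul, ← h.trace, map_one, Matrix.adjugate_fin_two]
  ext i j
  fin_cases i <;> fin_cases j <;> simp [Matrix.trace_fin_two]

/-- One real embedding is enough: B is simple, so ψ is injective, and every identity becomes one
about 2×2 matrices with the adjugate as involution. Nondegeneracy uses that the image of ψ spans all
matrices. -/
theorem IsSplittingOver.isQuat [IsSimpleRing B] (hB : Module.finrank F B = 4)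
    (h : IsSplittingOver φ ψ) : IsQuat F B := by
  have hφ := φ.injective
  have hψ : Function.Injective ψ := ψ.injective
  refine ⟨hB, ?_, ?_, ?_, ?_, ?_, ?_, ?_, ?_⟩
  · intro x
    apply hψ
    rw [map_mul, h.map_canonInv, h.smul, ← h.norm, map_one, Matrix.mul_adjugate]
  · intro x y
    apply hψ
    rw [h.map_canonInv, map_mul, map_mul, Matrix.adjugate_mul_distrib, h.map_canonInv,
      h.map_canonInv]
  · apply hφ
    rw [← h.trace, map_one, Matrix.trace_one, map_ofNat]; simp
  · apply hφ
    rw [← h.norm]; simp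
  · intro x y
    apply hφ
    rw [← h.norm, map_mul, Matrix.det_mul, h.norm, h.norm, map_mul]
  · intro x y
    apply hφ
    rw [← h.norm]
    simp only [map_add, ← h.norm, ← h.trace, map_mul, h.map_canonInv]
    simp [Matrix.det_fin_two, Matrix.trace_fin_two, Matrix.adjugate_fin_two, Matrix.mul_apply,
      Fin.sum_univ_two]
    ring
  · intro x hx
    apply hψ
    have key : ∀ A : Matrix (Fin 2) (Fin 2) ℝ, (ψ x * A).trace = 0 := by
      intro A
      have hA : A ∈ Submodule.span ℝ (Set.range ψ) := by rw [h.span]; trivial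
      induction hA using Submodule.span_induction with
      | mem A hA =>
        obtain ⟨y, rfl⟩ := hA
        rw [← map_mul, h.trace, hx, map_zero]
      | zero => simp
      | add A B _ _ hA hB => rw [mul_add, Matrix.trace_add, hA, hB, add_zero]
      | smul c A _ hA => rw [mul_smul_comm, Matrix.trace_smul, hA, smul_zero]
    rw [map_zero]
    ext i j
    have := key (Matrix.single j i 1)
    rwa [Matrix.trace_mul_single, MulOpposite.op_one, one_smul] at this
  · intro b
    apply Polynomial.map_injective φ hφ
    rw [h.charpoly, Polynomial.map_pow]
    congr 1
    rw [Matrix.charpoly_fin_two, h.trace, h.norm]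
    simp [redCharpoly]

end Splitting

section QuatIdentities

variable {F B : Type*} [Field F] [CharZero F] [Ring B] [Algebra F B] [Module.Finite F B]
  [IsQuat F B]

theorem redTrace_smul_one (c : F) : redTrace F (c • (1 : B)) = 2 * c := by
  rw [redTrace_smul, IsQuat.redTrace_one, mul_comm]

theorem canonInv_mul_self (x : B) : canonInv F x * x = redNorm F x • 1 := by
  rw [← IsQuat.mul_canonInv, canonInv_def, sub_mul, mul_sub]; simp

theorem canonInv_one : canonInv F (1 : B) = 1 := by
  rw [canonInv_def, IsQuat.redTrace_one, two_smul]; abel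

theorem redTrace_canonInv (x : B) : redTrace F (canonInv F x) = redTrace F x := by
  rw [canonInv_def, redTrace_sub, redTrace_smul_one]; ring

theorem canonInv_canonInv (x : B) : canonInv F (canonInv F x) = x := by
  rw [canonInv_def (canonInv F x), redTrace_canonInv, canonInv_def]; abel

theorem add_canonInv (x : B) : x + canonInv F x = redTrace F x • 1 := by
  rw [canonInv_def]; abel

theorem canonInv_smul_one (c : F) : canonInv F (c • (1 : B)) = c • 1 := by
  rw [canonInv_smul, canonInv_one]

theorem redTrace_mul_canonInv_self (x : B) : redTrace F (x * canonInv F x) = 2 * redNorm F x := by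
  rw [IsQuat.mul_canonInv, redTrace_smul_one]

theorem redNorm_smul (c : F) (x : B) : redNorm F (c • x) = c ^ 2 * redNorm F x := by
  simp only [redNorm, smul_pow, redTrace_smul]; ring

theorem redNorm_zero : redNorm F (0 : B) = 0 := by
  simpa using redNorm_smul (0 : F) (0 : B)

theorem redNorm_neg (x : B) : redNorm F (-x) = redNorm F x := by
  simpa using redNorm_smul (-1 : F) x

theorem redNorm_smul_one (c : F) : redNorm F (c • (1 : B)) = c ^ 2 := by
  rw [redNorm_smul, IsQuat.redNorm_one, mul_one]

theorem redTrace_mul_canonInv (x y : B) :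
    redTrace F (x * canonInv F y) = redTrace F x * redTrace F y - redTrace F (x * y) := by
  rw [canonInv_def, mul_sub, redTrace_sub, mul_smul_comm, mul_one, redTrace_smul]; ring

theorem mul_self_eq (x : B) : x * x = redTrace F x • x - redNorm F x • 1 := by
  rw [← IsQuat.mul_canonInv, canonInv_def, mul_sub]; simp

/-- The sandwich identity `x y x = Tr(y x) x - Nr(x) ȳ`. -/
theorem mul_mul_self (x y : B) :
    x * y * x = redTrace F (y * x) • x - redNorm F x • canonInv F y := by
  have h : y * x = redTrace F (y * x) • 1 - canonInv F x * canonInv F y := by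
    rw [← IsQuat.canonInv_mul, canonInv_def]; abel
  rw [mul_assoc]
  conv_lhs => rw [h]
  rw [mul_sub, ← mul_assoc, IsQuat.mul_canonInv]
  simp

theorem redNorm_canonInv (x : B) : redNorm F (canonInv F x) = redNorm F x := by
  have h1 := redTrace_mul_canonInv_self (F := F) (canonInv F x)
  rw [canonInv_canonInv, redTrace_mul_comm, redTrace_mul_canonInv_self] at h1
  have : (2 : F) ≠ 0 := two_ne_zero
  exact (mul_left_cancel₀ this h1).symm

/-- The inverse of an element of nonzero reduced norm. -/
def quatInv (x : B) : B := (redNorm F x)⁻¹ • canonInv F x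

theorem mul_quatInv {x : B} (h : redNorm F x ≠ 0) : x * quatInv (F := F) x = 1 := by
  rw [quatInv, mul_smul_comm, IsQuat.mul_canonInv, smul_smul, inv_mul_cancel₀ h, one_smul]

theorem quatInv_mul {x : B} (h : redNorm F x ≠ 0) : quatInv (F := F) x * x = 1 := by
  rw [quatInv, smul_mul_assoc, canonInv_mul_self, smul_smul, inv_mul_cancel₀ h, one_smul]

theorem redNorm_quatInv (x : B) : redNorm F (quatInv (F := F) x) = (redNorm F x)⁻¹ := by
  rw [quatInv, redNorm_smul, redNorm_canonInv]
  by_cases h : redNorm F x = 0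
  · simp [h]
  · field_simp

end QuatIdentities

/-! ### Positivity over a totally real field and the twisting element -/

section TotallyReal

variable {F : Type*} [Field F] [NumberField F] [NumberField.IsTotallyReal F]

/-- The real embedding attached to a complex embedding of a totally real field. -/
def realEmb (σ : F →+* ℂ) : F →+* ℝ :=
  NumberField.ComplexEmbedding.IsReal.embedding
    (NumberField.InfinitePlace.isReal_mk_iff.mp
      (NumberField.IsTotallyReal.isReal (NumberField.InfinitePlace.mk σ)))

theorem coe_realEmb (σ : F →+* ℂ) (x : F) : (realEmb σ x : ℂ) = σ x :=
  NumberField.ComplexEmbedding.IsReal.coe_embedding_apply _ x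

theorem trace_eq_sum_realEmb (x : F) :
    ((Algebra.trace ℚ F x : ℚ) : ℝ) = ∑ σ : F →+* ℂ, realEmb σ x := by
  have h := trace_eq_sum_embeddings (K := ℚ) ℂ (x := x)
  apply Complex.ofReal_injective
  rw [Complex.ofReal_sum]
  simp only [coe_realEmb]
  have h2 : ((Algebra.trace ℚ F x : ℚ) : ℂ) = ∑ σ : F →ₐ[ℚ] ℂ, σ x := by
    rw [← h]; rfl
  rw [Complex.ofReal_ratCast, h2]
  exact Fintype.sum_equiv (RingHom.equivRatAlgHom F ℂ).symm _ _ (fun σ => rfl)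

/-- A unit u with |u| < 1 at all other places has |u| ≥ 1 at σ₀, since its norm is ±1. With c = u ^
N the terms away from σ₀ tend to zero while the term at σ₀ stays at most σ₀(a) < 0. -/
theorem exists_pow_mul_trace_neg (a : F) (σ₀ : F →+* ℂ) (ha : realEmb σ₀ a < 0) :
    ∃ c : F, c ≠ 0 ∧ Algebra.trace ℚ F (c ^ 2 * a) < 0 := by
  classical
  obtain ⟨u, hu⟩ := NumberField.Units.dirichletUnitTheorem.exists_unit F
    (NumberField.InfinitePlace.mk σ₀)
  have hupos : ∀ σ : F →+* ℂ, 0 < |realEmb σ (u : F)| := fun σ => by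
    rw [abs_pos]; simp
  have hval : ∀ σ : F →+* ℂ, NumberField.InfinitePlace.mk σ (u : F) = |realEmb σ (u : F)| := by
    intro σ
    rw [NumberField.InfinitePlace.apply, ← coe_realEmb, Complex.norm_real, Real.norm_eq_abs]
  have hlt : ∀ σ : F →+* ℂ, σ ≠ σ₀ → |realEmb σ (u : F)| < 1 := by
    intro σ hσ
    have hne : NumberField.InfinitePlace.mk σ ≠ NumberField.InfinitePlace.mk σ₀ := by
      rw [Ne, NumberField.InfinitePlace.mk_eq_iff, not_or]
      refine ⟨hσ, fun h => hσ ?_⟩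
      rw [← h]
      exact (NumberField.InfinitePlace.isReal_mk_iff.mp
        (NumberField.IsTotallyReal.isReal (NumberField.InfinitePlace.mk σ))).symm
    have := hu _ hne
    rw [hval] at this
    exact (Real.log_neg_iff (hupos σ)).mp this
  have hprod : ∏ σ : F →+* ℂ, |realEmb σ (u : F)| = 1 := by
    have h := Algebra.norm_eq_prod_embeddings ℚ ℂ (u : F)
    have h1 : |Algebra.norm ℚ (u : F)| = 1 := NumberField.isUnit_iff_norm.mp u.isUnit
    have h2 : ((Algebra.norm ℚ (u : F) : ℚ) : ℝ) = ∏ σ : F →+* ℂ, realEmb σ (u : F) := by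
      apply Complex.ofReal_injective
      rw [Complex.ofReal_prod]
      simp only [coe_realEmb]
      rw [Complex.ofReal_ratCast]
      refine h.trans ?_
      exact Fintype.prod_equiv (RingHom.equivRatAlgHom F ℂ).symm _ _ (fun σ => rfl)
    rw [← Finset.abs_prod, ← h2]
    exact_mod_cast h1
  have hge : 1 ≤ |realEmb σ₀ (u : F)| := by
    by_contra h
    push Not at h
    rw [← Finset.mul_prod_erase _ _ (Finset.mem_univ σ₀)] at hprod
    have : ∏ σ ∈ Finset.univ.erase σ₀, |realEmb σ (u : F)| ≤ 1 :=
      Finset.prod_le_one (fun σ _ => (hupos σ).le)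
        fun σ hσ => (hlt σ (Finset.ne_of_mem_erase hσ)).le
    nlinarith [hupos σ₀]
  have hlim : Filter.Tendsto (fun N : ℕ => ∑ σ ∈ Finset.univ.erase σ₀,
      (|realEmb σ (u : F)| ^ 2) ^ N * realEmb σ a) Filter.atTop (nhds 0) := by
    have : (0 : ℝ) = ∑ σ ∈ Finset.univ.erase σ₀, 0 * realEmb σ a := by simp
    rw [this]
    refine tendsto_finsetSum _ fun σ hσ => ?_
    refine (tendsto_pow_atTop_nhds_zero_of_lt_one (by positivity) ?_).mul_const _
    have := hlt σ (Finset.ne_of_mem_erase hσ)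
    have := hupos σ
    nlinarith
  obtain ⟨N, hN⟩ := (hlim.eventually_lt_const (show (0 : ℝ) < -realEmb σ₀ a by linarith)).exists
  refine ⟨(u : F) ^ N, by simp, ?_⟩
  have : ((Algebra.trace ℚ F (((u : F) ^ N) ^ 2 * a) : ℚ) : ℝ) < 0 := by
    rw [trace_eq_sum_realEmb, ← Finset.add_sum_erase _ _ (Finset.mem_univ σ₀)]
    have hterm : ∀ σ : F →+* ℂ, realEmb σ (((u : F) ^ N) ^ 2 * a) =
        (|realEmb σ (u : F)| ^ 2) ^ N * realEmb σ a := by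
      intro σ
      rw [sq_abs, map_mul, map_pow, map_pow, ← pow_mul, ← pow_mul, mul_comm N 2]
    simp only [hterm]
    have h1 : 1 ≤ (|realEmb σ₀ (u : F)| ^ 2) ^ N := one_le_pow₀ (by nlinarith)
    nlinarith
  exact_mod_cast this

end TotallyReal

section Negative

variable {F B : Type*} [Field F] [Ring B] [Algebra F B] [Module.Finite F B]

/-- The determinant is continuous in the real coordinates and equals -1 at diag(1, -1); rational
coordinates are dense, so a negative value occurs on B itself. -/
theorem IsSplittingOver.exists_norm_neg [CharZero F] {φ : F →+* ℝ}
    {ψ : B →+* Matrix (Fin 2) (Fin 2) ℝ} (h : IsSplittingOver φ ψ) :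
    ∃ b : B, φ (redNorm F b) < 0 := by
  let e := Module.finBasis F B
  have hspan : ∀ X : Matrix (Fin 2) (Fin 2) ℝ, ∃ r : Fin (Module.finrank F B) → ℝ,
      X = ∑ i, r i • ψ (e i) := by
    intro X
    have hX : X ∈ Submodule.span ℝ (Set.range ψ) := by rw [h.span]; trivial
    induction hX using Submodule.span_induction with
    | mem A hA =>
      obtain ⟨y, rfl⟩ := hA
      refine ⟨fun i => φ (e.repr y i), ?_⟩
      conv_lhs => rw [← e.sum_repr y]
      rw [map_sum]
      simp only [h.smul]
    | zero => exact ⟨0, by simp⟩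
    | add A B _ _ hA hB =>
      obtain ⟨r, rfl⟩ := hA
      obtain ⟨s, rfl⟩ := hB
      exact ⟨r + s, by simp [add_smul, Finset.sum_add_distrib]⟩
    | smul c A _ hA =>
      obtain ⟨r, rfl⟩ := hA
      exact ⟨c • r, by simp [Finset.smul_sum, smul_smul]⟩
  let f : (Fin (Module.finrank F B) → ℝ) → ℝ := fun r => (∑ i, r i • ψ (e i)).det
  have hf : Continuous f := by
    refine Continuous.matrix_det ?_
    fun_prop
  obtain ⟨r, hr⟩ := hspan !![1, 0; 0, -1]
  have hopen : IsOpen {r | f r < 0} := isOpen_lt hf continuous_const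
  have hd : DenseRange (Pi.map fun (_ : Fin (Module.finrank F B)) (q : ℚ) => (q : ℝ)) :=
    DenseRange.piMap fun _ => Rat.denseRange_cast
  obtain ⟨q, hq⟩ := hd.exists_mem_open hopen ⟨r, by
    show (∑ i, r i • ψ (e i)).det < 0
    rw [← hr]; simp⟩
  refine ⟨∑ i, (q i : F) • e i, ?_⟩
  rw [← h.norm, map_sum]
  simp only [h.smul, map_ratCast]
  exact hq

end Negative

section Star

variable {F : Type*} [Field F] [NumberField F] [NumberField.IsTotallyReal F]
  {B : Type*} [Ring B] [Algebra F B] [Module.Finite F B] [IsQuat F B]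
  [Algebra.IsCentral F B] [Nontrivial B] [StarRing B]

theorem exists_algebraMap_of_commute (x : B) (h : ∀ y : B, y * x = x * y) :
    ∃ c : F, x = c • 1 := by
  have hx : x ∈ Subalgebra.center F B := by
    rw [Subalgebra.mem_center_iff]
    exact h
  rw [Algebra.IsCentral.center_eq_bot F B, Algebra.mem_bot] at hx
  obtain ⟨c, rfl⟩ := hx
  exact ⟨c, Algebra.algebraMap_eq_smul_one c⟩

/-- The involution preserves the centre. If it moved c to c' ≠ c, then b = c - c' would satisfy b^*
= -b, and Tr(b b^*) would be minus a sum of squares of real conjugates, against positivity. -/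
theorem star_smul_one (hpos : IsPositiveInvolution F B) (c : F) :
    star (c • (1 : B)) = c • 1 := by
  have hcomm : ∀ (c : F) (y : B), y * (c • 1) = (c • 1) * y := fun c y => by simp
  obtain ⟨c', hc'⟩ := exists_algebraMap_of_commute (F := F) (star (c • (1 : B))) (by
    intro y
    have := congrArg star (hcomm c (star y))
    simpa only [star_mul, star_star] using this.symm)
  by_cases hcc : c = c'
  · rw [hc', ← hcc]
  exfalso
  have hc'' : star (c' • (1 : B)) = c • 1 := by rw [← hc', star_star]
  have hδ : (c - c') ≠ 0 := sub_ne_zero.mpr hcc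
  have hb : (c - c') • (1 : B) ≠ 0 := by
    rw [Ne, smul_eq_zero]; simp [hδ]
  have h1 := hpos _ hb
  rw [sub_smul, star_sub, hc', hc'', ← sub_smul, ← sub_smul, smul_mul_smul_comm, one_mul,
    redTrace_smul_one] at h1
  have h2 : ((Algebra.trace ℚ F (2 * ((c - c') * (c' - c))) : ℚ) : ℝ) ≤ 0 := by
    rw [trace_eq_sum_realEmb]
    refine Finset.sum_nonpos fun σ _ => ?_
    simp only [map_mul, map_sub, map_ofNat]
    nlinarith [sq_nonneg (realEmb σ c - realEmb σ c')]
  have h3 : (0 : ℝ) < ((Algebra.trace ℚ F (2 * ((c - c') * (c' - c))) : ℚ) : ℝ) := by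
    exact_mod_cast h1
  linarith

theorem star_smul' (hpos : IsPositiveInvolution F B) (c : F) (x : B) :
    star (c • x) = c • star x := by
  have : c • x = (c • 1) * x := by simp
  rw [this, star_mul, star_smul_one hpos]; simp

/-- The reduced norm takes a negative value at a real place, and scaling by c makes the whole trace
of 2 Nr(c b) negative; so b ↦ b̄ is not positive. -/
theorem star_ne_canonInv (hpos : IsPositiveInvolution F B) (σ₀ : F →+* ℂ)
    {ψ : B →+* Matrix (Fin 2) (Fin 2) ℝ} (hψ : IsSplittingOver (realEmb σ₀) ψ) :
    ¬ ∀ b : B, star b = canonInv F b := by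
  intro h
  obtain ⟨b, hb⟩ := hψ.exists_norm_neg
  have hb' : realEmb σ₀ (2 * redNorm F b) < 0 := by
    rw [map_mul, map_ofNat]; linarith
  obtain ⟨c, hc, htr⟩ := exists_pow_mul_trace_neg _ σ₀ hb'
  have hb0 : c • b ≠ 0 := by
    rw [Ne, smul_eq_zero, not_or]
    refine ⟨hc, ?_⟩
    rintro rfl
    simp [redNorm_zero] at hb
  have := hpos _ hb0
  rw [h, redTrace_mul_canonInv_self, redNorm_smul] at this
  rw [mul_left_comm] at htr
  linarith

end Star

section Intertwine

variable {F B : Type*} [Field F] [CharZero F] [Ring B] [Algebra F B] [Module.Finite F B] [IsQuat F B]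

variable (F B) in
/-- The bilinear form `Tr(x y)`. -/
def traceForm : LinearMap.BilinForm F B :=
  LinearMap.mk₂ F (fun x y => redTrace F (x * y))
    (fun x y z => by rw [add_mul, redTrace_add]) (fun c x y => by
      rw [smul_mul_assoc, redTrace_smul, smul_eq_mul])
    (fun x y z => by rw [mul_add, redTrace_add]) (fun c x y => by
      rw [mul_smul_comm, redTrace_smul, smul_eq_mul])

theorem traceForm_nondegenerate : (traceForm F B).Nondegenerate := by
  refine ⟨fun x hx => IsQuat.nondeg (F := F) x hx, fun x hx => IsQuat.nondeg (F := F) x ?_⟩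
  intro y
  rw [redTrace_mul_comm]
  exact hx y

/-- For an automorphism `τ` of a split quaternion algebra there is a nonzero `γ` with
`τ(b) γ = γ b`. -/
theorem exists_intertwiner {φ : F →+* ℝ} {ψ : B →+* Matrix (Fin 2) (Fin 2) ℝ}
    (h : IsSplittingOver φ ψ) (hinj : Function.Injective ψ) (τ : B →ₐ[F] B)
    (hτ : Function.Injective τ) :
    ∃ γ : B, γ ≠ 0 ∧ ∀ b, τ b * γ = γ * b := by
  let e := Module.finBasis F B
  let e' := (traceForm F B).dualBasis traceForm_nondegenerate e
  have he' : ∀ i j, redTrace F (e' i * e j) = if j = i then 1 else 0 := fun i j =>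
    LinearMap.BilinForm.apply_dualBasis_left traceForm_nondegenerate e i j
  have hexp : ∀ x, x = ∑ j, redTrace F (e' j * x) • e j := by
    intro x
    refine e.ext_elem fun i => ?_
    simp only [map_sum, map_smul, Finsupp.coe_finsetSum, Finset.sum_apply, Finsupp.smul_apply,
      e.repr_self, Finsupp.single_apply, smul_eq_mul, mul_ite, mul_one, mul_zero,
      Finset.sum_ite_eq', Finset.mem_univ, if_true]
    conv_rhs => rw [← e.sum_repr x]
    rw [Finset.mul_sum]
    rw [show redTrace F (∑ j, e' i * (e.repr x) j • e j) =
      redTraceLin F B (∑ j, e' i * (e.repr x) j • e j) from rfl, map_sum]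
    simp [he']
  have hexp' : ∀ x, x = ∑ j, redTrace F (x * e j) • e' j := by
    intro x
    refine sub_eq_zero.mp (IsQuat.nondeg (F := F) _ fun y => ?_)
    rw [hexp y, ← redTraceLin_apply, Finset.mul_sum, map_sum]
    refine Finset.sum_eq_zero fun i _ => ?_
    rw [mul_smul_comm, map_smul, sub_mul, Finset.sum_mul, map_sub, map_sum]
    simp [he']
  -- Averaging over trace-dual bases, as for Skolem–Noether: every g c intertwines, so it suffices
  -- that g does not vanish identically.
  let g : B → B := fun c => ∑ i, τ (e i) * c * e' i
  have hg : ∀ c b, τ b * g c = g c * b := by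
    intro c b
    have h1 : ∀ i, τ b * (τ (e i) * c * e' i) =
        ∑ j, redTrace F (e' j * (b * e i)) • (τ (e j) * c * e' i) := by
      intro i
      rw [← mul_assoc, ← mul_assoc, ← map_mul]
      conv_lhs => rw [hexp (b * e i)]
      simp [map_sum, Finset.sum_mul]
    have h2 : ∀ j, τ (e j) * c * e' j * b =
        ∑ i, redTrace F (e' j * (b * e i)) • (τ (e j) * c * e' i) := by
      intro j
      rw [mul_assoc _ (e' j) b]
      conv_lhs => rw [hexp' (e' j * b)]
      simp [Finset.mul_sum, mul_assoc]
    simp only [g]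
    rw [Finset.mul_sum, Finset.sum_mul]
    simp only [h1, h2]
    exact Finset.sum_comm
  by_contra hcon
  push Not at hcon
  have hg0 : ∀ c, g c = 0 := by
    intro c
    by_contra h0
    obtain ⟨b, hb⟩ := hcon (g c) h0
    exact hb (hg c b)
  have hC : ∀ C : Matrix (Fin 2) (Fin 2) ℝ, ∑ i, ψ (τ (e i)) * C * ψ (e' i) = 0 := by
    intro C
    have hX : C ∈ Submodule.span ℝ (Set.range ψ) := by rw [h.span]; trivial
    induction hX using Submodule.span_induction with
    | mem A hA =>
      obtain ⟨c, rfl⟩ := hA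
      have := congrArg ψ (hg0 c)
      simpa [g, map_sum] using this
    | zero => simp
    | add A B _ _ hA hB => simp [mul_add, add_mul, Finset.sum_add_distrib, hA, hB]
    | smul c A _ hA =>
      simp only [mul_smul_comm, smul_mul_assoc, ← Finset.smul_sum, hA, smul_zero]
  have hcard : Fintype.card (Fin (Module.finrank F B)) =
      Module.finrank ℝ (Matrix (Fin 2) (Fin 2) ℝ) := by
    rw [Module.finrank_matrix]; simp [IsQuat.finrank (F := F) (B := B)]
  have hli : LinearIndependent ℝ fun i => ψ (e' i) := by
    refine linearIndependent_of_top_le_span_of_card_eq_finrank ?_ hcard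
    rw [← h.span, Submodule.span_le]
    rintro _ ⟨b, rfl⟩
    rw [hexp' b, map_sum]
    refine Submodule.sum_mem _ fun i _ => ?_
    rw [h.smul]
    exact Submodule.smul_mem _ _ (Submodule.subset_span ⟨i, rfl⟩)
  rw [Fintype.linearIndependent_iff] at hli
  have hpos : 0 < Module.finrank F B := by rw [IsQuat.finrank (F := F) (B := B)]; norm_num
  let i₀ : Fin (Module.finrank F B) := ⟨0, hpos⟩
  -- On matrix units the vanishing sum becomes linear relations among the ψ(e' i), whose
  -- coefficients are the entries of the ψ(τ(e i)).
  have : ψ (τ (e i₀)) = 0 := by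
    ext a j
    refine hli (fun i => ψ (τ (e i)) a j) ?_ i₀
    ext k b
    have := congrFun (congrFun (hC (Matrix.single j k 1)) a) b
    simpa [Matrix.sum_apply, Matrix.mul_apply, Matrix.single_apply, ite_and, Finset.sum_ite_eq] using this
  exact e.ne_zero i₀ (hτ (by rw [map_zero]; exact hinj (by rw [this, map_zero])))

/-- An intertwiner is invertible. -/
theorem redNorm_ne_zero_of_intertwiner {φ : F →+* ℝ} {ψ : B →+* Matrix (Fin 2) (Fin 2) ℝ}
    (h : IsSplittingOver φ ψ) (hinj : Function.Injective ψ) (τ : B →ₐ[F] B) {γ : B} (hγ : γ ≠ 0)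
    (hγτ : ∀ b, τ b * γ = γ * b) : redNorm F γ ≠ 0 := by
  intro h0
  -- If Nr γ = 0, then γ c γ̄ = τ(c) γ γ̄ = 0 for all c in B, and by spanning the same holds for all
  -- real matrices.
  have key : ∀ X : Matrix (Fin 2) (Fin 2) ℝ, ψ γ * X * (ψ γ).adjugate = 0 := by
    intro X
    have hX : X ∈ Submodule.span ℝ (Set.range ψ) := by rw [h.span]; trivial
    induction hX using Submodule.span_induction with
    | mem A hA =>
      obtain ⟨c, rfl⟩ := hA
      rw [← h.map_canonInv, ← map_mul, ← map_mul, ← hγτ, mul_assoc, IsQuat.mul_canonInv, h0]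
      simp
    | zero => simp
    | add A B _ _ hA hB => simp [mul_add, add_mul, hA, hB]
    | smul c A _ hA => simp only [mul_smul_comm, smul_mul_assoc, hA, smul_zero]
  apply hγ
  apply hinj
  rw [map_zero]
  by_contra hne
  obtain ⟨a, j, haj⟩ : ∃ a j, ψ γ a j ≠ 0 := by
    by_contra hcon
    push Not at hcon
    exact hne (Matrix.ext hcon)
  have hadj : (ψ γ).adjugate = 0 := by
    ext k b
    have := congrFun (congrFun (key (Matrix.single j k 1)) a) b
    have h2 : ψ γ a j * (ψ γ).adjugate k b = 0 := by
      simpa [Matrix.mul_apply, Matrix.single_apply, ite_and, Finset.sum_ite_eq] using this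
    exact (mul_eq_zero.mp h2).resolve_left haj
  have h3 := congrArg Matrix.adjugate hadj
  have hA : (ψ γ).adjugate.adjugate = ψ γ := by
    rw [← h.map_canonInv, ← h.map_canonInv, canonInv_canonInv]
  rw [hA] at h3
  rw [h3] at haj
  apply haj
  rw [Matrix.adjugate_fin_two]
  fin_cases a <;> fin_cases j <;> simp

end Intertwine

section Twisting

variable {F : Type*} [Field F] [NumberField F] [NumberField.IsTotallyReal F]
  {B : Type*} [Ring B] [Algebra F B] [Module.Finite F B] [IsQuat F B]
  [Algebra.IsCentral F B] [IsSimpleRing B] [StarRing B]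

/-- The composite of the two involutions is an F-automorphism, hence conjugation by some γ. That *
has order two forces γ⁻¹γ̄ to be central, so γ̄ = ±γ; the sign is decided by positivity. -/
theorem exists_isTwistingElement (hind : IsTotallyIndefinite F B)
    (hpos : IsPositiveInvolution F B) : ∃ γ : Bˣ, IsTwistingElement F γ := by
  obtain ⟨σ₀⟩ : Nonempty (F →+* ℂ) := inferInstance
  obtain ⟨ψ, hψ⟩ := exists_isSplittingOver hind (realEmb σ₀)
  have hinj : Function.Injective ψ := ψ.injective
  let τ : B →ₐ[F] B := AlgHom.ofLinearMap
    { toFun := fun b => star (canonInv F b)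
      map_add' := fun x y => by rw [canonInv_add, star_add]
      map_smul' := fun c x => by rw [canonInv_smul, star_smul' hpos]; rfl }
    (by simp [canonInv_one]) (fun x y => by simp [IsQuat.canonInv_mul])
  have hτ : ∀ b, τ b = star (canonInv F b) := fun b => rfl
  have hτinj : Function.Injective τ := by
    intro x y hxy
    rw [hτ, hτ] at hxy
    have := congrArg (canonInv F) (star_injective hxy)
    rwa [canonInv_canonInv, canonInv_canonInv] at this
  obtain ⟨γ, hγ0, hγ⟩ := exists_intertwiner hψ hinj τ hτinj
  have hn := redNorm_ne_zero_of_intertwiner hψ hinj τ hγ0 hγ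
  have h1 := mul_quatInv hn
  have h2 := quatInv_mul hn
  have hstar : ∀ b, star b = γ * canonInv F b * quatInv (F := F) γ := by
    intro b
    rw [← hγ, hτ, canonInv_canonInv, mul_assoc, h1, mul_one]
  have hstar' : ∀ b, star b * γ = γ * canonInv F b := by
    intro b
    rw [hstar, mul_assoc, h2, mul_one]
  have hcomm : ∀ b, b * (quatInv (F := F) γ * canonInv F γ) =
      (quatInv (F := F) γ * canonInv F γ) * b := by
    intro b
    have h3 := hstar' (star b)
    rw [star_star] at h3
    have h4 : canonInv F (star b * γ) = canonInv F (γ * canonInv F b) := by rw [hstar']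
    rw [IsQuat.canonInv_mul, IsQuat.canonInv_mul, canonInv_canonInv] at h4
    have h5 : canonInv F (star b) = quatInv (F := F) γ * b * γ := by
      rw [mul_assoc, h3, ← mul_assoc, h2, one_mul]
    rw [h5] at h4
    have h6 : quatInv (F := F) γ * canonInv F γ = canonInv F γ * quatInv (F := F) γ := by
      rw [quatInv]; simp
    rw [h6]
    calc b * (canonInv F γ * quatInv (F := F) γ) = b * canonInv F γ * quatInv (F := F) γ := by
          rw [mul_assoc]
      _ = canonInv F γ * (quatInv (F := F) γ * b * γ) * quatInv (F := F) γ := by rw [h4]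
      _ = canonInv F γ * quatInv (F := F) γ * b * (γ * quatInv (F := F) γ) := by
          simp only [mul_assoc]
      _ = _ := by rw [h1, mul_one]
  obtain ⟨c, hc⟩ := exists_algebraMap_of_commute (F := F) _ hcomm
  have hc1 : canonInv F γ = c • γ := by
    have : γ * (quatInv (F := F) γ * canonInv F γ) = canonInv F γ := by
      rw [← mul_assoc, h1, one_mul]
    rw [← this, hc]; simp
  have hc2 : c * c = 1 := by
    have := congrArg (canonInv F) hc1
    rw [canonInv_canonInv, canonInv_smul, hc1, smul_smul] at this
    have h7 : (1 - c * c) • γ = 0 := by rw [sub_smul, one_smul, ← this, sub_self]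
    rw [smul_eq_zero] at h7
    have := h7.resolve_right hγ0
    linear_combination -this
  refine ⟨⟨γ, quatInv (F := F) γ, h1, h2⟩, ?_, hstar⟩
  show canonInv F γ + γ = 0
  rcases mul_self_eq_one_iff.mp hc2 with rfl | rfl
  -- γ̄ = γ would make γ a scalar and * the canonical involution, which is not positive.
  · exfalso
    rw [one_smul, canonInv_def] at hc1
    have h8 : γ = ((2 : F)⁻¹ * redTrace F γ) • 1 := by
      rw [mul_smul, sub_eq_iff_eq_add.mp hc1, ← two_smul F γ, smul_smul,
        inv_mul_cancel₀ two_ne_zero, one_smul]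
    apply star_ne_canonInv hpos σ₀ hψ
    intro b
    have h9 : γ * canonInv F b = canonInv F b * γ := by rw [h8]; simp
    rw [hstar, h9, mul_assoc, h1, mul_one]
  · rw [hc1]; simp

end Twisting

/-! ### Discrete valuations with finite residue field -/

/-- A discrete valuation with uniformizer `π` and the two properties of its finite residue field
that are needed. -/
structure IsFiniteDVR {F : Type*} [Field F] (w : Valuation F ℤᵐ⁰) (π : F) : Prop where
  uniformizer : w π = exp (-1 : ℤ)
  ternary : ∀ a b c d e f : F, w a ≤ 1 → w b ≤ 1 → w c ≤ 1 → w d ≤ 1 → w e ≤ 1 → w f ≤ 1 →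
    ∃ x y z : F, w x ≤ 1 ∧ w y ≤ 1 ∧ w z ≤ 1 ∧ (w x = 1 ∨ w y = 1 ∨ w z = 1) ∧
      w (a * x ^ 2 + b * y ^ 2 + c * z ^ 2 + d * (x * y) + e * (x * z) + f * (y * z)) < 1
  sqrt : w 2 < 1 → ∀ a : F, w a ≤ 1 → ∃ s, w s ≤ 1 ∧ w (a - s ^ 2) < 1

section Valuation

variable {F : Type*} [Field F] {w : Valuation F ℤᵐ⁰} {π : F} (hw : IsFiniteDVR w π)

include hw

theorem IsFiniteDVR.ne_zero : π ≠ 0 := by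
  intro h
  have := hw.uniformizer
  rw [h, map_zero] at this
  exact WithZero.coe_ne_zero this.symm

theorem IsFiniteDVR.lt_one_iff (x : F) : w x < 1 ↔ w (π⁻¹ * x) ≤ 1 := by
  rw [map_mul, map_inv₀, hw.uniformizer, ← WithZero.exp_neg, neg_neg]
  by_cases hx : w x = 0
  · simp [hx]
  · obtain ⟨n, hn⟩ : ∃ n : ℤ, w x = exp n := ⟨log (w x), (WithZero.exp_log hx).symm⟩
    rw [hn, ← WithZero.exp_add, ← WithZero.exp_zero, WithZero.exp_lt_exp, WithZero.exp_le_exp]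
    omega

theorem IsFiniteDVR.zpow (n : ℤ) : w (π ^ n) = exp (-n) := by
  rw [map_zpow₀, hw.uniformizer, ← WithZero.exp_zsmul]; simp

theorem IsFiniteDVR.pow (n : ℕ) : w (π ^ n) = exp (-n : ℤ) := by
  rw [← zpow_natCast, hw.zpow]

theorem IsFiniteDVR.lt_one : w π < 1 := by
  rw [hw.uniformizer, ← WithZero.exp_zero, WithZero.exp_lt_exp]; norm_num

theorem IsFiniteDVR.exists_exp {x : F} (hx : x ≠ 0) : ∃ n : ℤ, w x = exp n :=
  ⟨log (w x), (WithZero.exp_log (by simpa using hx)).symm⟩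

theorem IsFiniteDVR.exists_pow_lt {x : F} (hx : x ≠ 0) : ∃ N : ℕ, w (π ^ N) < w x := by
  obtain ⟨n, hn⟩ := hw.exists_exp hx
  refine ⟨(1 - n).toNat, ?_⟩
  rw [hw.pow, hn, WithZero.exp_lt_exp]
  have := Int.self_le_toNat (1 - n)
  omega

omit hw in
theorem val_sq_lt_one {x : F} (h : w x < 1) : w (x ^ 2) < 1 := by
  rw [map_pow]; exact pow_lt_one₀ zero_le h two_ne_zero

omit hw in
theorem val_mul_lt_one {x y : F} (hx : w x ≤ 1) (hy : w y < 1) : w (x * y) < 1 := by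
  rw [map_mul]; exact mul_lt_one_of_nonneg_of_lt_one_right hx zero_le hy

omit hw in
theorem val_mul_le_one {x y : F} (hx : w x ≤ 1) (hy : w y ≤ 1) : w (x * y) ≤ 1 := by
  rw [map_mul]; exact mul_le_one' hx hy

omit hw in
theorem val_sub_lt_one {x y : F} (hx : w x < 1) (hy : w y < 1) : w (x - y) < 1 :=
  lt_of_le_of_lt (w.map_sub _ _) (max_lt hx hy)

omit hw in
theorem val_add_le_one {x y : F} (hx : w x ≤ 1) (hy : w y ≤ 1) : w (x + y) ≤ 1 :=
  (w.map_add _ _).trans (max_le hx hy)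

omit hw in
theorem val_add_lt_one {x y : F} (hx : w x < 1) (hy : w y < 1) : w (x + y) < 1 :=
  lt_of_le_of_lt (w.map_add _ _) (max_lt hx hy)

omit hw in
theorem val_eq_one_of_sub_lt {x y : F} (hx : w x = 1) (h : w (x - y) < 1) : w y = 1 := by
  have : w (y - x) < w x := by rw [hx, Valuation.map_sub_swap]; exact h
  have h2 := w.map_add_eq_of_lt_left this
  rw [← hx, ← h2]; congr 1; ring

end Valuation

/-! ### Lattices and maximal orders over a discrete valuation ring -/

section Scaled

variable {F B : Type*} [Field F] [Ring B] [Algebra F B]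

/-- The set `c Λ`, for `c ≠ 0`. -/
def scaled (Λ : Subring B) (c : F) : AddSubgroup B where
  carrier := {x | c⁻¹ • x ∈ Λ}
  zero_mem' := by simp
  add_mem' := fun {x y} hx hy => by
    show c⁻¹ • (x + y) ∈ Λ
    rw [smul_add]; exact add_mem hx hy
  neg_mem' := fun {x} hx => by
    show c⁻¹ • (-x) ∈ Λ
    rw [smul_neg]; exact neg_mem hx

theorem mem_scaled {Λ : Subring B} {c : F} {x : B} : x ∈ scaled Λ c ↔ c⁻¹ • x ∈ Λ := Iff.rfl

theorem mul_mem_scaled_left {Λ : Subring B} {c : F} {x y : B} (hy : y ∈ Λ)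
    (hx : x ∈ scaled Λ c) : y * x ∈ scaled Λ c := by
  rw [mem_scaled, ← mul_smul_comm]; exact mul_mem hy hx

theorem mul_mem_scaled_right {Λ : Subring B} {c : F} {x y : B} (hx : x ∈ scaled Λ c)
    (hy : y ∈ Λ) : x * y ∈ scaled Λ c := by
  rw [mem_scaled, ← smul_mul_assoc]; exact mul_mem hx hy

theorem smul_mem_scaled {Λ : Subring B} {c : F} (hc : c ≠ 0) {x : B} (hx : x ∈ Λ) :
    c • x ∈ scaled Λ c := by
  rwa [mem_scaled, smul_smul, inv_mul_cancel₀ hc, one_smul]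

end Scaled

/-- A maximal order over a discrete valuation ring. -/
structure LocalOrder {F B : Type*} [Field F] [Ring B] [Algebra F B] (w : Valuation F ℤᵐ⁰) (π : F)
    (Λ : Subring B) : Prop extends IsFiniteDVR w π where
  smul_mem : ∀ (c : F) (x : B), w c ≤ 1 → x ∈ Λ → c • x ∈ Λ
  trace_le : ∀ x ∈ Λ, w (redTrace F x) ≤ 1
  norm_le : ∀ x ∈ Λ, w (redNorm F x) ≤ 1
  exists_pow_smul_mem : ∀ x : B, ∃ N : ℕ, π ^ N • x ∈ Λ
  finite_reps : ∃ s : Finset B, ∀ x ∈ Λ, ∃ y ∈ s, x - y ∈ scaled Λ π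
  maximal : ∀ Λ' : Subring B, Λ ≤ Λ' → (∃ N : ℕ, ∀ x ∈ Λ', π ^ N • x ∈ Λ) → Λ' ≤ Λ

namespace LocalOrder

variable {F B : Type*} [Field F] [CharZero F] [Ring B] [Algebra F B] [Module.Finite F B]
  [IsQuat F B] {w : Valuation F ℤᵐ⁰} {π : F} {Λ : Subring B} (h : LocalOrder w π Λ)

include h

theorem smul_one_mem {c : F} (hc : w c ≤ 1) : c • (1 : B) ∈ Λ := h.smul_mem c 1 hc (one_mem _)

theorem canonInv_mem {x : B} (hx : x ∈ Λ) : canonInv F x ∈ Λ := by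
  rw [canonInv_def]; exact sub_mem (h.smul_one_mem (h.trace_le x hx)) hx

theorem mem_scaled_one {x : B} : x ∈ scaled Λ (1 : F) ↔ x ∈ Λ := by
  rw [mem_scaled, inv_one, one_smul]

theorem smul_mem_scaled_of_lt {c : F} (hc : w c < 1) {x : B} (hx : x ∈ Λ) :
    c • x ∈ scaled Λ π := by
  rw [mem_scaled, smul_smul]
  exact h.smul_mem _ _ ((h.lt_one_iff c).mp hc) hx

theorem smul_mem_scaled' {c a : F} (hc : w c ≤ 1) {x : B} (hx : x ∈ scaled Λ a) :
    c • x ∈ scaled Λ a := by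
  rw [mem_scaled, smul_comm]
  exact h.smul_mem _ _ hc hx

theorem norm_lt_of_mem_scaled {x : B} (hx : x ∈ scaled Λ π) : w (redNorm F x) < 1 := by
  have := h.norm_le _ hx
  rw [redNorm_smul, sq, mul_assoc] at this
  have h2 := (h.lt_one_iff _).mpr this
  have h3 := val_mul_lt_one h.lt_one.le h2
  rwa [← mul_assoc, mul_inv_cancel₀ h.ne_zero, one_mul] at h3

theorem one_notMem_scaled : (1 : B) ∉ scaled Λ π := by
  intro h1
  have := h.norm_lt_of_mem_scaled h1
  rw [IsQuat.redNorm_one, map_one] at this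
  exact lt_irrefl _ this

theorem quatInv_mem {x : B} (hx : x ∈ Λ) (hn : w (redNorm F x) = 1) : quatInv (F := F) x ∈ Λ := by
  rw [quatInv]
  exact h.smul_mem _ _ (by rw [map_inv₀, hn, inv_one]) (h.canonInv_mem hx)

omit h in
theorem norm_ne_zero {x : B} (hn : w (redNorm F x) = 1) : redNorm F x ≠ 0 := by
  intro h0; rw [h0, map_zero] at hn; exact zero_ne_one hn

/-- If x were divisible by all powers of π in Λ, then Tr(x y) would be too for each y, hence zero,
against nondegeneracy of the trace form. -/
theorem exists_notMem_scaled {x : B} (hx : x ≠ 0) : ∃ N : ℕ, x ∉ scaled Λ (π ^ N) := by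
  by_contra hcon
  push Not at hcon
  refine hx (IsQuat.nondeg (F := F) x fun y => ?_)
  by_contra hne
  obtain ⟨M, hM⟩ := h.exists_pow_smul_mem y
  have hne' : redTrace F (x * π ^ M • y) ≠ 0 := by
    rw [mul_smul_comm, redTrace_smul]
    exact mul_ne_zero (pow_ne_zero _ h.ne_zero) hne
  obtain ⟨N, hN⟩ := h.exists_pow_lt hne'
  have := h.trace_le _ (mul_mem (hcon N) hM)
  rw [smul_mul_assoc, redTrace_smul, map_mul, map_inv₀] at this
  have hpos : 0 < w (π ^ N) := by rw [zero_lt_iff]; simpa using pow_ne_zero N h.ne_zero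
  exact absurd ((inv_mul_le_one₀ hpos).mp this) (not_le.mpr hN)

/-- Every nonzero element becomes primitive after scaling by a power of `π`. -/
theorem exists_primitive {x : B} (hx : x ≠ 0) :
    ∃ c : F, c ≠ 0 ∧ c • x ∈ Λ ∧ c • x ∉ scaled Λ π := by
  classical
  obtain ⟨M, hM⟩ := h.exists_pow_smul_mem x
  have hx' : π ^ M • x ≠ 0 := by
    rw [Ne, smul_eq_zero, not_or]; exact ⟨pow_ne_zero _ h.ne_zero, hx⟩
  have hex := h.exists_notMem_scaled hx'
  let N := Nat.find hex
  have hN : π ^ M • x ∉ scaled Λ (π ^ N) := Nat.find_spec hex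
  have hN0 : N ≠ 0 := by
    intro h0
    rw [h0, pow_zero] at hN
    exact hN (h.mem_scaled_one.mpr hM)
  obtain ⟨K, hK⟩ := Nat.exists_eq_succ_of_ne_zero hN0
  have hK' : π ^ M • x ∈ scaled Λ (π ^ K) := by
    by_contra hcon
    have := Nat.find_min' hex hcon
    omega
  refine ⟨(π ^ K)⁻¹ * π ^ M, ?_, ?_, ?_⟩
  · exact mul_ne_zero (inv_ne_zero (pow_ne_zero _ h.ne_zero)) (pow_ne_zero _ h.ne_zero)
  · rw [mul_smul]; exact hK'
  · intro hcon
    apply hN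
    rw [hK, mem_scaled, pow_succ, mul_inv, mul_comm, mul_smul]
    rwa [mem_scaled, mul_smul] at hcon

/-- The order is not spanned by two elements modulo `π`. -/
theorem exists_notMem_span_pair (e₁ e₂ : B) :
    ∃ x ∈ Λ, ∀ a b : F, w a ≤ 1 → w b ≤ 1 → x - a • e₁ - b • e₂ ∉ scaled Λ π := by
  by_contra hcon
  push Not at hcon
  -- Dimension four against two conditions: some c ≠ 0 is trace-orthogonal to e₁ and e₂.
  let f : B →ₗ[F] F × F :=
    ((redTraceLin F B).comp (LinearMap.mulRight F e₁)).prod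
      ((redTraceLin F B).comp (LinearMap.mulRight F e₂))
  have hker : ¬ Function.Injective f := by
    intro hf
    have := LinearMap.finrank_le_finrank_of_injective hf
    rw [IsQuat.finrank (F := F) (B := B), Module.finrank_prod, Module.finrank_self] at this
    omega
  rw [← LinearMap.ker_eq_bot, Submodule.eq_bot_iff] at hker
  push Not at hker
  obtain ⟨c, hc, hc0⟩ := hker
  have hc1 : redTrace F (c * e₁) = 0 := congrArg Prod.fst (LinearMap.mem_ker.mp hc)
  have hc2 : redTrace F (c * e₂) = 0 := congrArg Prod.snd (LinearMap.mem_ker.mp hc)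
  obtain ⟨M, hM⟩ := h.exists_pow_smul_mem c
  -- If e₁ and e₂ spanned Λ modulo π, each reduction would gain a factor π, starting from the
  -- denominator π ^ M of c; in the limit Tr(c Λ) = 0.
  have key : ∀ N : ℕ, ∀ x ∈ Λ, w (redTrace F (c * x)) ≤ exp ((M : ℤ) - N) := by
    intro N
    induction N with
    | zero =>
      intro x hx
      have := h.trace_le _ (mul_mem hM hx)
      rw [smul_mul_assoc, redTrace_smul, map_mul, h.pow] at this
      have h2 := mul_le_mul_right this (exp (M : ℤ))
      rw [← mul_assoc, ← WithZero.exp_add, add_neg_cancel, WithZero.exp_zero, one_mul,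
        mul_one] at h2
      simpa using h2
    | succ N ih =>
      intro x hx
      obtain ⟨a, b, ha, hb, hab⟩ := hcon x hx
      have h1 := ih _ hab
      rw [mul_smul_comm, redTrace_smul, mul_sub, mul_sub, redTrace_sub, redTrace_sub,
        mul_smul_comm, mul_smul_comm, redTrace_smul, redTrace_smul, hc1, hc2, mul_zero, mul_zero,
        sub_zero, sub_zero, map_mul, map_inv₀, h.uniformizer, ← WithZero.exp_neg, neg_neg] at h1
      have h2 := mul_le_mul_right h1 (exp (-1 : ℤ))
      rw [← mul_assoc, ← WithZero.exp_add, neg_add_cancel, WithZero.exp_zero, one_mul,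
        ← WithZero.exp_add] at h2
      convert h2 using 2
      push_cast; ring
  refine hc0 (IsQuat.nondeg (F := F) c fun y => ?_)
  by_contra hne
  obtain ⟨M', hM'⟩ := h.exists_pow_smul_mem y
  have hne' : redTrace F (c * π ^ M' • y) ≠ 0 := by
    rw [mul_smul_comm, redTrace_smul]
    exact mul_ne_zero (pow_ne_zero _ h.ne_zero) hne
  obtain ⟨n, hn⟩ := h.exists_exp hne'
  have := key ((M - n + 1).toNat) _ hM'
  rw [hn, WithZero.exp_le_exp] at this
  have := Int.self_le_toNat (M - n + 1)
  omega

end LocalOrder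

/-- No element of `Λ` is a nontrivial idempotent modulo `π`. -/
def NoIdempotent {F B : Type*} [Field F] [Ring B] [Algebra F B] (w : Valuation F ℤᵐ⁰)
    (Λ : Subring B) : Prop :=
  ∀ z ∈ Λ, w (redNorm F z) < 1 → w (redTrace F z) < 1

/-! ### The ramified case: no idempotents modulo π -/

namespace LocalOrder

variable {F B : Type*} [Field F] [CharZero F] [Ring B] [Algebra F B] [Module.Finite F B]
  [IsQuat F B] {w : Valuation F ℤᵐ⁰} {π : F} {Λ : Subring B} (h : LocalOrder w π Λ)
  (hR : NoIdempotent w Λ)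

include h hR

/-- The cross term is Tr(x ȳ), and x ȳ has non-unit norm, so `NoIdempotent` applies to it. With the
next two lemmas, the elements of non-unit norm form a two-sided ideal J of Λ. -/
theorem norm_add_lt {x y : B} (hx : x ∈ Λ) (hy : y ∈ Λ) (hnx : w (redNorm F x) < 1)
    (hny : w (redNorm F y) < 1) : w (redNorm F (x + y)) < 1 := by
  rw [IsQuat.redNorm_add]
  refine val_add_lt_one (val_add_lt_one hnx hny) (hR _ (mul_mem hx (h.canonInv_mem hy)) ?_)
  rw [IsQuat.redNorm_mul, redNorm_canonInv]
  exact val_mul_lt_one hnx.le hny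

omit hR in
theorem norm_mul_lt_right {x y : B} (hx : x ∈ Λ) (hny : w (redNorm F y) < 1) :
    w (redNorm F (x * y)) < 1 := by
  rw [IsQuat.redNorm_mul]
  exact val_mul_lt_one (h.norm_le x hx) hny

omit hR in
theorem norm_mul_lt_left {x y : B} (hx : w (redNorm F x) < 1) (hy : y ∈ Λ) :
    w (redNorm F (x * y)) < 1 := by
  rw [IsQuat.redNorm_mul, mul_comm]
  exact val_mul_lt_one (h.norm_le y hy) hx

theorem norm_one_sub {y : B} (hy : y ∈ Λ) (hny : w (redNorm F y) < 1) :
    w (redNorm F (1 - y)) = 1 := by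
  have h1 : redNorm F (1 - y) = 1 + redNorm F y - redTrace F y := by
    rw [sub_eq_add_neg, IsQuat.redNorm_add, IsQuat.redNorm_one, redNorm_neg, canonInv_neg,
      one_mul, redTrace_neg, redTrace_canonInv, sub_eq_add_neg]
  refine val_eq_one_of_sub_lt (x := (1 : F)) (map_one w) ?_
  rw [h1, show (1 : F) - (1 + redNorm F y - redTrace F y) = redTrace F y - redNorm F y by ring]
  exact val_sub_lt_one (hR y hy hny) hny

/-- The non-units of `Λ` have a nonzero left annihilator modulo `π`. -/
theorem exists_annihilator : ∃ x ∈ Λ, x ∉ scaled Λ π ∧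
    ∀ y ∈ Λ, w (redNorm F y) < 1 → x * y ∈ scaled Λ π := by
  classical
  obtain ⟨s, hs⟩ := h.finite_reps
  -- S x records the residues of x J modulo π, where J is the ideal of non-units. While x J is not
  -- inside π Λ, replacing x by some x y with y ∈ J shrinks this finite set.
  let S : B → Finset B := fun x =>
    s.filter fun r => ∃ y ∈ Λ, w (redNorm F y) < 1 ∧ r - x * y ∈ scaled Λ π
  have key : ∀ n : ℕ, ∀ x ∈ Λ, x ∉ scaled Λ π → (S x).card = n → ∃ x ∈ Λ, x ∉ scaled Λ π ∧
      ∀ y ∈ Λ, w (redNorm F y) < 1 → x * y ∈ scaled Λ π := by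
    intro n
    induction n using Nat.strong_induction_on with
    | _ n ih =>
      intro x hx hxn hcard
      by_cases hdone : ∀ y ∈ Λ, w (redNorm F y) < 1 → x * y ∈ scaled Λ π
      · exact ⟨x, hx, hxn, hdone⟩
      push Not at hdone
      obtain ⟨y, hy, hny, hxy⟩ := hdone
      refine ih (S (x * y)).card ?_ (x * y) (mul_mem hx hy) hxy rfl
      rw [← hcard]
      refine Finset.card_lt_card ⟨?_, ?_⟩
      · intro r hr
        rw [Finset.mem_filter] at hr ⊢
        obtain ⟨hrs, y', hy', hny', hr⟩ := hr
        exact ⟨hrs, y * y', mul_mem hy hy', h.norm_mul_lt_right hy hny', by rwa [← mul_assoc]⟩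
      · intro hsub
        obtain ⟨r, hrs, hr⟩ := hs (x * y) (mul_mem hx hy)
        have hr1 : r ∈ S x := Finset.mem_filter.mpr ⟨hrs, y, hy, hny, by
          rw [← neg_sub]; exact neg_mem hr⟩
        obtain ⟨-, y', hy', hny', hr2⟩ := Finset.mem_filter.mp (hsub hr1)
        -- Nakayama: if x y were still in x y J modulo π, then x y (1 - y') ∈ π Λ with 1 - y' a
        -- unit, so x y ∈ π Λ.
        have h3 : x * y * (1 - y') ∈ scaled Λ π := by
          have := add_mem hr hr2
          rw [mul_sub, mul_one]
          convert this using 1; abel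
        have h4 := h.norm_one_sub hR hy' hny'
        have h5 := mul_mem_scaled_right h3 (h.quatInv_mem (sub_mem (one_mem _) hy') h4)
        rw [mul_assoc, mul_quatInv (norm_ne_zero h4), mul_one] at h5
        exact hxy h5
  exact key _ 1 (one_mem _) h.one_notMem_scaled rfl

/-- The non-units of `Λ` form a principal ideal. -/
theorem exists_generator : ∃ ϖ ∈ Λ, redNorm F ϖ ≠ 0 ∧ w (redNorm F ϖ) < 1 ∧
    ∀ y ∈ Λ, w (redNorm F y) < 1 → quatInv (F := F) ϖ * y ∈ Λ := by
  obtain ⟨x, hx, hxn, hann⟩ := h.exists_annihilator hR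
  have hb : ∀ y ∈ Λ, w (redNorm F y) < 1 → (π⁻¹ • x) * y ∈ Λ := fun y hy hny => by
    rw [smul_mul_assoc]; exact hann y hy hny
  obtain ⟨ϖ, hP, hnP, hu⟩ : ∃ ϖ ∈ Λ, w (redNorm F ϖ) < 1 ∧
      w (redNorm F ((π⁻¹ • x) * ϖ)) = 1 := by
    by_contra hcon
    push Not at hcon
    -- The left order of J contains Λ and is bounded because π ∈ J, so by maximality it is Λ. If no
    -- product (π⁻¹x)ϖ were a unit, π⁻¹x would belong to it, against x ∉ π Λ.
    let Λ' : Subring B :=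
      { carrier := {c | ∀ y ∈ Λ, w (redNorm F y) < 1 → c * y ∈ Λ ∧ w (redNorm F (c * y)) < 1}
        mul_mem' := fun {a b} ha hb y hy hny => by
          rw [mul_assoc]
          exact ha _ (hb y hy hny).1 (hb y hy hny).2
        one_mem' := fun y hy hny => by rw [one_mul]; exact ⟨hy, hny⟩
        add_mem' := fun {a b} ha hb y hy hny => by
          rw [add_mul]
          exact ⟨add_mem (ha y hy hny).1 (hb y hy hny).1, h.norm_add_lt hR (ha y hy hny).1
            (hb y hy hny).1 (ha y hy hny).2 (hb y hy hny).2⟩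
        zero_mem' := fun y hy hny => by
          rw [zero_mul, redNorm_zero, map_zero]; exact ⟨zero_mem _, zero_lt_one⟩
        neg_mem' := fun {a} ha y hy hny => by
          rw [neg_mul, redNorm_neg]
          exact ⟨neg_mem (ha y hy hny).1, (ha y hy hny).2⟩ }
    refine hxn (h.maximal Λ' (fun c hc y hy hny => ⟨mul_mem hc hy, h.norm_mul_lt_right hc hny⟩)
      ⟨1, fun c hc => ?_⟩ (fun y hy hny => ⟨hb y hy hny,
        lt_of_le_of_ne (h.norm_le _ (hb y hy hny)) (hcon y hy hny)⟩))
    have := (hc (π • 1) (h.smul_one_mem h.lt_one.le) (by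
      rw [redNorm_smul_one]; exact val_sq_lt_one h.lt_one)).1
    simpa using this
  have hu' := hb ϖ hP hnP
  have hu0 := norm_ne_zero hu
  have hP0 : redNorm F ϖ ≠ 0 := by
    intro h0
    rw [IsQuat.redNorm_mul, h0, mul_zero] at hu0
    exact hu0 rfl
  refine ⟨ϖ, hP, hP0, hnP, fun y hy hny => ?_⟩
  -- As u = (π⁻¹x)ϖ is a unit of Λ, ϖ⁻¹ = u⁻¹(π⁻¹x), and π⁻¹x carries J into Λ.
  have hinv : quatInv (F := F) ϖ = quatInv (F := F) ((π⁻¹ • x) * ϖ) * (π⁻¹ • x) := by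
    have h1 := quatInv_mul hu0
    rw [← mul_assoc] at h1
    calc quatInv (F := F) ϖ
        = (quatInv (F := F) ((π⁻¹ • x) * ϖ) * (π⁻¹ • x) * ϖ) * quatInv (F := F) ϖ := by
          rw [h1, one_mul]
      _ = _ := by rw [mul_assoc, mul_quatInv hP0, mul_one]
  rw [hinv, mul_assoc]
  exact mul_mem (h.quatInv_mem hu' hu) (hb y hy hny)

omit hR in
theorem mem_scaled_of_eq {x l y : B} (hl : l ∈ Λ) (hy : y ∈ Λ) (hn : w (redNorm F l) = 1) {q : B}
    (hq : π • 1 = q * l) (hx : x = q * y) : x ∈ scaled Λ π := by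
  have h1 : q = π • quatInv (F := F) l := by
    have := congrArg (· * quatInv (F := F) l) hq
    simp only [mul_assoc, mul_quatInv (norm_ne_zero hn), mul_one] at this
    rw [← this]; simp
  rw [hx, h1, smul_mul_assoc]
  exact smul_mem_scaled h.ne_zero (mul_mem (h.quatInv_mem hl hn) hy)

/-- Write J = ϖΛ and π = ϖ l. The norms of ϖ and l have exponents t ≤ -1 and r ≤ 0 with sum -2, so π
is ϖ or ϖ² times a unit, and x can be divided by the same power of ϖ. -/
theorem mem_scaled_of_norm_le {x : B} (hx : x ∈ Λ) (hn : w (redNorm F x) ≤ w (π ^ 2)) :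
    x ∈ scaled Λ π := by
  obtain ⟨ϖ, hP, hP0, hnP, hgen⟩ := h.exists_generator hR
  have hfac : ∀ y ∈ Λ, w (redNorm F y) < 1 → ∃ l ∈ Λ, y = ϖ * l ∧
      redNorm F y = redNorm F ϖ * redNorm F l := by
    intro y hy hny
    refine ⟨_, hgen y hy hny, by rw [← mul_assoc, mul_quatInv hP0, one_mul], ?_⟩
    rw [← IsQuat.redNorm_mul, ← mul_assoc, mul_quatInv hP0, one_mul]
  have hπ2 : w (π ^ 2) < 1 := val_sq_lt_one h.lt_one
  obtain ⟨l, hl, hπl, hnl⟩ := hfac (π • 1) (h.smul_one_mem h.lt_one.le) (by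
    rw [redNorm_smul_one]; exact hπ2)
  obtain ⟨x₁, hx₁, hxx₁, hnx₁⟩ := hfac x hx (lt_of_le_of_lt hn hπ2)
  rw [redNorm_smul_one] at hnl
  obtain ⟨t, ht⟩ := h.exists_exp hP0
  have hl0 : redNorm F l ≠ 0 := by
    intro h0
    rw [h0, mul_zero] at hnl
    exact pow_ne_zero 2 h.ne_zero hnl
  obtain ⟨r, hr⟩ := h.exists_exp hl0
  have hle := h.norm_le l hl
  have hsum : t + r = -2 := by
    have := congrArg w hnl
    rw [map_mul, ht, hr, h.pow, ← WithZero.exp_add, WithZero.exp_inj] at this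
    push_cast at this
    omega
  rw [hr, ← WithZero.exp_zero, WithZero.exp_le_exp] at hle
  rw [ht, ← WithZero.exp_zero, WithZero.exp_lt_exp] at hnP
  obtain rfl | rfl : r = 0 ∨ r = -1 := by omega
  · exact h.mem_scaled_of_eq hl hx₁ (by rw [hr, WithZero.exp_zero]) hπl hxx₁
  · have ht1 : t = -1 := by omega
    subst ht1
    have hx₁n : w (redNorm F x₁) < 1 := by
      rw [hnx₁, map_mul, ht, h.pow] at hn
      have h2 := mul_le_mul_right hn (exp (1 : ℤ))
      rw [← mul_assoc, ← WithZero.exp_add, ← WithZero.exp_add] at h2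
      norm_num at h2
      refine lt_of_le_of_lt h2 ?_
      rw [← WithZero.exp_neg, ← WithZero.exp_zero, WithZero.exp_lt_exp]; norm_num
    obtain ⟨l', hl', hll', hnl'⟩ := hfac l hl (by
      rw [hr, ← WithZero.exp_zero, WithZero.exp_lt_exp]; norm_num)
    obtain ⟨x₂, hx₂, hxx₂, -⟩ := hfac x₁ hx₁ hx₁n
    refine h.mem_scaled_of_eq (q := ϖ * ϖ) (l := l') (y := x₂) hl' hx₂ ?_
      (by rw [hπl, hll', mul_assoc]) (by rw [hxx₁, hxx₂, mul_assoc])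
    have := congrArg w hnl'
    rw [map_mul, ht, hr] at this
    have h2 := congrArg (exp (1 : ℤ) * ·) this
    simp only [← mul_assoc, ← WithZero.exp_add] at h2
    norm_num at h2
    exact h2.symm

/-- Descent on the power of π that brings x into Λ, dividing by π each time. Together with
`norm_le`, Λ is cut out by integrality of the reduced norm, as in a division algebra. -/
theorem mem_of_norm_le {x : B} (hn : w (redNorm F x) ≤ 1) : x ∈ Λ := by
  obtain ⟨N, hN⟩ := h.exists_pow_smul_mem x
  induction N generalizing x with
  | zero => simpa using hN
  | succ N ih =>
    have h1 : π • x ∈ Λ := by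
      refine ih ?_ (by rwa [smul_smul, ← pow_succ])
      rw [redNorm_smul]
      exact val_mul_le_one (val_sq_lt_one h.lt_one).le hn
    have h2 := h.mem_scaled_of_norm_le hR h1 (by
      rw [redNorm_smul, map_mul]; exact mul_le_of_le_one_right' hn)
    rwa [mem_scaled, smul_smul, inv_mul_cancel₀ h.ne_zero, one_smul] at h2

theorem mem_scaled_of_norm_le' {x : B} {c : F} (hc : c ≠ 0) (hn : w (redNorm F x) ≤ w c ^ 2) :
    x ∈ scaled Λ c := by
  refine h.mem_of_norm_le hR ?_
  have hc' : 0 < w c := by rw [zero_lt_iff]; simpa using hc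
  rw [redNorm_smul, map_mul, map_pow, map_inv₀, inv_pow]
  exact (inv_mul_le_one₀ (pow_pos hc' 2)).mpr hn

end LocalOrder

/-! ### Norms, traces and the trace dual in the ramified case -/

namespace LocalOrder

variable {F B : Type*} [Field F] [CharZero F] [Ring B] [Algebra F B] [Module.Finite F B]
  [IsQuat F B] {w : Valuation F ℤᵐ⁰} {π : F} {Λ : Subring B} (h : LocalOrder w π Λ)

theorem redNorm_smul_add_smul (a b : F) (x y : B) :
    redNorm F (a • x + b • y) = a ^ 2 * redNorm F x + b ^ 2 * redNorm F y +
      a * b * redTrace F (x * canonInv F y) := by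
  rw [IsQuat.redNorm_add, redNorm_smul, redNorm_smul, canonInv_smul, smul_mul_smul_comm,
    redTrace_smul]

include h

theorem inv_smul_mem_scaled {a : F} (ha : w a = 1) {x : B} (hx : a • x ∈ scaled Λ π) :
    x ∈ scaled Λ π := by
  have ha0 : a ≠ 0 := by rintro rfl; simp at ha
  have := h.smul_mem_scaled' (c := a⁻¹) (by rw [map_inv₀, ha, inv_one]) hx
  rwa [smul_smul, inv_mul_cancel₀ ha0, one_smul] at this

variable (hR : NoIdempotent w Λ)
include hR

/-- Choose 1, y, e independent modulo π. The norm form on their span is ternary, hence has a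
primitive zero modulo π; the resulting x is not in π Λ, so its norm is divisible by π but not by π².
-/
theorem exists_norm_eq : ∃ x ∈ Λ, w (redNorm F x) = exp (-1 : ℤ) := by
  obtain ⟨y, hy, hyn⟩ := h.exists_notMem_span_pair 1 0
  obtain ⟨e, he, hen⟩ := h.exists_notMem_span_pair 1 y
  obtain ⟨a, b, c, ha, hb, hc, habc, hlt⟩ := h.ternary 1 (redNorm F y) (redNorm F e)
    (redTrace F (1 * canonInv F y)) (redTrace F (1 * canonInv F e))
    (redTrace F (y * canonInv F e)) (by rw [map_one]) (h.norm_le y hy) (h.norm_le e he)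
    (h.trace_le _ (mul_mem (one_mem _) (h.canonInv_mem hy)))
    (h.trace_le _ (mul_mem (one_mem _) (h.canonInv_mem he)))
    (h.trace_le _ (mul_mem hy (h.canonInv_mem he)))
  have hx : a • 1 + b • y + c • e ∈ Λ :=
    add_mem (add_mem (h.smul_mem _ _ ha (one_mem _)) (h.smul_mem _ _ hb hy)) (h.smul_mem _ _ hc he)
  refine ⟨a • 1 + b • y + c • e, hx, ?_⟩
  have hn : redNorm F (a • 1 + b • y + c • e) =
      1 * a ^ 2 + redNorm F y * b ^ 2 + redNorm F e * c ^ 2 +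
        redTrace F (1 * canonInv F y) * (a * b) + redTrace F (1 * canonInv F e) * (a * c) +
        redTrace F (y * canonInv F e) * (b * c) := by
    rw [IsQuat.redNorm_add, redNorm_smul_add_smul, redNorm_smul, IsQuat.redNorm_one, canonInv_smul,
      add_mul, smul_mul_smul_comm, smul_mul_smul_comm, redTrace_add, redTrace_smul, redTrace_smul]
    ring
  rw [← hn] at hlt
  have hnot : a • 1 + b • y + c • e ∉ scaled Λ π := by
    intro hmem
    by_cases hc1 : w c = 1
    · have hc0 : c ≠ 0 := by rintro rfl; simp at hc1
      refine hen (-(c⁻¹ * a)) (-(c⁻¹ * b)) ?_ ?_ (h.inv_smul_mem_scaled hc1 ?_)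
      · rw [Valuation.map_neg, map_mul, map_inv₀, hc1]; simpa using ha
      · rw [Valuation.map_neg, map_mul, map_inv₀, hc1]; simpa using hb
      · convert hmem using 1
        simp only [smul_sub, neg_smul, smul_neg, smul_smul, mul_inv_cancel_left₀ hc0]
        abel
    have hmem2 : a • 1 + b • y ∈ scaled Λ π := by
      have := sub_mem hmem (h.smul_mem_scaled_of_lt (lt_of_le_of_ne hc hc1) he)
      simpa using this
    by_cases hb1 : w b = 1
    · have hb0 : b ≠ 0 := by rintro rfl; simp at hb1
      refine hyn (-(b⁻¹ * a)) 0 ?_ (by simp) (h.inv_smul_mem_scaled hb1 ?_)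
      · rw [Valuation.map_neg, map_mul, map_inv₀, hb1]; simpa using ha
      · convert hmem2 using 1
        simp only [smul_sub, neg_smul, smul_neg, smul_smul, mul_inv_cancel_left₀ hb0, smul_zero,
          sub_zero]
        abel
    have hmem3 : a • (1 : B) ∈ scaled Λ π := by
      have := sub_mem hmem2 (h.smul_mem_scaled_of_lt (lt_of_le_of_ne hb hb1) hy)
      simpa using this
    have ha1 : w a = 1 := by tauto
    exact h.one_notMem_scaled (h.inv_smul_mem_scaled ha1 hmem3)
  have hgt : ¬ w (redNorm F (a • 1 + b • y + c • e)) ≤ w (π ^ 2) :=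
    fun hle => hnot (h.mem_scaled_of_norm_le hR hx hle)
  have h0 : redNorm F (a • 1 + b • y + c • e) ≠ 0 := by
    intro h0; rw [h0, map_zero] at hgt; exact hgt zero_le
  obtain ⟨t, ht⟩ := h.exists_exp h0
  rw [ht, h.pow, WithZero.exp_le_exp] at hgt
  rw [ht, ← WithZero.exp_zero, WithZero.exp_lt_exp] at hlt
  rw [ht, WithZero.exp_inj]
  push_cast at hgt
  omega

/-- The residue ring is not spanned by `1`. -/
theorem exists_norm_sub_eq_one : ∃ y ∈ Λ, ∀ a : F, w a ≤ 1 → w (redNorm F (y - a • 1)) = 1 := by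
  by_contra hcon
  push Not at hcon
  have hcon' : ∀ y ∈ Λ, ∃ a : F, w a ≤ 1 ∧ w (redNorm F (y - a • 1)) < 1 := by
    intro y hy
    obtain ⟨a, ha, hne⟩ := hcon y hy
    exact ⟨a, ha, lt_of_le_of_ne (h.norm_le _ (sub_mem hy (h.smul_one_mem ha))) hne⟩
  obtain ⟨q, hq, hnq⟩ := h.exists_norm_eq hR
  obtain ⟨x, hx, hxn⟩ := h.exists_notMem_span_pair 1 q
  obtain ⟨a, ha, hna⟩ := hcon' x hx
  have hq0 : redNorm F q ≠ 0 := by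
    intro h0; rw [h0, map_zero] at hnq; exact WithZero.coe_ne_zero hnq.symm
  have hle : ∀ z : B, w (redNorm F z) < 1 → w (redNorm F (quatInv (F := F) q * z)) ≤ 1 := by
    intro z hz
    rw [IsQuat.redNorm_mul, redNorm_quatInv, map_mul, map_inv₀, hnq, ← WithZero.exp_neg, neg_neg]
    rw [h.lt_one_iff, map_mul, map_inv₀, h.uniformizer, ← WithZero.exp_neg, neg_neg] at hz
    exact hz
  have h1 : quatInv (F := F) q * (x - a • 1) ∈ Λ := h.mem_of_norm_le hR (hle _ hna)
  obtain ⟨b, hb, hnb⟩ := hcon' _ h1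
  refine hxn a b ha hb (h.mem_scaled_of_norm_le hR ?_ ?_)
  · exact sub_mem (sub_mem hx (h.smul_one_mem ha)) (h.smul_mem _ _ hb hq)
  · have : x - a • 1 - b • q = q * (quatInv (F := F) q * (x - a • 1) - b • 1) := by
      rw [mul_sub, ← mul_assoc, mul_quatInv hq0]; simp
    rw [this, IsQuat.redNorm_mul, map_mul, hnq, pow_two, map_mul, h.uniformizer]
    rw [h.lt_one_iff, map_mul, map_inv₀, h.uniformizer, ← WithZero.exp_neg, neg_neg] at hnb
    have := mul_le_mul_right hnb (exp (-1 : ℤ))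
    rw [← mul_assoc, ← WithZero.exp_add, neg_add_cancel, WithZero.exp_zero, one_mul, mul_one]
      at this
    exact mul_le_mul_right this _

omit hR in
theorem exists_trace_eq_one_of_eq {z : B} (hz : z ∈ Λ) (ht : w (redTrace F z) = 1) :
    ∃ y ∈ Λ, redTrace F y = 1 ∧ redNorm F y = (redTrace F z)⁻¹ ^ 2 * redNorm F z := by
  have h0 : redTrace F z ≠ 0 := by intro h0; rw [h0, map_zero] at ht; exact zero_ne_one ht
  refine ⟨(redTrace F z)⁻¹ • z, h.smul_mem _ _ (by rw [map_inv₀, ht, inv_one]) hz, ?_, ?_⟩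
  · rw [redTrace_smul, inv_mul_cancel₀ h0]
  · rw [redNorm_smul]

/-- If all traces were non-units, then so would be Tr 1 = 2. Every residue is then a square, Nr y ≡
s², and Nr(y - s) ≡ 0, which is impossible for y generating a proper residue extension. -/
theorem exists_trace_eq_one : ∃ y ∈ Λ, redTrace F y = 1 := by
  by_contra hcon
  have hT : ∀ z ∈ Λ, w (redTrace F z) < 1 := by
    intro z hz
    refine lt_of_le_of_ne (h.trace_le z hz) fun ht => hcon ?_
    obtain ⟨y, hy, hy1, -⟩ := h.exists_trace_eq_one_of_eq hz ht
    exact ⟨y, hy, hy1⟩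
  have h2 : w (2 : F) < 1 := by
    have := hT 1 (one_mem _)
    rwa [IsQuat.redTrace_one] at this
  obtain ⟨y, hy, hyn⟩ := h.exists_norm_sub_eq_one hR
  obtain ⟨s, hs, hns⟩ := h.sqrt h2 (redNorm F y) (h.norm_le y hy)
  have := hyn s hs
  have hn : redNorm F (y - s • 1) = (redNorm F y - s ^ 2) + (2 * s ^ 2 - s * redTrace F y) := by
    rw [sub_eq_add_neg, IsQuat.redNorm_add, redNorm_neg, redNorm_smul_one, canonInv_neg,
      canonInv_smul_one, mul_neg, mul_smul_comm, mul_one, redTrace_neg, redTrace_smul]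
    ring
  rw [hn] at this
  refine absurd this (ne_of_lt (val_add_lt_one hns (val_sub_lt_one ?_ ?_)))
  · rw [mul_comm]
    exact val_mul_lt_one (by rw [map_pow]; exact pow_le_one₀ zero_le hs) h2
  · exact val_mul_lt_one hs (hT y hy)

/-- The ternary form Nr(a + b y) - c z² has a primitive zero modulo π. The first part is anisotropic
by the choice of y, so z is a unit and can be divided out. -/
theorem exists_norm_sub_lt {c : F} (hc : w c = 1) : ∃ u ∈ Λ, w (redNorm F u - c) < 1 := by
  obtain ⟨y, hy, hyn⟩ := h.exists_norm_sub_eq_one hR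
  obtain ⟨a, b, z, ha, hb, hz, habz, hlt⟩ := h.ternary 1 (redNorm F y) (-c)
    (redTrace F (1 * canonInv F y)) 0 0 (by rw [map_one]) (h.norm_le y hy)
    (by rw [Valuation.map_neg, hc])
    (h.trace_le _ (mul_mem (one_mem _) (h.canonInv_mem hy))) (by simp) (by simp)
  have hx : a • 1 + b • y ∈ Λ := add_mem (h.smul_one_mem ha) (h.smul_mem _ _ hb hy)
  have hn := redNorm_smul_add_smul (F := F) a b (1 : B) y
  rw [IsQuat.redNorm_one] at hn
  have hlt' : w (redNorm F (a • 1 + b • y) - c * z ^ 2) < 1 := by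
    convert hlt using 2
    rw [hn]; ring
  by_cases hz1 : w z = 1
  · have hz0 : z ≠ 0 := by rintro rfl; simp at hz1
    refine ⟨z⁻¹ • (a • 1 + b • y), h.smul_mem _ _ (by rw [map_inv₀, hz1, inv_one]) hx, ?_⟩
    rw [redNorm_smul]
    have : z⁻¹ ^ 2 * redNorm F (a • 1 + b • y) - c =
        z⁻¹ ^ 2 * (redNorm F (a • 1 + b • y) - c * z ^ 2) := by field_simp
    rw [this]
    exact val_mul_lt_one (by rw [map_pow, map_inv₀, hz1]; simp) hlt'
  exfalso
  have hz' := lt_of_le_of_ne hz hz1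
  have hlt2 : w (redNorm F (a • 1 + b • y)) < 1 := by
    have := val_add_lt_one hlt' (val_mul_lt_one hc.le (val_sq_lt_one hz'))
    rwa [sub_add_cancel] at this
  by_cases hb1 : w b = 1
  · have hb0 : b ≠ 0 := by rintro rfl; simp at hb1
    have h1 := hyn (-(b⁻¹ * a)) (by
      rw [Valuation.map_neg, map_mul, map_inv₀, hb1]; simpa using ha)
    have h2 : a • 1 + b • y = b • (y - (-(b⁻¹ * a)) • 1) := by
      simp only [smul_sub, neg_smul, smul_neg, smul_smul, mul_inv_cancel_left₀ hb0]
      abel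
    rw [h2, redNorm_smul, map_mul, h1, map_pow, hb1] at hlt2
    simp at hlt2
  have hb' := lt_of_le_of_ne hb hb1
  have ha1 : w a = 1 := by tauto
  have h3 : w (redNorm F (a • 1 + b • y) - b • (b * redNorm F y + a * redTrace F (1 * canonInv F y)))
      < 1 := val_sub_lt_one hlt2 (by
    rw [smul_eq_mul, mul_comm]
    refine val_mul_lt_one (val_add_le_one (val_mul_le_one hb (h.norm_le y hy))
      (val_mul_le_one ha (h.trace_le _ (mul_mem (one_mem _) (h.canonInv_mem hy))))) hb')
  rw [hn, smul_eq_mul] at h3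
  have h4 : w (a ^ 2) < 1 := by
    convert h3 using 2; ring
  rw [map_pow, ha1] at h4
  simp at h4

/-- The reduced norm is surjective on units up to arbitrary precision. -/
theorem exists_norm_sub_le {c : F} (hc : w c = 1) (N : ℕ) :
    ∃ u ∈ Λ, w (redNorm F u - c) ≤ w (π ^ (N + 1)) := by
  obtain ⟨y, hy, hyT⟩ := h.exists_trace_eq_one hR
  have hc0 : c ≠ 0 := by rintro rfl; simp at hc
  induction N with
  | zero =>
    obtain ⟨u, hu, hlt⟩ := h.exists_norm_sub_lt hR hc
    refine ⟨u, hu, ?_⟩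
    rw [h.lt_one_iff, map_mul, map_inv₀] at hlt
    have hpos : 0 < w π := by rw [zero_lt_iff]; simpa using h.ne_zero
    rw [zero_add, pow_one]
    exact (inv_mul_le_one₀ hpos).mp hlt
  | succ N ih =>
    obtain ⟨u, hu, hle⟩ := ih
    have hπ0 := pow_ne_zero (N + 1) h.ne_zero
    obtain ⟨r, hr⟩ : ∃ r, redNorm F u - c = π ^ (N + 1) * r :=
      ⟨(π ^ (N + 1))⁻¹ * (redNorm F u - c), by rw [mul_inv_cancel_left₀ hπ0]⟩
    have hr1 : w r ≤ 1 := by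
      have hpos : 0 < w (π ^ (N + 1)) := by rw [zero_lt_iff]; simpa using hπ0
      rw [hr, map_mul] at hle
      exact (mul_le_iff_le_one_right hpos).mp hle
    -- Since Tr y = 1, the factor 1 + π ^ (N + 1) s y has norm 1 + π ^ (N + 1) s up to higher order;
    -- this s cancels the leading error r.
    set s := -(c⁻¹ * r) with hs
    have hs1 : w s ≤ 1 := by
      rw [hs, Valuation.map_neg, map_mul, map_inv₀, hc]; simpa using hr1
    have hπN : w (π ^ (N + 1)) ≤ 1 := by
      rw [map_pow]; exact pow_le_one₀ zero_le h.lt_one.le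
    refine ⟨u * (1 + (π ^ (N + 1) * s) • y), mul_mem hu (add_mem (one_mem _)
      (h.smul_mem _ _ (val_mul_le_one hπN hs1) hy)), ?_⟩
    have hn1 : redNorm F (1 + (π ^ (N + 1) * s) • y) =
        1 + π ^ (N + 1) * s + (π ^ (N + 1) * s) ^ 2 * redNorm F y := by
      have := redNorm_smul_add_smul (F := F) 1 (π ^ (N + 1) * s) (1 : B) y
      rw [one_smul, one_mul, one_mul, redTrace_canonInv, hyT, IsQuat.redNorm_one] at this
      rw [this]; ring
    have hkey : redNorm F (u * (1 + (π ^ (N + 1) * s) • y)) - c =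
        π ^ (N + 1 + 1) * (π ^ N * (r * s + (c + π ^ (N + 1) * r) * s ^ 2 * redNorm F y)) := by
      have hu' : redNorm F u = c + π ^ (N + 1) * r := by rw [← hr]; ring
      have hcs : c * s = -r := by rw [hs]; field_simp
      rw [IsQuat.redNorm_mul, hn1, hu']
      linear_combination π ^ (N + 1) * hcs
    rw [hkey, map_mul]
    refine mul_le_of_le_one_right' (val_mul_le_one ?_ (val_add_le_one (val_mul_le_one hr1 hs1)
      (val_mul_le_one (val_mul_le_one (val_add_le_one hc.le (val_mul_le_one hπN hr1)) ?_)
        (h.norm_le y hy))))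
    · rw [map_pow]; exact pow_le_one₀ zero_le h.lt_one.le
    · rw [map_pow]; exact pow_le_one₀ zero_le hs1

/-- The dual of `Λ` for the trace form. -/
theorem trace_mul_le_one_iff (x : B) :
    (∀ l ∈ Λ, w (redTrace F (x * l)) ≤ 1) ↔ w (redNorm F x) ≤ exp (1 : ℤ) := by
  constructor
  · intro hx
    by_contra hcon
    have h0 : redNorm F x ≠ 0 := by
      intro h0; rw [h0, map_zero] at hcon; exact hcon zero_le
    obtain ⟨t, ht⟩ := h.exists_exp h0
    rw [ht, WithZero.exp_le_exp] at hcon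
    obtain ⟨y, hy, hyT⟩ := h.exists_trace_eq_one hR
    -- Here the exponent of Nr x is t ≥ 2, so π⁻¹x⁻¹ has norm of exponent 2 - t ≤ 0 and lies in Λ.
    -- Testing x against π⁻¹x⁻¹y gives the trace π⁻¹.
    have hmem : π⁻¹ • quatInv (F := F) x ∈ Λ := by
      refine h.mem_of_norm_le hR ?_
      rw [redNorm_smul, redNorm_quatInv, map_mul, map_pow, map_inv₀, map_inv₀, ht, h.uniformizer,
        ← WithZero.exp_neg, ← WithZero.exp_neg, ← WithZero.exp_nsmul, ← WithZero.exp_add,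
        ← WithZero.exp_zero, WithZero.exp_le_exp]
      simp only [neg_neg, nsmul_eq_mul, Nat.cast_ofNat]
      omega
    have := hx _ (mul_mem hmem hy)
    rw [smul_mul_assoc, mul_smul_comm, ← mul_assoc, mul_quatInv h0, one_mul, redTrace_smul, hyT,
      mul_one, map_inv₀, h.uniformizer, ← WithZero.exp_neg, ← WithZero.exp_zero,
      WithZero.exp_le_exp] at this
    norm_num at this
  · intro hx l hl
    have h1 : w (redNorm F (π • (x * l))) < 1 := by
      rw [redNorm_smul, IsQuat.redNorm_mul, map_mul, map_mul, h.pow, ← mul_assoc]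
      have h2 : exp (-((2 : ℕ) : ℤ)) * w (redNorm F x) ≤ exp (-1 : ℤ) := by
        have := mul_le_mul_right hx (exp (-((2 : ℕ) : ℤ)))
        rwa [← WithZero.exp_add] at this
      refine lt_of_le_of_lt (mul_le_mul' h2 (h.norm_le l hl)) ?_
      rw [mul_one, ← WithZero.exp_zero, WithZero.exp_lt_exp]
      norm_num
    have h2 := hR _ (h.mem_of_norm_le hR h1.le) h1
    rw [redTrace_smul, h.lt_one_iff, inv_mul_cancel_left₀ h.ne_zero] at h2
    exact h2

end LocalOrder

/-! ### The split case: an idempotent modulo π -/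

namespace LocalOrder

variable {F B : Type*} [Field F] [CharZero F] [Ring B] [Algebra F B] [Module.Finite F B]
  [IsQuat F B] {w : Valuation F ℤᵐ⁰} {π : F} {Λ : Subring B} (h : LocalOrder w π Λ)

include h

theorem smul_mem_scaled_of_le {c a : F} (hc : c ≠ 0) (ha : w a ≤ w c) {x : B} (hx : x ∈ Λ) :
    a • x ∈ scaled Λ c := by
  rw [mem_scaled, smul_smul]
  have hpos : 0 < w c := by rw [zero_lt_iff]; simpa using hc
  refine h.smul_mem _ _ ?_ hx
  rw [map_mul, map_inv₀]
  exact (inv_mul_le_one₀ hpos).mpr ha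

theorem mul_mul_self_mem {z y : B} (hz : z ∈ Λ) (hy : y ∈ Λ) (hn : w (redNorm F z) < 1)
    (hT : w (redTrace F (y * z)) < 1) : z * y * z ∈ scaled Λ π := by
  rw [mul_mul_self (F := F)]
  exact sub_mem (h.smul_mem_scaled_of_lt hT hz) (h.smul_mem_scaled_of_lt hn (h.canonInv_mem hy))

theorem mul_mul_self_sub_mem {z : B} (y : B) (hy : y ∈ Λ) (hn : w (redNorm F z) < 1) :
    z * y * z - redTrace F (y * z) • z ∈ scaled Λ π := by
  rw [mul_mul_self (F := F), sub_sub_cancel_left]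
  exact neg_mem (h.smul_mem_scaled_of_lt hn (h.canonInv_mem hy))

/-- The subring generated by adding π⁻¹ z̄Λz to Λ is bounded, so maximality puts it inside Λ. It is
closed under products because the trace hypothesis, through the sandwich identity, sends the
unwanted corners zΛz and z̄Λz̄ that occur into π Λ. -/
theorem corner_mem {z : B} (hz : z ∈ Λ) (hT : redTrace F z = 1) (hn : w (redNorm F z) < 1)
    (H : ∀ o ∈ Λ, ∀ l ∈ Λ, w (redTrace F (z * o * canonInv F z * l)) < 1) :
    ∀ l ∈ Λ, canonInv F z * l * z ∈ scaled Λ π := by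
  have hz' := h.canonInv_mem hz
  have hsum : z + canonInv F z = 1 := by rw [add_canonInv, hT, one_smul]
  have hn' : w (redNorm F (canonInv F z)) < 1 := by rwa [redNorm_canonInv]
  have hleft : ∀ a ∈ Λ, ∀ l ∈ Λ, ∃ b ∈ Λ, a * (canonInv F z * l * z) =
      π • b + canonInv F z * (a * canonInv F z * l) * z := by
    intro a ha l hl
    have h1 : z * (a * canonInv F z * l) * z ∈ scaled Λ π := by
      refine h.mul_mul_self_mem hz (mul_mem (mul_mem ha hz') hl) hn ?_
      rw [redTrace_mul_comm]
      simpa only [mul_assoc] using H a ha l hl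
    refine ⟨_, h1, ?_⟩
    rw [smul_smul, mul_inv_cancel₀ h.ne_zero, one_smul, ← add_mul, ← add_mul, hsum, one_mul]
    simp only [mul_assoc]
  have hright : ∀ a ∈ Λ, ∀ l ∈ Λ, ∃ b ∈ Λ, (canonInv F z * l * z) * a =
      π • b + canonInv F z * (l * z * a) * z := by
    intro a ha l hl
    have h1 : canonInv F z * (l * z * a) * canonInv F z ∈ scaled Λ π := by
      refine h.mul_mul_self_mem hz' (mul_mem (mul_mem hl hz) ha) hn' ?_
      have := H a ha l hl
      rw [redTrace_mul_comm] at this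
      simpa only [mul_assoc] using this
    refine ⟨_, h1, ?_⟩
    rw [smul_smul, mul_inv_cancel₀ h.ne_zero, one_smul, ← mul_add, add_comm (canonInv F z) z,
      hsum, mul_one]
    simp only [mul_assoc]
  let Λ' : Subring B :=
    { carrier := {x | ∃ a ∈ Λ, ∃ l ∈ Λ, x = a + π⁻¹ • (canonInv F z * l * z)}
      mul_mem' := by
        rintro _ _ ⟨a, ha, l, hl, rfl⟩ ⟨a', ha', l', hl', rfl⟩
        obtain ⟨b, hb, hb'⟩ := hleft a ha l' hl'
        obtain ⟨c, hc, hc'⟩ := hright a' ha' l hl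
        have hν : w (π⁻¹ * redNorm F z) ≤ 1 := (h.lt_one_iff _).mp hn
        refine ⟨a * a' + b + c, add_mem (add_mem (mul_mem ha ha') hb) hc,
          a * canonInv F z * l' + l * z * a' + (π⁻¹ * redNorm F z) • (l * l'),
          add_mem (add_mem (mul_mem (mul_mem ha hz') hl') (mul_mem (mul_mem hl hz) ha'))
            (h.smul_mem _ _ hν (mul_mem hl hl')), ?_⟩
        have h3 : (canonInv F z * l * z) * (canonInv F z * l' * z) =
            redNorm F z • (canonInv F z * (l * l') * z) := by
          calc (canonInv F z * l * z) * (canonInv F z * l' * z)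
              = canonInv F z * l * (z * canonInv F z) * l' * z := by simp only [mul_assoc]
            _ = _ := by rw [IsQuat.mul_canonInv]; simp [mul_assoc]
        rw [add_mul, mul_add, mul_add, mul_smul_comm, hb', smul_mul_assoc, hc',
          smul_mul_smul_comm, h3]
        simp only [mul_add, add_mul, smul_add, smul_smul, inv_mul_cancel₀ h.ne_zero, one_smul,
          mul_smul_comm, smul_mul_assoc, mul_assoc]
        abel
      one_mem' := ⟨1, one_mem _, 0, zero_mem _, by simp⟩
      add_mem' := by
        rintro _ _ ⟨a, ha, l, hl, rfl⟩ ⟨a', ha', l', hl', rfl⟩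
        refine ⟨a + a', add_mem ha ha', l + l', add_mem hl hl', ?_⟩
        simp only [mul_add, add_mul, smul_add]; abel
      zero_mem' := ⟨0, zero_mem _, 0, zero_mem _, by simp⟩
      neg_mem' := by
        rintro _ ⟨a, ha, l, hl, rfl⟩
        refine ⟨-a, neg_mem ha, -l, neg_mem hl, ?_⟩
        simp only [mul_neg, neg_mul, smul_neg]; abel }
  intro l hl
  refine h.maximal Λ' (fun a ha => ⟨a, ha, 0, zero_mem _, by simp⟩) ⟨1, ?_⟩
    ⟨0, zero_mem _, l, hl, by simp⟩
  rintro _ ⟨a, ha, l, hl, rfl⟩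
  rw [pow_one, smul_add, smul_smul, mul_inv_cancel₀ h.ne_zero, one_smul]
  exact add_mem (h.smul_mem _ _ h.lt_one.le ha) (mul_mem (mul_mem hz' hl) hz)

/-- Otherwise both off-diagonal corners vanish modulo π by `corner_mem`. The diagonal ones are
spanned by z and z̄ by the sandwich identity, so two elements would span Λ modulo π. -/
theorem exists_corner_unit {z : B} (hz : z ∈ Λ) (hT : redTrace F z = 1)
    (hn : w (redNorm F z) < 1) :
    ∃ o ∈ Λ, ∃ l ∈ Λ, w (redTrace F (z * o * canonInv F z * l)) = 1 := by
  have hz' := h.canonInv_mem hz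
  have hsum : z + canonInv F z = 1 := by rw [add_canonInv, hT, one_smul]
  have hn' : w (redNorm F (canonInv F z)) < 1 := by rwa [redNorm_canonInv]
  by_contra hcon
  push Not at hcon
  have H : ∀ o ∈ Λ, ∀ l ∈ Λ, w (redTrace F (z * o * canonInv F z * l)) < 1 :=
    fun o ho l hl => lt_of_le_of_ne
      (h.trace_le _ (mul_mem (mul_mem (mul_mem hz ho) hz') hl)) (hcon o ho l hl)
  have h1 := h.corner_mem hz hT hn H
  have h2 := h.corner_mem hz' (by rw [redTrace_canonInv, hT]) hn' (fun o ho l hl => by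
    rw [canonInv_canonInv, mul_assoc, redTrace_mul_comm, ← mul_assoc]
    exact H l hl o ho)
  simp only [canonInv_canonInv] at h2
  obtain ⟨x, hx, hxn⟩ := h.exists_notMem_span_pair z (canonInv F z)
  refine hxn (redTrace F (x * z)) (redTrace F (x * canonInv F z)) (h.trace_le _ (mul_mem hx hz))
    (h.trace_le _ (mul_mem hx hz')) ?_
  have h3 := add_mem (add_mem (add_mem (h.mul_mul_self_sub_mem (z := z) x hx hn)
    (h.mul_mul_self_sub_mem (z := canonInv F z) x hx hn')) (h1 x hx)) (h2 x hx)
  have h4 : x = (z + canonInv F z) * x * (z + canonInv F z) := by rw [hsum, one_mul, mul_one]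
  have h5 : x - redTrace F (x * z) • z - redTrace F (x * canonInv F z) • canonInv F z =
    z * x * z - redTrace F (x * z) • z +
      (canonInv F z * x * canonInv F z - redTrace F (x * canonInv F z) • canonInv F z) +
      canonInv F z * x * z + z * x * canonInv F z := by
    conv_lhs => lhs; lhs; rw [h4]
    simp only [mul_add, add_mul]; abel
  rw [h5]; exact h3

/-- If `Λ` has a nontrivial idempotent modulo `π`, the trace form is nondegenerate modulo `π`. -/
theorem mem_scaled_of_trace_lt {z : B} (hz : z ∈ Λ) (hT : redTrace F z = 1)
    (hn : w (redNorm F z) < 1) {x : B} (hx : x ∈ Λ)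
    (hxT : ∀ y ∈ Λ, w (redTrace F (x * y)) < 1) : x ∈ scaled Λ π := by
  have hz' := h.canonInv_mem hz
  have hsum : z + canonInv F z = 1 := by rw [add_canonInv, hT, one_smul]
  have hn' : w (redNorm F (canonInv F z)) < 1 := by rwa [redNorm_canonInv]
  obtain ⟨o, ho, l, hl, hu⟩ := h.exists_corner_unit hz hT hn
  have h1 : z * x * z ∈ scaled Λ π := h.mul_mul_self_mem hz hx hn (hxT z hz)
  have h2 : canonInv F z * x * canonInv F z ∈ scaled Λ π :=
    h.mul_mul_self_mem hz' hx hn' (hxT _ hz')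
  have h3 : z * x * canonInv F z ∈ scaled Λ π := by
    -- The product z x z̄ l z o z̄ lies in π Λ by the hypothesis on x, and is congruent to z x z̄
    -- times the unit Tr(z o z̄ l). The other off-diagonal corner is symmetric.
    have a1 : z * (x * canonInv F z * l) * z ∈ scaled Λ π := by
      refine h.mul_mul_self_mem hz (mul_mem (mul_mem hx hz') hl) hn ?_
      simpa only [mul_assoc] using hxT (canonInv F z * l * z) (mul_mem (mul_mem hz' hl) hz)
    have a2 := mul_mem_scaled_right a1 (mul_mem ho hz')
    have a3 := mul_mem_scaled_left (mul_mem hz hx) (h.mul_mul_self_sub_mem (z := canonInv F z)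
      (l * z * o) (mul_mem (mul_mem hl hz) ho) hn')
    have hu' : redTrace F (l * z * o * canonInv F z) =
        redTrace F (z * o * canonInv F z * l) := by
      rw [redTrace_mul_comm _ l]; simp only [mul_assoc]
    rw [hu'] at a3
    refine h.inv_smul_mem_scaled hu ?_
    convert sub_mem a2 a3 using 1
    simp only [mul_sub, mul_smul_comm, mul_assoc]; abel
  have h4 : canonInv F z * x * z ∈ scaled Λ π := by
    have a1 : canonInv F z * (x * z * o) * canonInv F z ∈ scaled Λ π := by
      refine h.mul_mul_self_mem hz' (mul_mem (mul_mem hx hz) ho) hn' ?_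
      simpa only [mul_assoc] using hxT (z * o * canonInv F z) (mul_mem (mul_mem hz ho) hz')
    have a2 := mul_mem_scaled_right a1 (mul_mem hl hz)
    have a3 := mul_mem_scaled_left (mul_mem hz' hx) (h.mul_mul_self_sub_mem (z := z)
      (o * canonInv F z * l) (mul_mem (mul_mem ho hz') hl) hn)
    have hu' : redTrace F (o * canonInv F z * l * z) =
        redTrace F (z * o * canonInv F z * l) := by
      rw [redTrace_mul_comm _ z]; simp only [mul_assoc]
    rw [hu'] at a3
    refine h.inv_smul_mem_scaled hu ?_
    convert sub_mem a2 a3 using 1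
    simp only [mul_sub, mul_smul_comm, mul_assoc]; abel
  have h5 : x = z * x * z + canonInv F z * x * canonInv F z + z * x * canonInv F z +
      canonInv F z * x * z := by
    calc x = (z + canonInv F z) * x * (z + canonInv F z) := by rw [hsum, one_mul, mul_one]
      _ = _ := by simp only [mul_add, add_mul]; abel
  rw [h5]
  exact add_mem (add_mem (add_mem h1 h2) h3) h4

/-- If x were outside Λ, the scalar c making c x primitive would be a non-unit, so c x would have
only non-unit traces against Λ, contradicting nondegeneracy modulo π. Thus Λ is its own trace dual.
-/
theorem mem_of_trace_le {z : B} (hz : z ∈ Λ) (hT : redTrace F z = 1)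
    (hn : w (redNorm F z) < 1) {x : B} (hxT : ∀ y ∈ Λ, w (redTrace F (x * y)) ≤ 1) : x ∈ Λ := by
  by_cases hx0 : x = 0
  · rw [hx0]; exact zero_mem _
  by_contra hx
  obtain ⟨c, hc0, hcx, hcn⟩ := h.exists_primitive hx0
  have hc1 : w c < 1 := by
    by_contra hcon
    push Not at hcon
    have := h.smul_mem c⁻¹ _ (by rw [map_inv₀]; exact inv_le_one_of_one_le₀ hcon) hcx
    rw [smul_smul, inv_mul_cancel₀ hc0, one_smul] at this
    exact hx this
  refine hcn (h.mem_scaled_of_trace_lt hz hT hn hcx fun y hy => ?_)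
  rw [smul_mul_assoc, redTrace_smul, mul_comm]
  exact val_mul_lt_one (hxT y hy) hc1

/-- If Nr g is a non-unit, some g l₁ is an idempotent modulo π, and a corner unit for it can be
rewritten, by moving l past g, as Tr of conj(g a) times g b. Such traces polarize the norm on gΛ and
are non-units. -/
theorem norm_eq_one_of_normalizes {z : B} (hz : z ∈ Λ) (hT : redTrace F z = 1)
    (hn : w (redNorm F z) < 1) {g : B} (hg : g ∈ Λ) (hgn : g ∉ scaled Λ π)
    (hnorm : ∀ x ∈ Λ, ∃ y ∈ Λ, x * g = g * y) : w (redNorm F g) = 1 := by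
  by_contra hne
  have hg1 : w (redNorm F g) < 1 := lt_of_le_of_ne (h.norm_le g hg) hne
  obtain ⟨l₀, hl₀, hl₀T⟩ : ∃ l ∈ Λ, w (redTrace F (g * l)) = 1 := by
    by_contra hcon
    push Not at hcon
    exact hgn (h.mem_scaled_of_trace_lt hz hT hn hg fun y hy =>
      lt_of_le_of_ne (h.trace_le _ (mul_mem hg hy)) (hcon y hy))
  have hTT : ∀ a ∈ Λ, ∀ b ∈ Λ, w (redTrace F (canonInv F (g * a) * (g * b))) < 1 := by
    intro a ha b hb
    have e1 := IsQuat.redNorm_add (F := F) (g * b) (g * a)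
    rw [← mul_add] at e1
    have e2 : redTrace F (canonInv F (g * a) * (g * b)) =
        redNorm F (g * (b + a)) - redNorm F (g * b) - redNorm F (g * a) := by
      rw [e1, redTrace_mul_comm]; ring
    rw [e2]
    exact val_sub_lt_one (val_sub_lt_one (h.norm_mul_lt_left hg1 (add_mem hb ha))
      (h.norm_mul_lt_left hg1 hb)) (h.norm_mul_lt_left hg1 ha)
  set t := (redTrace F (g * l₀))⁻¹ with ht
  have ht1 : w t = 1 := by rw [ht, map_inv₀, hl₀T, inv_one]
  have ht0 : redTrace F (g * l₀) ≠ 0 := by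
    intro h0; rw [h0, map_zero] at hl₀T; exact zero_ne_one hl₀T
  set l₁ := t • l₀ with hl₁def
  have hl₁ : l₁ ∈ Λ := h.smul_mem _ _ ht1.le hl₀
  have hT1 : redTrace F (g * l₁) = 1 := by
    rw [hl₁def, mul_smul_comm, redTrace_smul, ht, inv_mul_cancel₀ ht0]
  obtain ⟨o, ho, l, hl, hu⟩ := h.exists_corner_unit (mul_mem hg hl₁) hT1
    (h.norm_mul_lt_left hg1 hl₁)
  obtain ⟨l', hl', hll'⟩ := hnorm l hl
  have := hTT l₁ hl₁ (l' * l₁ * o) (mul_mem (mul_mem hl' hl₁) ho)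
  have e : redTrace F (g * l₁ * o * canonInv F (g * l₁) * l) =
      redTrace F (canonInv F (g * l₁) * (g * (l' * l₁ * o))) := by
    rw [mul_assoc, redTrace_mul_comm]
    congr 1
    calc canonInv F (g * l₁) * l * (g * l₁ * o) = canonInv F (g * l₁) * (l * g) * l₁ * o := by
          simp only [mul_assoc]
      _ = _ := by rw [hll']; simp only [mul_assoc]
  rw [e] at hu
  exact absurd hu (ne_of_lt this)

theorem exists_idempotent_approx {z : B} (hz : z ∈ Λ) (hT : redTrace F z = 1)
    (hn : w (redNorm F z) < 1) (N : ℕ) :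
    ∃ z ∈ Λ, redTrace F z = 1 ∧ w (redNorm F z) ≤ w (π ^ (N + 1)) := by
  have hpos : 0 < w π := by rw [zero_lt_iff]; simpa using h.ne_zero
  have hle : ∀ x : F, w x < 1 → w x ≤ w π := fun x hx => by
    rw [h.lt_one_iff, map_mul, map_inv₀] at hx
    exact (inv_mul_le_one₀ hpos).mp hx
  induction N with
  | zero => exact ⟨z, hz, hT, by rw [zero_add, pow_one]; exact hle _ hn⟩
  | succ N ih =>
    obtain ⟨z, hz, hT, hn⟩ := ih
    set ν := redNorm F z with hν
    have hint : ∀ n : ℕ, w (n : F) ≤ 1 := by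
      intro n
      induction n with
      | zero => simp
      | succ n ih => push_cast; exact val_add_le_one ih (map_one w).le
    have hν1 : w ν ≤ w π := hn.trans (by
      rw [pow_succ, map_mul]
      exact mul_le_of_le_one_left' (by rw [map_pow]; exact pow_le_one₀ zero_le h.lt_one.le))
    have hν2 : w ν ≤ 1 := hν1.trans h.lt_one.le
    -- This is 3z² - 2z³, the usual lifting of idempotents, reduced with z² = z - ν; its norm is
    -- ν²(3 + 4ν).
    refine ⟨(1 + 2 * ν) • z + (-ν) • 1, add_mem (h.smul_mem _ _ ?_ hz) (h.smul_one_mem ?_), ?_, ?_⟩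
    · exact val_add_le_one (map_one w).le (val_mul_le_one (by exact_mod_cast hint 2) hν2)
    · rw [Valuation.map_neg]; exact hν2
    · rw [redTrace_add, redTrace_smul, redTrace_smul, IsQuat.redTrace_one, hT]; ring
    · have : redNorm F ((1 + 2 * ν) • z + (-ν) • (1 : B)) = ν * (ν * (3 + 4 * ν)) := by
        rw [redNorm_smul_add_smul, canonInv_one, mul_one, hT, IsQuat.redNorm_one, ← hν]; ring
      rw [this, map_mul, pow_succ, map_mul w (π ^ (N + 1)) π]
      refine mul_le_mul' hn ?_
      rw [map_mul]
      refine (mul_le_of_le_one_right' ?_).trans hν1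
      exact val_add_le_one (by exact_mod_cast hint 3)
        (val_mul_le_one (by exact_mod_cast hint 4) hν2)

end LocalOrder

/-! ### Approximate solutions of Nr q = p, and the dual lattice, in both cases -/

namespace LocalOrder

variable {F B : Type*} [Field F] [CharZero F] [Ring B] [Algebra F B] [Module.Finite F B]
  [IsQuat F B] {w : Valuation F ℤᵐ⁰} {π : F} {Λ : Subring B} (h : LocalOrder w π Λ)

include h

/-- Rescaling an element of unit trace and non-unit norm to trace one gives z² = z - Nr(z), an
idempotent modulo π. -/
theorem exists_idempotent_of_not (hS : ¬ NoIdempotent w Λ) :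
    ∃ z ∈ Λ, redTrace F z = 1 ∧ w (redNorm F z) < 1 := by
  unfold NoIdempotent at hS
  push Not at hS
  obtain ⟨z, hz, hn, hT⟩ := hS
  have hT1 : w (redTrace F z) = 1 := le_antisymm (h.trace_le z hz) hT
  obtain ⟨y, hy, hyT, hyn⟩ := h.exists_trace_eq_one_of_eq hz hT1
  refine ⟨y, hy, hyT, ?_⟩
  rw [hyn]
  refine val_mul_lt_one ?_ hn
  rw [map_pow, map_inv₀, hT1]; simp

theorem exists_pow_le {p : F} (hp : p ≠ 0) : ∃ N : ℕ, w (π ^ (N + 1)) ≤ w p := by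
  obtain ⟨N, hN⟩ := h.exists_pow_lt hp
  refine ⟨N, le_trans ?_ hN.le⟩
  rw [pow_succ, map_mul]
  exact mul_le_of_le_one_right' h.lt_one.le

/-- An element `q` of reduced norm close to `p`, with `q² ∈ p Λ`, and an element `y` of trace one
with `q y q ∈ p Λ`. -/
theorem exists_norm_approx {p : F} (hp0 : p ≠ 0) (hp : w p ≤ 1) :
    ∃ q ∈ Λ, ∃ y ∈ Λ, redTrace F y = 1 ∧ w (redNorm F q - p) ≤ w p ^ 2 ∧
      q * q ∈ scaled Λ p ∧ q * y * q ∈ scaled Λ p := by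
  have hp2 : w p ^ 2 ≤ w p := by
    rw [pow_two]; exact mul_le_of_le_one_right' hp
  by_cases hR : NoIdempotent w Λ
  · obtain ⟨y, hy, hyT⟩ := h.exists_trace_eq_one hR
    obtain ⟨q₀, hq₀, hnq₀⟩ := h.exists_norm_eq hR
    obtain ⟨n, hn⟩ := h.exists_exp hp0
    have hn0 : n ≤ 0 := by rwa [hn, ← WithZero.exp_zero, WithZero.exp_le_exp] at hp
    obtain ⟨e, rfl⟩ : ∃ e : ℕ, n = -(e : ℤ) := ⟨(-n).toNat, by omega⟩
    have hq00 : redNorm F q₀ ≠ 0 := by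
      intro h0; rw [h0, map_zero] at hnq₀; exact WithZero.coe_ne_zero hnq₀.symm
    have hnpow : ∀ k : ℕ, redNorm F (q₀ ^ k) = redNorm F q₀ ^ k := by
      intro k
      induction k with
      | zero => simp [IsQuat.redNorm_one]
      | succ k ih => rw [pow_succ, pow_succ, IsQuat.redNorm_mul, ih]
    have hwe : w (redNorm F q₀ ^ e) = w p := by
      rw [map_pow, hnq₀, hn, ← WithZero.exp_nsmul]; simp
    have hc : w (p / redNorm F q₀ ^ e) = 1 := by
      rw [map_div₀, hwe, div_self]; simpa using hp0
    obtain ⟨N, hN⟩ := h.exists_pow_le hp0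
    -- Ramified case: q = q₀ ^ e u, where q₀ has uniformizing norm, e is the order of p, and u
    -- adjusts the unit p / Nr(q₀) ^ e. Both divisibility conditions follow from norms alone.
    obtain ⟨u, hu, hnu⟩ := h.exists_norm_sub_le hR hc N
    have hq : q₀ ^ e * u ∈ Λ := mul_mem (pow_mem hq₀ e) hu
    have h1 : w (redNorm F (q₀ ^ e * u) - p) ≤ w p ^ 2 := by
      have : redNorm F (q₀ ^ e * u) - p =
          redNorm F q₀ ^ e * (redNorm F u - p / redNorm F q₀ ^ e) := by
        rw [IsQuat.redNorm_mul, hnpow]; field_simp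
      rw [this, map_mul, hwe, pow_two]
      exact mul_le_mul' le_rfl (hnu.trans hN)
    have h2 : w (redNorm F (q₀ ^ e * u)) ≤ w p := by
      have := w.map_add (redNorm F (q₀ ^ e * u) - p) p
      rw [sub_add_cancel] at this
      exact this.trans (max_le (h1.trans hp2) le_rfl)
    refine ⟨_, hq, y, hy, hyT, h1, h.mem_scaled_of_norm_le' hR hp0 ?_,
      h.mem_scaled_of_norm_le' hR hp0 ?_⟩
    · rw [IsQuat.redNorm_mul, map_mul, pow_two]
      exact mul_le_mul' h2 h2
    · rw [IsQuat.redNorm_mul, IsQuat.redNorm_mul, map_mul, map_mul, pow_two]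
      exact mul_le_mul' (mul_le_of_le_of_le_one h2 (h.norm_le y hy)) h2
  · obtain ⟨z₀, hz₀, hT₀, hn₀⟩ := h.exists_idempotent_of_not hR
    obtain ⟨N, hN⟩ := h.exists_pow_le (pow_ne_zero 2 hp0)
    obtain ⟨z, hz, hT, hn⟩ := h.exists_idempotent_approx hz₀ hT₀ hn₀ N
    have hz' := h.canonInv_mem hz
    have hlt : w (redNorm F z) < 1 := by
      refine lt_of_le_of_lt hn ?_
      rw [map_pow]; exact pow_lt_one₀ zero_le h.lt_one (by omega)
    obtain ⟨o, ho, l, hl, hu⟩ := h.exists_corner_unit hz hT hlt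
    set ν := redNorm F z with hν
    have hνp : w ν ≤ w p ^ 2 := by rw [← map_pow]; exact hn.trans hN
    have hν1 : w ν ≤ 1 := hlt.le
    -- Split case: a and b are the two off-diagonal entries, and q = a + c b is antidiagonal. The
    -- idempotent z is taken precise enough for every error term to be a multiple of ν, hence of p².
    set a := z * o * canonInv F z with ha
    set b := canonInv F z * l * z with hb
    have haΛ : a ∈ Λ := mul_mem (mul_mem hz ho) hz'
    have hbΛ : b ∈ Λ := mul_mem (mul_mem hz' hl) hz
    have hab : w (redTrace F (a * b)) = 1 := by
      refine val_eq_one_of_sub_lt hu ?_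
      have e1 : canonInv F z * canonInv F z = canonInv F z - ν • 1 := by
        rw [mul_self_eq (F := F), redTrace_canonInv, hT, redNorm_canonInv, one_smul]
      have e2 : z * z = z - ν • 1 := by rw [mul_self_eq (F := F), hT, one_smul]
      have e3 : a * b = z * o * canonInv F z * l * z - ν • (z * o * l * z) := by
        calc a * b = z * o * (canonInv F z * canonInv F z) * l * z := by
              rw [ha, hb]; simp only [mul_assoc]
          _ = _ := by
              rw [e1]
              simp only [sub_mul, mul_sub, smul_mul_assoc, mul_smul_comm, mul_one]
      have e4 : redTrace F (z * o * canonInv F z * l * z) =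
          redTrace F (z * o * canonInv F z * l) - ν * redTrace F (o * canonInv F z * l) := by
        rw [redTrace_mul_comm, ← redTrace_smul, ← redTrace_sub]
        congr 1
        simp only [← mul_assoc, e2, sub_mul, smul_mul_assoc, one_mul]
      rw [e3, redTrace_sub, redTrace_smul, e4,
        show ∀ u x y : F, u - (u - ν * x - ν * y) = (x + y) * ν from fun u x y => by ring]
      exact val_mul_lt_one (val_add_le_one (h.trace_le _ (mul_mem (mul_mem ho hz') hl))
        (h.trace_le _ (mul_mem (mul_mem (mul_mem hz ho) hl) hz))) hlt
    have hab0 : redTrace F (a * b) ≠ 0 := by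
      intro h0; rw [h0, map_zero] at hab; exact zero_ne_one hab
    -- For an antidiagonal element the norm is -c Tr(a b) up to multiples of ν, so this c makes it
    -- p.
    set c := -(p / redTrace F (a * b)) with hc
    have hcw : w c = w p := by rw [hc, Valuation.map_neg, map_div₀, hab, div_one]
    have hc1 : w c ≤ 1 := hcw.le.trans hp
    have hna : redNorm F a = ν * (ν * redNorm F o) := by
      rw [ha, IsQuat.redNorm_mul, IsQuat.redNorm_mul, redNorm_canonInv]; ring
    have hnb : redNorm F b = ν * (ν * redNorm F l) := by
      rw [hb, IsQuat.redNorm_mul, IsQuat.redNorm_mul, redNorm_canonInv]; ring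
    have hTa : redTrace F a = ν * redTrace F o := by
      rw [ha, redTrace_mul_comm, ← mul_assoc, canonInv_mul_self]
      simp [redTrace_smul, hν]
    have hTb : redTrace F b = ν * redTrace F l := by
      rw [hb, redTrace_mul_comm, ← mul_assoc, IsQuat.mul_canonInv]
      simp [redTrace_smul, hν]
    have hq : a + c • b ∈ Λ := add_mem haΛ (h.smul_mem _ _ hc1 hbΛ)
    have hnq : redNorm F (a + c • b) - p =
        ν * (ν * redNorm F o + c * (c * (ν * redNorm F l)) +
          c * (ν * (redTrace F o * redTrace F l))) := by
      have e := redNorm_smul_add_smul (F := F) 1 c a b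
      have hcp : c * redTrace F (a * b) = -p := by rw [hc]; field_simp
      rw [one_smul] at e
      rw [e, redTrace_mul_canonInv, hna, hnb, hTa, hTb]
      linear_combination -hcp
    have h1 : w (redNorm F (a + c • b) - p) ≤ w p ^ 2 := by
      rw [hnq, map_mul]
      refine (mul_le_of_le_one_right' ?_).trans hνp
      exact val_add_le_one (val_add_le_one (val_mul_le_one hν1 (h.norm_le o ho))
        (val_mul_le_one hc1 (val_mul_le_one hc1 (val_mul_le_one hν1 (h.norm_le l hl)))))
        (val_mul_le_one hc1 (val_mul_le_one hν1
          (val_mul_le_one (h.trace_le o ho) (h.trace_le l hl))))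
    have h2 : w (redNorm F (a + c • b)) ≤ w p := by
      have := w.map_add (redNorm F (a + c • b) - p) p
      rw [sub_add_cancel] at this
      exact this.trans (max_le (h1.trans hp2) le_rfl)
    refine ⟨_, hq, z, hz, hT, h1, ?_, ?_⟩
    · rw [mul_self_eq (F := F)]
      refine sub_mem (h.smul_mem_scaled_of_le hp0 ?_ hq)
        (h.smul_mem_scaled_of_le hp0 h2 (one_mem _))
      rw [redTrace_add, redTrace_smul, hTa, hTb,
        show ν * redTrace F o + c * (ν * redTrace F l) =
          ν * (redTrace F o + c * redTrace F l) by ring, map_mul]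
      refine (mul_le_of_le_one_right' ?_).trans (hνp.trans hp2)
      exact val_add_le_one (h.trace_le o ho) (val_mul_le_one hc1 (h.trace_le l hl))
    · rw [mul_mul_self (F := F)]
      refine sub_mem (h.smul_mem_scaled_of_le hp0 ?_ hq)
        (h.smul_mem_scaled_of_le hp0 h2 hz')
      have e1 : redTrace F (z * a) = ν * redTrace F (z * o) := by
        rw [ha, ← mul_assoc, redTrace_mul_comm, ← mul_assoc, ← mul_assoc, canonInv_mul_self]
        simp [redTrace_smul, hν]
      have e2 : redTrace F (z * b) = ν * redTrace F (l * z) := by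
        rw [hb, ← mul_assoc, ← mul_assoc, IsQuat.mul_canonInv]
        simp [redTrace_smul, hν]
      rw [mul_add, mul_smul_comm, redTrace_add, redTrace_smul, e1, e2,
        show ν * redTrace F (z * o) + c * (ν * redTrace F (l * z)) =
          ν * (redTrace F (z * o) + c * redTrace F (l * z)) by ring, map_mul]
      refine (mul_le_of_le_one_right' ?_).trans (hνp.trans hp2)
      exact val_add_le_one (h.trace_le _ (mul_mem hz ho))
        (val_mul_le_one hc1 (h.trace_le _ (mul_mem hl hz)))

theorem trace_smul_iff {c : F} (hc : c ≠ 0) (x : B) :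
    (∀ l ∈ Λ, w (redTrace F (x * l)) ≤ w c) ↔ ∀ l ∈ Λ, w (redTrace F ((c⁻¹ • x) * l)) ≤ 1 := by
  have hpos : 0 < w c := by rw [zero_lt_iff]; simpa using hc
  refine forall₂_congr fun l _ => ?_
  rw [smul_mul_assoc, redTrace_smul, map_mul, map_inv₀]
  exact (inv_mul_le_one₀ hpos).symm

/-- The dual of `γ⁻¹ Λ` for the trace form is a multiple of `Λ`, for suitable `γ` normalizing
`Λ`. -/
theorem exists_dual_scaling {g : B} (hg : redNorm F g ≠ 0)
    (hnorm : ∀ x ∈ Λ, quatInv (F := F) g * x * g ∈ Λ)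
    (hodd : NoIdempotent w Λ → ∃ k : ℤ, w (redNorm F g) = exp (2 * k + 1)) :
    ∃ c : F, c ≠ 0 ∧ ∀ x : B,
      (∀ l ∈ Λ, w (redTrace F (quatInv (F := F) g * x * l)) ≤ w c) ↔ x ∈ Λ := by
  by_cases hR : NoIdempotent w Λ
  · obtain ⟨k, hk⟩ := hodd hR
    -- The dual of Λ allows norms of exponent up to 1. Dividing by c = π ^ (k + 1) and by g shifts
    -- the exponent by 2(k + 1) - (2k + 1) = 1, so the condition becomes that Nr x is integral.
    have hc : π ^ (k + 1) ≠ 0 := zpow_ne_zero _ h.ne_zero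
    refine ⟨_, hc, fun x => ?_⟩
    rw [h.trace_smul_iff hc, h.trace_mul_le_one_iff hR]
    have : w (redNorm F ((π ^ (k + 1))⁻¹ • (quatInv (F := F) g * x))) =
        exp (1 : ℤ) * w (redNorm F x) := by
      rw [redNorm_smul, IsQuat.redNorm_mul, redNorm_quatInv, map_mul, map_mul, map_pow, map_inv₀,
        map_inv₀, hk, h.zpow, ← mul_assoc, ← WithZero.exp_neg, ← WithZero.exp_neg,
        ← WithZero.exp_nsmul, ← WithZero.exp_add]
      congr 2
      simp only [nsmul_eq_mul, Nat.cast_ofNat]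
      ring
    rw [this]
    have hpos : (0 : ℤᵐ⁰) < exp (1 : ℤ) := WithZero.exp_pos
    rw [mul_le_iff_le_one_right hpos]
    exact ⟨h.mem_of_norm_le hR, h.norm_le x⟩
  · obtain ⟨z, hz, hT, hn⟩ := h.exists_idempotent_of_not hR
    have hg0 : g ≠ 0 := by rintro rfl; exact hg redNorm_zero
    -- The primitive multiple c g still normalizes Λ, hence is a unit, and self-duality of Λ
    -- applies.
    obtain ⟨c, hc, hcg, hcn⟩ := h.exists_primitive hg0
    have hunit : w (redNorm F (c • g)) = 1 := by
      refine h.norm_eq_one_of_normalizes hz hT hn hcg hcn fun x hx => ⟨_, hnorm x hx, ?_⟩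
      rw [← mul_assoc, ← mul_assoc, smul_mul_assoc, mul_quatInv hg]
      simp
    refine ⟨c, hc, fun x => ?_⟩
    rw [h.trace_smul_iff hc]
    have hinv : quatInv (F := F) (c • g) = c⁻¹ • quatInv (F := F) g := by
      rw [quatInv, quatInv, redNorm_smul, canonInv_smul, smul_smul, smul_smul]
      congr 1
      field_simp
    rw [← smul_mul_assoc, ← hinv]
    have hinvΛ := h.quatInv_mem hcg hunit
    constructor
    · intro hx
      have := mul_mem hcg (h.mem_of_trace_le hz hT hn hx)
      rwa [← mul_assoc, mul_quatInv (norm_ne_zero hunit), one_mul] at this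
    · intro hx l hl
      exact h.trace_le _ (mul_mem (mul_mem hinvΛ hx) hl)

end LocalOrder

/-! ### Residue fields of a number field -/

/-- Ternary quadratic forms over finite fields are isotropic. -/
theorem exists_ternary_zero {κ : Type*} [Field κ] [Finite κ] (a b c d e f : κ) :
    ∃ x y z : κ, (x ≠ 0 ∨ y ≠ 0 ∨ z ≠ 0) ∧
      a * x ^ 2 + b * y ^ 2 + c * z ^ 2 + d * (x * y) + e * (x * z) + f * (y * z) = 0 := by
  classical
  have := Fintype.ofFinite κ
  obtain ⟨p, hp⟩ := CharP.exists κ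
  have hpp : p.Prime := (CharP.char_is_prime_or_zero κ p).resolve_right (CharP.char_ne_zero_of_finite κ p)
  let X := fun i : Fin 3 => (MvPolynomial.X i : MvPolynomial (Fin 3) κ)
  let P : MvPolynomial (Fin 3) κ := MvPolynomial.C a * (X 0 * X 0) + MvPolynomial.C b * (X 1 * X 1) +
    MvPolynomial.C c * (X 2 * X 2) + MvPolynomial.C d * (X 0 * X 1) +
    MvPolynomial.C e * (X 0 * X 2) + MvPolynomial.C f * (X 1 * X 2)
  have hmon : ∀ (t : κ) (i j : Fin 3), (MvPolynomial.C t * (X i * X j)).totalDegree ≤ 2 := by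
    intro t i j
    refine (MvPolynomial.totalDegree_mul _ _).trans ?_
    rw [MvPolynomial.totalDegree_C, zero_add]
    refine (MvPolynomial.totalDegree_mul _ _).trans ?_
    simp only [X, MvPolynomial.totalDegree_X]; norm_num
  have hadd : ∀ Q R : MvPolynomial (Fin 3) κ, Q.totalDegree ≤ 2 → R.totalDegree ≤ 2 →
      (Q + R).totalDegree ≤ 2 := fun Q R hQ hR =>
    (MvPolynomial.totalDegree_add _ _).trans (max_le hQ hR)
  have hdeg : P.totalDegree < Fintype.card (Fin 3) := by
    have : P.totalDegree ≤ 2 := hadd _ _ (hadd _ _ (hadd _ _ (hadd _ _ (hadd _ _ (hmon _ _ _)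
      (hmon _ _ _)) (hmon _ _ _)) (hmon _ _ _)) (hmon _ _ _)) (hmon _ _ _)
    simpa using Nat.lt_succ_of_le this
  have heval : ∀ x : Fin 3 → κ, MvPolynomial.eval x P = a * x 0 ^ 2 + b * x 1 ^ 2 + c * x 2 ^ 2 +
      d * (x 0 * x 1) + e * (x 0 * x 2) + f * (x 1 * x 2) := fun x => by
    simp only [P, X, map_add, map_mul, MvPolynomial.eval_C, MvPolynomial.eval_X]; ring
  -- Chevalley–Warning: degree two in three variables, so the number of zeros is divisible by the
  -- characteristic, and zero is one of them.
  have hdvd := char_dvd_card_solutions p hdeg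
  have hpos : 0 < Fintype.card { x : Fin 3 → κ // MvPolynomial.eval x P = 0 } :=
    Fintype.card_pos_iff.mpr ⟨⟨0, by rw [heval]; simp⟩⟩
  have h1 : 1 < Fintype.card { x : Fin 3 → κ // MvPolynomial.eval x P = 0 } :=
    hpp.one_lt.trans_le (Nat.le_of_dvd hpos hdvd)
  obtain ⟨⟨x, hx⟩, hne⟩ := Fintype.exists_ne_of_one_lt_card h1 ⟨0, by rw [heval]; simp⟩
  rw [heval] at hx
  refine ⟨x 0, x 1, x 2, ?_, hx⟩
  by_contra hcon
  push Not at hcon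
  refine hne (Subtype.ext (funext fun i => ?_))
  fin_cases i
  exacts [hcon.1, hcon.2.1, hcon.2.2]

section FiniteDVR

variable {F : Type*} [Field F] [NumberField F] (v : HeightOneSpectrum (𝓞 F))

theorem val_integer_le_one (a : 𝓞 F) : v.valuation F (a : F) ≤ 1 := v.valuation_le_one a

theorem val_integer_lt_one_iff (a : 𝓞 F) : v.valuation F (a : F) < 1 ↔ a ∈ v.asIdeal :=
  v.valuation_lt_one_iff_mem a

theorem val_integer_eq_one_iff (a : 𝓞 F) : v.valuation F (a : F) = 1 ↔ a ∉ v.asIdeal :=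
  v.valuation_eq_one_iff_notMem

theorem val_integer_le_exp_iff (a : 𝓞 F) (n : ℕ) :
    v.valuation F (a : F) ≤ exp (-n : ℤ) ↔ a ∈ v.asIdeal ^ n := by
  rw [← v.intValuation_le_pow_iff_mem, ← v.valuation_of_algebraMap (K := F)]

theorem exists_integer_approx {c : F} (hc : v.valuation F c ≤ 1) :
    ∃ a : 𝓞 F, v.valuation F (c - a) < 1 := by
  obtain ⟨a, ha⟩ := v.exists_valuation_sub_lt_of_integer hc 1
  exact ⟨a, by rw [Valuation.map_sub_swap]; exact ha⟩

/-- Valuation-integral elements agree with elements of 𝓞 F up to the maximal ideal, so both residue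
properties are those of the finite field 𝓞 F / v: ternary forms are isotropic, and in characteristic
two every element is a square. -/
theorem exists_isFiniteDVR : ∃ π : F, IsFiniteDVR (v.valuation F) π := by
  obtain ⟨π, hπ⟩ := v.valuation_exists_uniformizer F
  have := v.isMaximal
  let _ : Field (𝓞 F ⧸ v.asIdeal) := Ideal.Quotient.field v.asIdeal
  have : Finite (𝓞 F ⧸ v.asIdeal) := Ideal.finiteQuotientOfFreeOfNeBot v.asIdeal v.ne_bot
  have hmem : ∀ a : 𝓞 F, v.valuation F (a : F) < 1 ↔ Ideal.Quotient.mk v.asIdeal a = 0 := fun a => by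
    rw [Ideal.Quotient.eq_zero_iff_mem]; exact v.valuation_lt_one_iff_mem a
  have hint : ∀ a : 𝓞 F, v.valuation F (a : F) ≤ 1 := fun a => v.valuation_le_one a
  refine ⟨π, hπ, ?_, ?_⟩
  · intro a b c d e f ha hb hc hd he hf
    obtain ⟨a', ha'⟩ := exists_integer_approx v ha
    obtain ⟨b', hb'⟩ := exists_integer_approx v hb
    obtain ⟨c', hc'⟩ := exists_integer_approx v hc
    obtain ⟨d', hd'⟩ := exists_integer_approx v hd
    obtain ⟨e', he'⟩ := exists_integer_approx v he
    obtain ⟨f', hf'⟩ := exists_integer_approx v hf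
    obtain ⟨x, y, z, hne, h0⟩ := exists_ternary_zero (Ideal.Quotient.mk v.asIdeal a')
      (Ideal.Quotient.mk v.asIdeal b') (Ideal.Quotient.mk v.asIdeal c')
      (Ideal.Quotient.mk v.asIdeal d') (Ideal.Quotient.mk v.asIdeal e')
      (Ideal.Quotient.mk v.asIdeal f')
    obtain ⟨x, rfl⟩ := Ideal.Quotient.mk_surjective x
    obtain ⟨y, rfl⟩ := Ideal.Quotient.mk_surjective y
    obtain ⟨z, rfl⟩ := Ideal.Quotient.mk_surjective z
    have hunit : ∀ t : 𝓞 F, Ideal.Quotient.mk v.asIdeal t ≠ 0 → v.valuation F (t : F) = 1 :=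
      fun t ht => (hint t).eq_of_not_lt fun hlt => ht ((hmem t).mp hlt)
    refine ⟨x, y, z, hint _, hint _, hint _, ?_, ?_⟩
    · exact hne.imp (hunit x) (Or.imp (hunit y) (hunit z))
    · have h1 : v.valuation F ((a' * x ^ 2 + b' * y ^ 2 + c' * z ^ 2 + d' * (x * y) + e' * (x * z) +
          f' * (y * z) : 𝓞 F) : F) < 1 := (hmem _).mpr (by simpa using h0)
      have h2 : ∀ {s t : F} (r : 𝓞 F), v.valuation F (s - t) < 1 →
          v.valuation F ((r : F) * (s - t)) < 1 := fun r hr => val_mul_lt_one (hint r) hr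
      have h3 := val_add_lt_one h1 (val_add_lt_one (val_add_lt_one (val_add_lt_one (val_add_lt_one
        (val_add_lt_one (h2 (x ^ 2) ha') (h2 (y ^ 2) hb')) (h2 (z ^ 2) hc')) (h2 (x * y) hd'))
        (h2 (x * z) he')) (h2 (y * z) hf'))
      convert h3 using 2
      push_cast
      ring
  · intro h2 a ha
    obtain ⟨a', ha'⟩ := exists_integer_approx v ha
    have hchar : ringChar (𝓞 F ⧸ v.asIdeal) = 2 := by
      have : ((2 : ℕ) : 𝓞 F ⧸ v.asIdeal) = 0 := by
        have := (hmem ((2 : ℕ) : 𝓞 F)).mp (by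
          rwa [show (((2 : ℕ) : 𝓞 F) : F) = 2 from
            (map_natCast (algebraMap (𝓞 F) F) 2).trans Nat.cast_ofNat])
        rwa [map_natCast] at this
      have hd := (ringChar.spec _ 2).mp this
      exact ((Nat.dvd_prime Nat.prime_two).mp hd).resolve_left (CharP.ringChar_ne_one)
    obtain ⟨s, hs⟩ := FiniteField.isSquare_of_char_two hchar (Ideal.Quotient.mk v.asIdeal a')
    obtain ⟨s, rfl⟩ := Ideal.Quotient.mk_surjective s
    refine ⟨s, hint s, ?_⟩
    have h1 : v.valuation F ((a' - s ^ 2 : 𝓞 F) : F) < 1 := (hmem _).mpr (by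
      rw [map_sub, map_pow, hs]; ring)
    have := val_add_lt_one ha' h1
    convert this using 2
    push_cast
    ring

end FiniteDVR

/-! ### Integrality of reduced traces and norms -/

section Integrality

variable {F : Type*} [Field F] [CharZero F] {B : Type*} [Ring B] [Algebra F B] [Module.Finite F B]
  [IsQuat F B] {R : Type*} [CommRing R] [IsDomain R] [IsIntegrallyClosed R] [Algebra R F]
  [IsFractionRing R F] [Algebra R B] [IsScalarTower R F B]

variable (F) in
theorem redCharpoly_monic (b : B) : (redCharpoly F b).Monic := by
  rw [redCharpoly]; monicity!

variable (F) in
theorem aeval_redCharpoly (b : B) : Polynomial.aeval b (redCharpoly F b) = 0 := by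
  simp only [redCharpoly, map_add, map_sub, map_mul, map_pow, Polynomial.aeval_X,
    Polynomial.aeval_C]
  rw [sq, mul_self_eq (F := F) b]
  simp [Algebra.algebraMap_eq_smul_one]

/-- For b not a scalar, the reduced characteristic polynomial is the minimal polynomial, so it
divides any monic integral equation of b and is integral by Gauss's lemma. Scalars have a minimal
polynomial of degree one and are treated apart. -/
theorem isIntegral_redTrace_and_redNorm {b : B} (hb : IsIntegral R b) :
    (∃ t : R, algebraMap R F t = redTrace F b) ∧ ∃ t : R, algebraMap R F t = redNorm F b := by
  obtain ⟨f, hf, hfb⟩ := hb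
  have hfb' : Polynomial.aeval b (f.map (algebraMap R F)) = 0 := by
    rw [Polynomial.aeval_map_algebraMap]; exact hfb
  by_cases hs : ∃ c : F, b = c • 1
  · obtain ⟨c, rfl⟩ := hs
    have : IsIntegral R c := by
      refine ⟨f, hf, ?_⟩
      have h1 : (c • 1 : B) = algebraMap F B c := (Algebra.algebraMap_eq_smul_one c).symm
      rw [h1, Polynomial.aeval_algebraMap_apply, Polynomial.aeval_map_algebraMap] at hfb'
      have : Nontrivial B := ⟨1, 0, fun h => by
        have := IsQuat.redNorm_one (F := F) (B := B)
        rw [h, redNorm_zero] at this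
        exact zero_ne_one this⟩
      exact (map_eq_zero_iff _ (algebraMap F B).injective).mp hfb'
    obtain ⟨t, rfl⟩ := IsIntegrallyClosed.isIntegral_iff.mp this
    refine ⟨⟨2 * t, ?_⟩, t ^ 2, ?_⟩
    · rw [redTrace_smul_one, map_mul, map_ofNat]
    · rw [redNorm_smul_one, map_pow]
  · have hdvd : redCharpoly F b ∣ f.map (algebraMap R F) := by
      rw [← Polynomial.modByMonic_eq_zero_iff_dvd (redCharpoly_monic F b)]
      set r := f.map (algebraMap R F) %ₘ redCharpoly F b with hr
      have hrb : Polynomial.aeval b r = 0 := by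
        rw [hr, Polynomial.modByMonic_eq_sub_mul_div, map_sub, map_mul,
          aeval_redCharpoly, zero_mul, sub_zero, hfb']
      have hnat : (redCharpoly F b).natDegree = 2 := by
        rw [redCharpoly]; compute_degree!
      have hdeg : r.natDegree ≤ 1 := by
        have := Polynomial.natDegree_modByMonic_lt (f.map (algebraMap R F))
          (redCharpoly_monic F b) (fun h => by simp [h] at hnat)
        rw [← hr, hnat] at this
        omega
      rw [Polynomial.eq_X_add_C_of_natDegree_le_one hdeg] at hrb ⊢
      simp only [map_add, map_mul, Polynomial.aeval_C, Polynomial.aeval_X,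
        Algebra.algebraMap_eq_smul_one, smul_mul_assoc, one_mul] at hrb
      have h1 : r.coeff 1 = 0 := by
        by_contra h1
        refine hs ⟨-((r.coeff 1)⁻¹ * r.coeff 0), ?_⟩
        have := congrArg (fun x => (r.coeff 1)⁻¹ • x) (eq_neg_of_add_eq_zero_left hrb)
        simpa [smul_smul, inv_mul_cancel₀ h1] using this
      have h0 : r.coeff 0 = 0 := by
        rw [h1, zero_smul, zero_add] at hrb
        by_contra h0
        refine hs ⟨0, ?_⟩
        have h10 : (1 : B) = 0 := (smul_eq_zero.mp hrb).resolve_left h0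
        rw [← mul_one b, h10]; simp
      simp [h1, h0]
    obtain ⟨g, hg⟩ := IsIntegrallyClosed.eq_map_mul_C_of_dvd F hf hdvd
    rw [(redCharpoly_monic F b).leadingCoeff, map_one, mul_one] at hg
    refine ⟨⟨-g.coeff 1, ?_⟩, g.coeff 0, ?_⟩
    · rw [map_neg, ← Polynomial.coeff_map, hg, redCharpoly]
      simp [Polynomial.coeff_C]
    · rw [← Polynomial.coeff_map, hg, redCharpoly]
      simp

end Integrality

/-! ### Localizing a maximal order inside the global algebra -/

section LocAt

variable {F : Type*} [Field F] [NumberField F] {B : Type*} [Ring B] [Algebra F B]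
  (O : Subalgebra (𝓞 F) B)

/-- The localization of an order at a finite place, inside the global algebra. -/
def locAt (v : HeightOneSpectrum (𝓞 F)) : Subring B where
  carrier := {x | ∃ s : 𝓞 F, s ∉ v.asIdeal ∧ s • x ∈ O}
  mul_mem' := by
    rintro x y ⟨s, hs, hx⟩ ⟨t, ht, hy⟩
    refine ⟨s * t, fun h => (v.isPrime.mem_or_mem h).elim hs ht, ?_⟩
    rw [← smul_mul_smul_comm]; exact mul_mem hx hy
  one_mem' := ⟨1, (Ideal.ne_top_iff_one _).mp v.isPrime.ne_top, by rw [one_smul]; exact one_mem O⟩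
  add_mem' := by
    rintro x y ⟨s, hs, hx⟩ ⟨t, ht, hy⟩
    refine ⟨s * t, fun h => (v.isPrime.mem_or_mem h).elim hs ht, ?_⟩
    rw [smul_add]
    refine add_mem ?_ ?_
    · rw [mul_comm, mul_smul]; exact O.smul_mem hx t
    · rw [mul_smul]; exact O.smul_mem hy s
  zero_mem' := ⟨1, (Ideal.ne_top_iff_one _).mp v.isPrime.ne_top, by simp⟩
  neg_mem' := by
    rintro x ⟨s, hs, hx⟩
    exact ⟨s, hs, by rw [smul_neg]; exact neg_mem hx⟩

variable {O} {v : HeightOneSpectrum (𝓞 F)}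

theorem mem_locAt_of_mem {x : B} (hx : x ∈ O) : x ∈ locAt O v :=
  ⟨1, (Ideal.ne_top_iff_one _).mp v.isPrime.ne_top, by rwa [one_smul]⟩

theorem integer_smul_eq (s : 𝓞 F) (x : B) : s • x = (s : F) • x := (algebraMap_smul F s x).symm

theorem smul_mem_locAt {c : F} (hc : v.valuation F c ≤ 1) {x : B} (hx : x ∈ locAt O v) :
    c • x ∈ locAt O v := by
  obtain ⟨s, hs, hx⟩ := hx
  obtain ⟨n, ⟨d, hd⟩, hnd⟩ := v.exists_primeCompl_mul_eq_of_integer c hc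
  refine ⟨d * s, fun h => (v.isPrime.mem_or_mem h).elim hd hs, ?_⟩
  have : (d * s) • c • x = n • s • x := by
    simp only [integer_smul_eq, smul_smul]
    congr 1
    have hnd' : c * (d : F) = n := hnd
    rw [← hnd']
    simp only [map_mul]
    ring
  rw [this]
  exact O.smul_mem hx n

/-- Elements which are locally in `O` at all places are in `O`. -/
theorem mem_of_forall_mem_locAt {x : B} (hx : ∀ v, x ∈ locAt O v) : x ∈ O := by
  let 𝔞 : Ideal (𝓞 F) := (Subalgebra.toSubmodule O).comap (LinearMap.toSpanSingleton (𝓞 F) B x)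
  have hmem : ∀ s, s ∈ 𝔞 ↔ s • x ∈ O := fun s => Iff.rfl
  by_cases h : 𝔞 = ⊤
  · have : (1 : 𝓞 F) ∈ 𝔞 := h ▸ Submodule.mem_top
    rw [hmem, one_smul] at this
    exact this
  · obtain ⟨P, hP, hle⟩ := Ideal.exists_le_maximal 𝔞 h
    have hbot := Ring.ne_bot_of_isMaximal_of_not_isField hP (NumberField.RingOfIntegers.not_isField F)
    obtain ⟨s, hs, hsx⟩ := hx ⟨P, hP.isPrime, hbot⟩
    exact absurd (hle ((hmem s).mpr hsx)) hs

theorem exists_smul_mem (hO : IsOrder O) (x : B) : ∃ s : 𝓞 F, s ≠ 0 ∧ s • x ∈ O := by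
  have hx : x ∈ Submodule.span F (O : Set B) := hO.2 ▸ Submodule.mem_top
  induction hx using Submodule.span_induction with
  | mem x hx => exact ⟨1, one_ne_zero, by rwa [one_smul]⟩
  | zero => exact ⟨1, one_ne_zero, by simp⟩
  | add x y _ _ ihx ihy =>
    obtain ⟨s, hs, hx⟩ := ihx
    obtain ⟨t, ht, hy⟩ := ihy
    refine ⟨s * t, mul_ne_zero hs ht, ?_⟩
    rw [smul_add]
    refine add_mem ?_ ?_
    · rw [mul_comm, mul_smul]; exact O.smul_mem hx t
    · rw [mul_smul]; exact O.smul_mem hy s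
  | smul a x _ ih =>
    obtain ⟨s, hs, hx⟩ := ih
    obtain ⟨n, d, hd, rfl⟩ := IsFractionRing.div_surjective (A := 𝓞 F) a
    have hd0 : d ≠ 0 := nonZeroDivisors.ne_zero hd
    refine ⟨s * d, mul_ne_zero hs hd0, ?_⟩
    have : (s * d) • (algebraMap (𝓞 F) F n / algebraMap (𝓞 F) F d) • x = n • s • x := by
      simp only [integer_smul_eq, smul_smul]
      congr 1
      have : algebraMap (𝓞 F) F d ≠ 0 := by simpa using hd0
      simp only [map_mul]
      field_simp
    rw [this]; exact O.smul_mem hx n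

/-- Clearing the denominators of `x` away from `v`. -/
theorem exists_smul_mem_locAt (hO : IsOrder O) (v : HeightOneSpectrum (𝓞 F)) (x : B) :
    ∃ s : 𝓞 F, s ∉ v.asIdeal ∧ ∀ u : HeightOneSpectrum (𝓞 F), u ≠ v → s • x ∈ locAt O u := by
  obtain ⟨t, ht, htx⟩ := exists_smul_mem hO x
  -- Write (t) = vⁿ J with v not dividing J and take s in J outside v. For u ≠ v, an r in vⁿ outside
  -- u gives r s ∈ (t), and t x ∈ O.
  have hfin : FiniteMultiplicity v.asIdeal (Ideal.span {t}) :=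
    FiniteMultiplicity.of_prime_left v.prime (by simpa using ht)
  obtain ⟨J, hJ, hvJ⟩ := hfin.exists_eq_pow_mul_and_not_dvd
  rw [Ideal.dvd_iff_le, SetLike.not_le_iff_exists] at hvJ
  obtain ⟨s, hsJ, hsv⟩ := hvJ
  refine ⟨s, hsv, fun u hu => ?_⟩
  have hnle : ¬ v.asIdeal ^ multiplicity v.asIdeal (Ideal.span {t}) ≤ u.asIdeal := by
    intro hle
    have := u.isPrime.le_of_pow_le hle
    exact hu (HeightOneSpectrum.ext (v.isMaximal.eq_of_le u.isPrime.ne_top this).symm)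
  rw [SetLike.not_le_iff_exists] at hnle
  obtain ⟨r, hr, hru⟩ := hnle
  have hrs : r * s ∈ Ideal.span {t} := by rw [hJ]; exact Ideal.mul_mem_mul hr hsJ
  obtain ⟨r', hr'⟩ := Ideal.mem_span_singleton'.mp hrs
  refine ⟨r, hru, ?_⟩
  rw [← mul_smul, ← hr', mul_smul]
  exact O.smul_mem htx r'

theorem isOrder_of_le {O' : Subalgebra (𝓞 F) B} (hO : IsOrder O) (hle : O ≤ O') {a : 𝓞 F}
    (ha : a ≠ 0) (h : ∀ x ∈ O', a • x ∈ O) : IsOrder O' := by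
  refine ⟨?_, ?_⟩
  · have hfin : Module.Finite (𝓞 F) (Subalgebra.toSubmodule O) := Module.Finite.iff_fg.mpr hO.1
    have hN : IsNoetherian (𝓞 F) (Subalgebra.toSubmodule O) := isNoetherian_of_isNoetherianRing_of_finite _ _
    have hinj : Function.Injective (LinearMap.lsmul (𝓞 F) B a) := by
      intro x y hxy
      simp only [LinearMap.lsmul_apply, integer_smul_eq] at hxy
      exact smul_right_injective B (r := (a : F)) (by simpa using ha) hxy
    refine Submodule.fg_of_fg_map_injective _ hinj ?_
    have hle' : (Subalgebra.toSubmodule O').map (LinearMap.lsmul (𝓞 F) B a) ≤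
        Subalgebra.toSubmodule O := by
      rintro _ ⟨x, hx, rfl⟩
      exact h x hx
    exact (isNoetherian_submodule.mp hN) _ hle'
  · rw [eq_top_iff, ← hO.2]
    exact Submodule.span_mono hle

theorem exists_mem_pow_ne_zero (v : HeightOneSpectrum (𝓞 F)) {c : F} (hc : c ≠ 0) :
    ∃ a : 𝓞 F, a ≠ 0 ∧ v.valuation F (a : F) ≤ v.valuation F c := by
  obtain ⟨n, d, hd, rfl⟩ := IsFractionRing.div_surjective (A := 𝓞 F) c
  have hd0 : algebraMap (𝓞 F) F d ≠ 0 := by simpa using nonZeroDivisors.ne_zero hd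
  have hn0 : n ≠ 0 := by rintro rfl; simp at hc
  refine ⟨n, hn0, ?_⟩
  rw [map_div₀]
  have h1 : v.valuation F (algebraMap (𝓞 F) F d) ≤ 1 := v.valuation_le_one d
  rw [le_div_iff₀ (zero_lt_iff.mpr (by simpa using hd0))]
  exact mul_le_of_le_one_right' h1

variable [Module.Finite F B] [IsQuat F B]

theorem isIntegral_of_mem_order (hO : IsOrder O) {x : B} (hx : x ∈ O) : IsIntegral (𝓞 F) x :=
  IsIntegral.of_mem_of_fg O hO.1 x hx

theorem exists_redTrace_eq (hO : IsOrder O) {x : B} (hx : x ∈ O) :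
    ∃ t : 𝓞 F, (t : F) = redTrace F x :=
  (isIntegral_redTrace_and_redNorm (isIntegral_of_mem_order hO hx)).1

theorem exists_redNorm_eq (hO : IsOrder O) {x : B} (hx : x ∈ O) :
    ∃ t : 𝓞 F, (t : F) = redNorm F x :=
  (isIntegral_redTrace_and_redNorm (isIntegral_of_mem_order hO hx)).2

theorem canonInv_mem_order (hO : IsOrder O) {x : B} (hx : x ∈ O) : canonInv F x ∈ O := by
  obtain ⟨t, ht⟩ := exists_redTrace_eq hO hx
  rw [canonInv_def, ← ht, ← integer_smul_eq]
  exact sub_mem (O.smul_mem (one_mem O) t) hx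

/-- A maximal order is locally maximal. -/
theorem le_locAt_of_le (hmax : IsMaximalOrder O) {π : F} (hπ : π ≠ 0) {Λ : Subring B}
    (hle : locAt O v ≤ Λ) {N : ℕ} (hN : ∀ x ∈ Λ, π ^ N • x ∈ locAt O v) : Λ ≤ locAt O v := by
  -- Replacing the localization at v by Λ and keeping all the others gives a global order containing
  -- O, hence equal to O.
  let O' : Subalgebra (𝓞 F) B :=
    { carrier := {x | x ∈ Λ ∧ ∀ u : HeightOneSpectrum (𝓞 F), u ≠ v → x ∈ locAt O u}
      mul_mem' := fun hx hy => ⟨mul_mem hx.1 hy.1, fun u hu => mul_mem (hx.2 u hu) (hy.2 u hu)⟩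
      add_mem' := fun hx hy => ⟨add_mem hx.1 hy.1, fun u hu => add_mem (hx.2 u hu) (hy.2 u hu)⟩
      algebraMap_mem' := fun r => ⟨hle (mem_locAt_of_mem (O.algebraMap_mem r)),
        fun u _ => mem_locAt_of_mem (O.algebraMap_mem r)⟩ }
  have hmem : ∀ x, x ∈ O' ↔ x ∈ Λ ∧ ∀ u : HeightOneSpectrum (𝓞 F), u ≠ v → x ∈ locAt O u :=
    fun x => Iff.rfl
  have hOO' : O ≤ O' := fun x hx =>
    (hmem x).mpr ⟨hle (mem_locAt_of_mem hx), fun u _ => mem_locAt_of_mem hx⟩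
  obtain ⟨a, ha, hav⟩ := exists_mem_pow_ne_zero v (pow_ne_zero N hπ)
  have hO' : IsOrder O' := by
    refine isOrder_of_le hmax.prop hOO' ha fun x hx => mem_of_forall_mem_locAt fun u => ?_
    rw [integer_smul_eq]
    by_cases hu : u = v
    · subst hu
      have : (a : F) • x = ((a : F) * (π ^ N)⁻¹) • π ^ N • x := by
        rw [smul_smul, inv_mul_cancel_right₀ (pow_ne_zero N hπ)]
      rw [this]
      refine smul_mem_locAt ?_ (hN x hx.1)
      rw [map_mul, map_inv₀]
      exact mul_inv_le_one_of_le₀ hav zero_le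
    · exact smul_mem_locAt (u.valuation_le_one a) (((hmem x).mp hx).2 u hu)
  have hle' : O' ≤ O := hmax.le_of_ge hO' hOO'
  intro x hx
  obtain ⟨s, hs, hsx⟩ := exists_smul_mem_locAt hmax.prop v x
  refine ⟨s, hs, hle' ((hmem _).mpr ⟨?_, hsx⟩)⟩
  rw [Algebra.smul_def]
  exact mul_mem (hle (mem_locAt_of_mem (O.algebraMap_mem s))) hx

theorem exists_finite_reps (hO : IsOrder O) {π : F} (hw : IsFiniteDVR (v.valuation F) π) :
    ∃ s : Finset B, ∀ x ∈ locAt O v, ∃ y ∈ s, x - y ∈ scaled (locAt O v) π := by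
  classical
  have hsc : ∀ {c : F} {x : B}, v.valuation F c < 1 → x ∈ O → c • x ∈ scaled (locAt O v) π := by
    intro c x hc hx
    rw [mem_scaled, smul_smul]
    exact smul_mem_locAt ((hw.lt_one_iff c).mp hc) (mem_locAt_of_mem hx)
  obtain ⟨G, hG⟩ := hO.1
  have hGO : ∀ g ∈ G, g ∈ O := fun g hg => by
    have : g ∈ Subalgebra.toSubmodule O := hG ▸ Submodule.subset_span hg
    exact this
  have : Finite (𝓞 F ⧸ v.asIdeal) := Ideal.finiteQuotientOfFreeOfNeBot v.asIdeal v.ne_bot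
  have := Fintype.ofFinite (𝓞 F ⧸ v.asIdeal)
  refine ⟨Finset.univ.image fun c : G → 𝓞 F ⧸ v.asIdeal => ∑ g : G, (c g).out • (g : B), ?_⟩
  have hO : ∀ x ∈ O, ∃ c : G → 𝓞 F ⧸ v.asIdeal,
      x - ∑ g : G, (c g).out • (g : B) ∈ scaled (locAt O v) π := by
    intro x hx
    have hx' : x ∈ Submodule.span (𝓞 F) (G : Set B) := hG ▸ hx
    obtain ⟨f, rfl⟩ := (Submodule.mem_span_finset').mp hx'
    refine ⟨fun g => Ideal.Quotient.mk _ (f g), ?_⟩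
    rw [← Finset.sum_sub_distrib]
    refine AddSubgroup.sum_mem _ fun g _ => ?_
    rw [← sub_smul, integer_smul_eq]
    refine hsc ?_ (hGO g g.2)
    rw [v.valuation_lt_one_iff_mem, ← Ideal.Quotient.eq_zero_iff_mem, map_sub, sub_eq_zero]
    exact (Ideal.Quotient.mk_out _).symm
  rintro x ⟨s, hs, hsx⟩
  -- Inverting the denominator s modulo v makes x congruent to t s x ∈ O modulo π.
  obtain ⟨t, ht⟩ : ∃ t : 𝓞 F, 1 - t * s ∈ v.asIdeal := by
    have := v.isMaximal
    obtain ⟨y, i, hi, hy⟩ := v.isMaximal.exists_inv hs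
    exact ⟨y, by rw [← hy]; simpa using hi⟩
  obtain ⟨c, hc⟩ := hO _ (O.smul_mem hsx t)
  refine ⟨_, Finset.mem_image_of_mem _ (Finset.mem_univ c), ?_⟩
  have h1 : x - t • s • x ∈ scaled (locAt O v) π := by
    rw [← mul_smul]
    nth_rewrite 1 [← one_smul (𝓞 F) x]
    rw [← sub_smul, integer_smul_eq, mem_scaled, smul_smul]
    refine smul_mem_locAt ((hw.lt_one_iff _).mp ?_) ⟨s, hs, hsx⟩
    rwa [v.valuation_lt_one_iff_mem]
  have := add_mem h1 hc
  rwa [sub_add_sub_cancel] at this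

/-- The localization of a maximal order at a finite place is a maximal order. -/
theorem localOrder_locAt (hmax : IsMaximalOrder O) {π : F}
    (hw : IsFiniteDVR (v.valuation F) π) : LocalOrder (v.valuation F) π (locAt O v) := by
  have hs1 : ∀ s : 𝓞 F, s ∉ v.asIdeal → v.valuation F (s : F) = 1 := fun s hs =>
    (v.valuation_eq_one_iff_notMem).mpr hs
  refine { hw with
    smul_mem := fun c x hc hx => smul_mem_locAt hc hx
    trace_le := ?_
    norm_le := ?_
    exists_pow_smul_mem := ?_
    finite_reps := exists_finite_reps hmax.prop hw
    maximal := fun Λ hle ⟨N, hN⟩ => le_locAt_of_le hmax hw.ne_zero hle hN }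
  · rintro x ⟨s, hs, hsx⟩
    obtain ⟨t, ht⟩ := exists_redTrace_eq hmax.prop hsx
    have : v.valuation F (t : F) ≤ 1 := val_integer_le_one v t
    rw [ht, integer_smul_eq, redTrace_smul, map_mul, hs1 s hs, one_mul] at this
    exact this
  · rintro x ⟨s, hs, hsx⟩
    obtain ⟨t, ht⟩ := exists_redNorm_eq hmax.prop hsx
    have : v.valuation F (t : F) ≤ 1 := val_integer_le_one v t
    rw [ht, integer_smul_eq, redNorm_smul, map_mul, map_pow, hs1 s hs, one_pow, one_mul] at this
    exact this
  · intro x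
    obtain ⟨s, hs, hsx⟩ := exists_smul_mem hmax.prop x
    have hs0 : (s : F) ≠ 0 := by simpa using hs
    obtain ⟨N, hN⟩ := hw.exists_pow_lt hs0
    refine ⟨N, ?_⟩
    have : π ^ N • x = (π ^ N * (s : F)⁻¹) • s • x := by
      rw [integer_smul_eq, smul_smul, inv_mul_cancel_right₀ hs0]
    rw [this]
    refine smul_mem_locAt ?_ (mem_locAt_of_mem hsx)
    rw [map_mul, map_inv₀]
    exact mul_inv_le_one_of_le₀ hN.le zero_le

end LocAt

/-! ### From local elements to elements of the global order -/

section Globalize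

variable {F : Type*} [Field F] [NumberField F] {B : Type*} [Ring B] [Algebra F B]
  {O : Subalgebra (𝓞 F) B}

theorem scaled_locAt_mono {v : HeightOneSpectrum (𝓞 F)} {c d : F} (hc : c ≠ 0)
    (hcd : v.valuation F c ≤ v.valuation F d) : scaled (locAt O v) c ≤ scaled (locAt O v) d := by
  intro x hx
  have : d⁻¹ • x = (d⁻¹ * c) • c⁻¹ • x := by
    rw [smul_smul, mul_assoc, mul_inv_cancel₀ hc, mul_one]
  rw [mem_scaled, this]
  refine smul_mem_locAt ?_ hx
  rw [map_mul, map_inv₀, mul_comm]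
  exact mul_inv_le_one_of_le₀ hcd zero_le

theorem smul_mem_scaled_locAt {v : HeightOneSpectrum (𝓞 F)} {c d : F}
    (hcd : v.valuation F c ≤ v.valuation F d) {x : B} (hx : x ∈ locAt O v) :
    c • x ∈ scaled (locAt O v) d := by
  rw [mem_scaled, smul_smul]
  refine smul_mem_locAt ?_ hx
  rw [map_mul, map_inv₀, mul_comm]
  exact mul_inv_le_one_of_le₀ hcd zero_le

theorem exists_pow_le {v : HeightOneSpectrum (𝓞 F)} {a : F} (ha : a ≠ 0) :
    ∃ n : ℕ, ∀ s : 𝓞 F, s ∈ v.asIdeal ^ n → v.valuation F (s : F) ≤ v.valuation F a := by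
  have h0 : v.valuation F a ≠ 0 := by simpa using ha
  refine ⟨(-log (v.valuation F a)).toNat, fun s hs => ?_⟩
  refine ((val_integer_le_exp_iff v s _).mpr hs).trans ?_
  rw [← WithZero.exp_log h0, WithZero.exp_le_exp, WithZero.exp_log h0]
  have := Int.self_le_toNat (-log (v.valuation F a))
  omega

/-- Approximation of elements of the local orders at finitely many places. -/
theorem exists_mem_order_approx (S : Finset (HeightOneSpectrum (𝓞 F)))
    (x : HeightOneSpectrum (𝓞 F) → B) (hx : ∀ v ∈ S, x v ∈ locAt O v) {a : F} (ha : a ≠ 0) :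
    ∃ y ∈ O, ∀ v ∈ S, x v - y ∈ scaled (locAt O v) a := by
  classical
  choose n hn using fun v : HeightOneSpectrum (𝓞 F) => exists_pow_le (v := v) ha
  have h1 : ∀ v ∈ S, ∃ y ∈ O, x v - y ∈ scaled (locAt O v) a := by
    intro v hv
    obtain ⟨s, hs, hsx⟩ := hx v hv
    -- The denominator s is invertible modulo a power of v deep enough to absorb a, so x v is close
    -- to a multiple of s x v in O.
    have hcop : IsCoprime (Ideal.span {s}) (v.asIdeal ^ n v) := by
      apply IsCoprime.pow_right
      rw [Ideal.isCoprime_iff_sup_eq, sup_comm]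
      refine v.isMaximal.out.2 _ (lt_of_le_of_ne le_sup_left fun h => hs ?_)
      rw [h]; exact (le_sup_right : Ideal.span {s} ≤ _) (Ideal.mem_span_singleton_self s)
    obtain ⟨t, ht, r, hr, htr⟩ := Ideal.isCoprime_iff_exists.mp hcop
    obtain ⟨t, rfl⟩ := Ideal.mem_span_singleton'.mp ht
    refine ⟨t • s • x v, O.smul_mem hsx t, ?_⟩
    have : x v - t • s • x v = (r : F) • x v := by
      rw [← mul_smul, ← integer_smul_eq]
      nth_rewrite 1 [← one_smul (𝓞 F) (x v)]
      rw [← sub_smul, ← htr, add_sub_cancel_left]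
    rw [this]
    exact smul_mem_scaled_locAt (hn v r hr) (hx v hv)
  choose! y hyO hy using h1
  -- The e v are approximate idempotents selecting the place v among those of S; they glue the
  -- separate approximations.
  have h2 : ∀ v ∈ S, ∃ e : 𝓞 F, ∀ u ∈ S, e - (if u = v then 1 else 0) ∈ u.asIdeal ^ n u := by
    intro v _
    obtain ⟨e, he⟩ := IsDedekindDomain.exists_forall_sub_mem_ideal (s := S)
      (fun u : HeightOneSpectrum (𝓞 F) => u.asIdeal) n (fun u _ => u.prime)
      (fun u _ w _ huw h => huw (HeightOneSpectrum.ext h)) (fun u => if u.1 = v then 1 else 0)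
    exact ⟨e, fun u hu => he u hu⟩
  choose! e he using h2
  refine ⟨∑ v ∈ S, e v • y v, sum_mem fun v hv => O.smul_mem (hyO v hv) _, fun u hu => ?_⟩
  have h3 : ∑ v ∈ S, e v • y v - y u ∈ scaled (locAt O u) a := by
    have : y u = ∑ v ∈ S, (if u = v then (1 : 𝓞 F) else 0) • y v := by
      simp [ite_smul, hu]
    rw [this, ← Finset.sum_sub_distrib]
    refine sum_mem fun v hv => ?_
    rw [← sub_smul, integer_smul_eq]
    exact smul_mem_scaled_locAt (hn u _ (he v hv u hu)) (mem_locAt_of_mem (hyO v hv))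
  have := sub_mem (hy u hu) h3
  rwa [sub_sub_sub_cancel_right] at this

theorem finite_places_over {a : 𝓞 F} (ha : a ≠ 0) :
    ∃ S : Finset (HeightOneSpectrum (𝓞 F)), ∀ v, v ∉ S → v.valuation F (a : F) = 1 := by
  have hfin : {v : HeightOneSpectrum (𝓞 F) | v.asIdeal ∣ Ideal.span {a}}.Finite :=
    Ideal.finite_factors (by simpa using ha)
  refine ⟨hfin.toFinset, fun v hv => ?_⟩
  rw [val_integer_eq_one_iff]
  intro hmem
  refine hv (hfin.mem_toFinset.mpr ?_)
  rwa [Set.mem_ofPred_eq, Ideal.dvd_span_singleton]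

theorem mul_sub_mul_mem_scaled {Λ : Subring B} {c : F} {x x' y y' : B} (hx' : x' ∈ Λ) (hy : y ∈ Λ)
    (hxx : x - x' ∈ scaled Λ c) (hyy : y - y' ∈ scaled Λ c) : x * y - x' * y' ∈ scaled Λ c := by
  have : x * y - x' * y' = (x - x') * y + x' * (y - y') := by noncomm_ring
  rw [this]
  exact add_mem (mul_mem_scaled_right hxx hy) (mul_mem_scaled_left hx' hyy)

variable [Module.Finite F B] [IsQuat F B]

/-- Approximating the local q and y modulo p² at the places where p is not a unit changes Nr q only
by multiples of p², and preserves the other conditions modulo p. At the remaining places there is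
nothing to check. -/
theorem exists_norm_approx_order (hmax : IsMaximalOrder O) {p : 𝓞 F} (hp : p ≠ 0) :
    ∃ q ∈ O, ∃ y ∈ O, (∃ t : 𝓞 F, redTrace F y = 1 + p * t) ∧
      (∃ r : 𝓞 F, redNorm F q = p + p ^ 2 * r) ∧ (∃ a ∈ O, q * q = p • a) ∧
      ∃ b ∈ O, q * y * q = p • b := by
  have hp0 : (p : F) ≠ 0 := by simpa using hp
  obtain ⟨S, hS⟩ := finite_places_over hp
  choose π hπ using fun v : HeightOneSpectrum (𝓞 F) => exists_isFiniteDVR v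
  have hloc := fun v => localOrder_locAt hmax (hπ v)
  choose q hq y hy hT hn hqq hqyq using fun v =>
    (hloc v).exists_norm_approx hp0 (val_integer_le_one v p)
  obtain ⟨q', hq'O, hq'⟩ := exists_mem_order_approx S q (fun v _ => hq v) (pow_ne_zero 2 hp0)
  obtain ⟨y', hy'O, hy'⟩ := exists_mem_order_approx S y (fun v _ => hy v) (pow_ne_zero 2 hp0)
  have hp2 : ∀ v : HeightOneSpectrum (𝓞 F), v.valuation F ((p : F) ^ 2) ≤ v.valuation F (p : F) := by
    intro v
    rw [sq, map_mul]; exact mul_le_of_le_one_left' (val_integer_le_one v p)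
  have hmono : ∀ v, scaled (locAt O v) ((p : F) ^ 2) ≤ scaled (locAt O v) (p : F) := fun v =>
    scaled_locAt_mono (pow_ne_zero 2 hp0) (hp2 v)
  have hswap : ∀ {v} {x x' : B} {c : F}, x' - x ∈ scaled (locAt O v) c →
      x - x' ∈ scaled (locAt O v) c := fun h => by rw [← neg_sub]; exact neg_mem h
  have htr : ∀ v {x : B} {c : F}, c ≠ 0 → x ∈ scaled (locAt O v) c →
      v.valuation F (redTrace F x) ≤ v.valuation F c := by
    intro v x c hc hx
    have := (hloc v).trace_le _ (mem_scaled.mp hx)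
    rw [redTrace_smul, map_mul, map_inv₀] at this
    rwa [inv_mul_le_iff₀ (zero_lt_iff.mpr (by simpa using hc)), mul_one] at this
  have hglob : ∀ x ∈ O, (∀ v ∈ S, x ∈ scaled (locAt O v) (p : F)) → ∃ a ∈ O, x = p • a := by
    intro x hx h
    refine ⟨(p : F)⁻¹ • x, mem_of_forall_mem_locAt fun v => ?_, ?_⟩
    · by_cases hv : v ∈ S
      · exact h v hv
      · refine smul_mem_locAt ?_ (mem_locAt_of_mem hx)
        rw [map_inv₀, hS v hv, inv_one]
    · rw [integer_smul_eq, smul_smul, mul_inv_cancel₀ hp0, one_smul]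
  have hint : ∀ (x : F) (n : ℕ), (∃ x' : 𝓞 F, (x' : F) = x) →
      (∀ v ∈ S, v.valuation F x ≤ v.valuation F (p : F) ^ n) → ∃ r : 𝓞 F, x = p ^ n * r := by
    rintro x n ⟨x', rfl⟩ h
    obtain ⟨r, hr⟩ := HeightOneSpectrum.mem_integers_of_valuation_le_one F
      (((p : F) ^ n)⁻¹ * x') (fun v => by
        rw [map_mul, map_inv₀, map_pow]
        by_cases hv : v ∈ S
        · rw [mul_comm]; exact mul_inv_le_one_of_le₀ (h v hv) zero_le
        · rw [hS v hv, one_pow, inv_one, one_mul]; exact val_integer_le_one v x')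
    have hr' : (r : F) = ((p : F) ^ n)⁻¹ * x' := hr
    exact ⟨r, by rw [hr', mul_inv_cancel_left₀ (pow_ne_zero n hp0)]⟩
  obtain ⟨ty, hty⟩ := exists_redTrace_eq hmax.prop hy'O
  obtain ⟨nq, hnq⟩ := exists_redNorm_eq hmax.prop hq'O
  refine ⟨q', hq'O, y', hy'O, ?_, ?_, ?_, ?_⟩
  · obtain ⟨t, ht⟩ := hint (redTrace F y' - 1) 1 ⟨ty - 1, by rw [← hty]; simp⟩ fun v hv => by
      rw [← hT v, ← redTrace_sub, pow_one]
      exact (htr v (pow_ne_zero 2 hp0) (hswap (hy' v hv))).trans (hp2 v)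
    exact ⟨t, by rw [← sub_eq_iff_eq_add', ht, pow_one]⟩
  · obtain ⟨r, hr⟩ := hint (redNorm F q' - p) 2 ⟨nq - p, by rw [← hnq]; simp⟩ fun v hv => by
      have h1 : redNorm F q' - p = (redNorm F (q v) - p) + (redNorm F (q' - q v) +
          redTrace F (q v * canonInv F (q' - q v))) := by
        have := IsQuat.redNorm_add (F := F) (q v) (q' - q v)
        rw [add_sub_cancel] at this
        rw [this]; ring
      obtain ⟨z, hz, hqz⟩ : ∃ z ∈ locAt O v, q' - q v = (p : F) ^ 2 • z :=
        ⟨_, hswap (hq' v hv), by rw [smul_smul, mul_inv_cancel₀ (pow_ne_zero 2 hp0), one_smul]⟩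
      have hp4 : v.valuation F (p : F) ^ 2 * v.valuation F (p : F) ^ 2 ≤ v.valuation F (p : F) ^ 2 :=
        mul_le_of_le_one_left' (pow_le_one' (val_integer_le_one v p) 2)
      rw [h1]
      refine (v.valuation F).map_add_le (hn v) ((v.valuation F).map_add_le ?_ ?_)
      · rw [hqz, redNorm_smul, map_mul, map_pow, map_pow, sq (v.valuation F (p : F) ^ 2)]
        exact (mul_le_of_le_one_right' ((hloc v).norm_le z hz)).trans hp4
      · rw [hqz, canonInv_smul, mul_smul_comm, redTrace_smul, map_mul, map_pow]
        exact mul_le_of_le_one_right' ((hloc v).trace_le _ (mul_mem (hq v) ((hloc v).canonInv_mem hz)))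
    exact ⟨r, by rw [← sub_eq_iff_eq_add', hr]⟩
  · refine hglob _ (mul_mem hq'O hq'O) fun v hv => ?_
    have := hmono v (mul_sub_mul_mem_scaled (hq v) (mem_locAt_of_mem hq'O) (hswap (hq' v hv))
      (hswap (hq' v hv)))
    have := add_mem this (hqq v)
    rwa [sub_add_cancel] at this
  · refine hglob _ (mul_mem (mul_mem hq'O hy'O) hq'O) fun v hv => ?_
    have h1 := mul_sub_mul_mem_scaled (hq v) (mem_locAt_of_mem hy'O) (hswap (hq' v hv))
      (hswap (hy' v hv))
    have := hmono v (mul_sub_mul_mem_scaled (mul_mem (hq v) (hy v)) (mem_locAt_of_mem hq'O) h1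
      (hswap (hq' v hv)))
    have := add_mem this (hqyq v)
    rwa [sub_add_cancel] at this

end Globalize

/-! ### Hensel's lemma over 𝓞 F ⊗ ℤ_p -/

section Hensel

theorem mem_smul_top_iff_repr {ι R M : Type*} [Finite ι] [CommRing R] [AddCommGroup M] [Module R M]
    (b : Module.Basis ι R M) (I : Ideal R) (x : M) :
    x ∈ (I • ⊤ : Submodule R M) ↔ ∀ i, b.repr x i ∈ I := by
  have := Fintype.ofFinite ι
  constructor
  · intro hx i
    induction hx using Submodule.smul_induction_on' with
    | smul r hr m _ => simpa using I.mul_mem_right _ hr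
    | add x _ y _ hx hy => simpa using I.add_mem hx hy
  · intro h
    rw [← b.sum_repr x]
    exact Submodule.sum_mem _ fun i _ => Submodule.smul_mem_smul (h i) Submodule.mem_top

theorem isAdicComplete_of_basis {ι R M : Type*} [Finite ι] [CommRing R] [AddCommGroup M]
    [Module R M] (b : Module.Basis ι R M) (I : Ideal R) [IsAdicComplete I R] :
    IsAdicComplete I M where
  haus' := by
    intro x hx
    refine b.repr.map_eq_zero_iff.mp (Finsupp.ext fun i => ?_)
    refine IsHausdorff.haus (I := I) inferInstance _ fun n => ?_
    have := hx n
    rw [SModEq.zero, mem_smul_top_iff_repr b] at this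
    rw [SModEq.zero]
    simpa using this i
  prec' := by
    have := Fintype.ofFinite ι
    intro f hf
    have h1 : ∀ i, ∃ L : R, ∀ n, b.repr (f n) i ≡ L [SMOD (I ^ n • ⊤ : Submodule R R)] := by
      intro i
      refine IsPrecomplete.prec (I := I) inferInstance fun {m n} hmn => ?_
      have := hf hmn
      rw [SModEq.sub_mem, mem_smul_top_iff_repr b] at this
      rw [SModEq.sub_mem]
      simpa using this i
    choose L hL using h1
    refine ⟨∑ i, L i • b i, fun n => ?_⟩
    rw [SModEq.sub_mem, mem_smul_top_iff_repr b]
    intro i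
    have := hL i n
    rw [SModEq.sub_mem] at this
    have hrepr : b.repr (∑ j, L j • b j) i = L i := by
      rw [b.repr_sum_self]
    rw [map_sub, Finsupp.sub_apply, hrepr]
    simpa using this

variable (p : ℕ) [Fact p.Prime]

/-- A finite free ℤ_p-module is p-adically complete, coordinate by coordinate, and complete pairs
are Henselian. -/
theorem henselianRing_padic_tensor (S : Type*) [CommRing S] [Module.Finite ℤ S] [Module.Free ℤ S] :
    HenselianRing (ℤ_[p] ⊗[ℤ] S) (Ideal.span {(p : ℤ_[p] ⊗[ℤ] S)}) := by
  have h1 : IsAdicComplete (IsLocalRing.maximalIdeal ℤ_[p]) (ℤ_[p] ⊗[ℤ] S) :=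
    isAdicComplete_of_basis (Algebra.TensorProduct.basis ℤ_[p] (Module.finBasis ℤ S)) _
  have h2 := (IsAdicComplete.map_algebraMap_iff (S := ℤ_[p] ⊗[ℤ] S)
    (IsLocalRing.maximalIdeal ℤ_[p]) (ℤ_[p] ⊗[ℤ] S)).mpr h1
  rw [PadicInt.maximalIdeal_eq_span_p, Ideal.map_span, Set.image_singleton, map_natCast] at h2
  exact IsAdicComplete.henselianRing _ _

/-- Hensel's lemma for an equation with unit linear coefficient. -/
theorem exists_root_of_henselianRing {R : Type*} [CommRing R] (x : R)
    [HenselianRing R (Ideal.span {x})] (r t₀ n : R) :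
    ∃ t : R, (1 + x * r) * (1 + t * (1 + x * t₀) + t ^ 2 * n) = 1 := by
  set α := (1 + x * r) * n
  set β := (1 + x * r) * (1 + x * t₀) with hβ
  set c := x * r
  -- The equation reads α t² + β t + c = 0 with β ≡ 1 and c ≡ 0. Substituting t = s / α makes it
  -- monic in s; as the roots of f have product α c, t is recovered as -c / (s + β), without
  -- dividing by α.
  let f : R[X] := Polynomial.X ^ 2 + Polynomial.C β * Polynomial.X + Polynomial.C (α * c)
  have hf : f.Monic := by simp only [f]; monicity!
  have hx : x ∈ Ideal.span {x} := Ideal.mem_span_singleton_self x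
  have hquot : Ideal.Quotient.mk (Ideal.span {x}) x = 0 := Ideal.Quotient.eq_zero_iff_mem.mpr hx
  have hβ1 : Ideal.Quotient.mk (Ideal.span {x}) β = 1 := by
    simp [hβ, c, hquot]
  obtain ⟨s, hs, hsx⟩ := HenselianRing.is_henselian (I := Ideal.span {x}) f hf 0
    (by
      simp only [f, Polynomial.eval_add, Polynomial.eval_mul, Polynomial.eval_pow,
        Polynomial.eval_X, Polynomial.eval_C]
      rw [← Ideal.Quotient.eq_zero_iff_mem]
      simp [c, hquot])
    (by
      have : Polynomial.eval 0 (Polynomial.derivative f) = β := by simp [f]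
      rw [this, hβ1]; exact isUnit_one)
  rw [sub_zero] at hsx
  have hs0 : s ^ 2 + β * s + α * c = 0 := by simpa [f] using hs
  have hunit : IsUnit (s + β) := by
    have hmem : s + β - 1 ∈ (⊥ : Ideal R).jacobson := by
      refine HenselianRing.jac (I := Ideal.span {x}) ?_
      rw [← Ideal.Quotient.eq_zero_iff_mem, map_sub, map_add, hβ1,
        Ideal.Quotient.eq_zero_iff_mem.mpr hsx, map_one]
      ring
    have := Ideal.mem_jacobson_bot.mp hmem 1
    simpa using this
  obtain ⟨u, hu⟩ := hunit
  refine ⟨-c * (↑u⁻¹ : R), ?_⟩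
  have hui : (↑u⁻¹ : R) * (s + β) = 1 := by rw [← hu]; exact u.inv_mul
  set w := (↑u⁻¹ : R)
  have : (1 + x * r) * (1 + -c * w * (1 + x * t₀) + (-c * w) ^ 2 * n) - 1 =
      c + β * (-c * w) + α * (-c * w) ^ 2 := by
    simp only [α, β, c]; ring
  rw [← sub_eq_zero, this]
  linear_combination (-(c * (w * (s + β) + 1)) + c * β * w) * hui + c * w ^ 2 * hs0

end Hensel

/-! ### Exact factorizations of p and their divisibility properties -/

section NormElement

variable {A : Type*} [Ring A]

/-- Correcting an approximate factorization `q q̄ ≡ p` to an exact one. -/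
theorem correction_mul {p r q q' y y' t T n : A} (hr : ∀ x, Commute r x) (ht : ∀ x, Commute t x)
    (hp : ∀ x, Commute p x) (hT : ∀ x, Commute T x) (hn : ∀ x, Commute n x)
    (hq : q * q' = p * (1 + p * r)) (hq' : q' * q = p * (1 + p * r)) (hy : y + y' = T)
    (hyn : y * y' = n) (h : (1 + p * r) * (1 + t * T + t ^ 2 * n) = 1) :
    q * (1 + t * y) * ((1 + t * y') * q') = p ∧ ((1 + t * y') * q') * (q * (1 + t * y)) = p := by
  have hyn' : y' * y = n := by
    have : y' = T - y := by rw [← hy]; abel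
    rw [this, sub_mul, (hT y).eq, ← mul_sub, ← this, hyn]
  have h1 : (1 + t * y) * (1 + t * y') = 1 + t * T + t ^ 2 * n := by
    have : t * y * (t * y') = t ^ 2 * (y * y') := by
      rw [mul_assoc, ← mul_assoc y, ← (ht y).eq]; noncomm_ring
    have e : (1 + t * y) * (1 + t * y') = 1 + t * (y + y') + t * y * (t * y') := by noncomm_ring
    rw [e, this, hyn, hy]
  have h2 : (1 + t * y') * (1 + t * y) = 1 + t * T + t ^ 2 * n := by
    have : t * y' * (t * y) = t ^ 2 * (y' * y) := by
      rw [mul_assoc, ← mul_assoc y', ← (ht y').eq]; noncomm_ring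
    have e : (1 + t * y') * (1 + t * y) = 1 + t * (y + y') + t * y' * (t * y) := by noncomm_ring
    rw [e, this, hyn', hy]
  have hc : ∀ x, Commute (1 + t * T + t ^ 2 * n) x := fun x =>
    ((Commute.one_left x).add_left ((ht x).mul_left (hT x))).add_left
      (((ht x).pow_left 2).mul_left (hn x))
  have hpr : ∀ x, Commute (p * (1 + p * r)) x := fun x =>
    (hp x).mul_left ((Commute.one_left x).add_left ((hp x).mul_left (hr x)))
  constructor
  · rw [mul_assoc, ← mul_assoc (1 + t * y), h1, (hc q').eq, ← mul_assoc, hq, mul_assoc, h, mul_one]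
  · rw [mul_assoc, ← mul_assoc q', hq', ← mul_assoc, ← (hpr _).eq, mul_assoc, h2, mul_assoc, h,
      mul_one]

/-- Multiplying q by 1 + t y creates the term t q y q in the middle of the square; this is why q y
q, and not only q², was made divisible by p. -/
theorem correction_sq {p q y t a b : A} (ht : ∀ x, Commute t x) (hp : ∀ x, Commute p x)
    (hqq : q * q = p * a) (hqyq : q * y * q = p * b) :
    ∃ c, (q * (1 + t * y)) * (q * (1 + t * y)) = p * c ∧
      ((1 + t * y) * q) * ((1 + t * y) * q) = p * ((1 + t * y) * (a + t * b)) := by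
  have h1 : q * (t * y) * q = t * (q * y * q) := by
    rw [← mul_assoc, ← (ht q).eq]; noncomm_ring
  have h2 : q * (1 + t * y) * q = p * (a + t * b) := by
    rw [mul_add, add_mul, h1, mul_one, hqq, hqyq, mul_add, ← mul_assoc t, (ht p).eq, mul_assoc]
  refine ⟨(a + t * b) * (1 + t * y), ?_, ?_⟩
  · rw [← mul_assoc, h2, mul_assoc]
  · rw [mul_assoc, ← mul_assoc q, h2, ← mul_assoc, ← (hp _).eq, mul_assoc]

/-- Multiply Φ² = p c by Ψ and cancel p. Applied both ways, Φ and Ψ have the same image, which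
yields FM = VM. -/
theorem eq_mul_of_sq_eq {p Φ Ψ c : A} (hp : ∀ x, Commute p x) (hp0 : ∀ x, p * x = 0 → x = 0)
    (hΨΦ : Ψ * Φ = p) (hc : Φ * Φ = p * c) : Φ = Ψ * c := by
  have h1 : p * (Φ - Ψ * c) = 0 := by
    rw [mul_sub, ← mul_assoc p, (hp Ψ).eq, mul_assoc, ← hc, ← mul_assoc, hΨΦ, sub_self]
  exact sub_eq_zero.mp (hp0 _ h1)

/-- Φ commutes with Ψ² because ΦΨ = ΨΦ = p, and p cancels. Commuting makes the divisibilities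
two-sided, so that they survive transposition. -/
theorem commute_of_sq_eq {p Φ Ψ c : A} (hp : ∀ x, Commute p x) (hp0 : ∀ x, p * x = 0 → x = 0)
    (hΦΨ : Φ * Ψ = p) (hΨΦ : Ψ * Φ = p) (hc : Ψ * Ψ = p * c) : Commute Φ c := by
  have h1 : p * (Φ * c - c * Φ) = 0 := by
    rw [mul_sub, ← mul_assoc, (hp Φ).eq, mul_assoc, ← hc, ← mul_assoc p, ← hc, ← mul_assoc, hΦΨ,
      mul_assoc, hΨΦ, (hp Ψ).eq, sub_self]
  exact sub_eq_zero.mp (hp0 _ h1)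

end NormElement

/-! ### Norms of polynomials and restriction of scalars -/

section NormPolynomial

variable {K L : Type*} [Field K] [Field L] [Algebra K L] [FiniteDimensional K L]

theorem eval_charpoly_eq_det {V : Type*} [AddCommGroup V] [Module K V] [FiniteDimensional K V]
    (f : Module.End K V) (x : K) : f.charpoly.eval x = LinearMap.det (x • LinearMap.id - f) := by
  let b := Module.finBasis K V
  rw [← LinearMap.charpoly_toMatrix f b, ← LinearMap.det_toMatrix b, Matrix.charpoly,
    ← Polynomial.coe_evalRingHom, RingHom.map_det]
  congr 1
  ext i j
  simp only [RingHom.mapMatrix_apply, Matrix.map_apply, Matrix.charmatrix_apply, map_sub, map_smul,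
    LinearMap.toMatrix_id, Matrix.sub_apply, Matrix.smul_apply, Polynomial.coe_evalRingHom,
    Polynomial.eval_sub, Polynomial.eval_C, Matrix.diagonal_apply, Matrix.one_apply, smul_eq_mul]
  split_ifs <;> simp

-- A K-basis of L is also a K[X]-basis of L[X]; in it, the multiplication matrix of q specializes at
-- x to that of q(x).
attribute [local instance] Polynomial.algebra in
theorem eval_norm_polynomial (q : L[X]) (x : K) :
    (Algebra.norm K[X] q).eval x = Algebra.norm K (q.eval (algebraMap K L x)) := by
  classical
  let b := Module.finBasis K L
  let c : Module.Basis (Fin (Module.finrank K L)) K[X] L[X] :=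
    (Algebra.IsPushout.out (R := K) (S := K[X]) (R' := L) (S' := L[X])).basis b
  have hc : ∀ i, c i = Polynomial.C (b i) := fun i => IsBaseChange.basis_apply _ _ i
  rw [Algebra.norm_eq_matrix_det c, Algebra.norm_eq_matrix_det b, ← Polynomial.coe_evalRingHom,
    RingHom.map_det]
  congr 1
  ext i j
  rw [RingHom.mapMatrix_apply, Matrix.map_apply, Algebra.leftMulMatrix_eq_repr_mul,
    Algebra.leftMulMatrix_eq_repr_mul]
  have h1 := c.sum_repr (q * c j)
  have h2 := congrArg (Polynomial.eval (algebraMap K L x)) h1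
  simp only [hc, Polynomial.eval_finsetSum, Polynomial.eval_mul, Polynomial.eval_C,
    Algebra.smul_def, Polynomial.algebraMap_def, Polynomial.coe_mapRingHom,
    Polynomial.eval_map_algebraMap, Polynomial.aeval_algebraMap_apply] at h2
  rw [← h2]
  simp only [← Algebra.smul_def, Polynomial.coe_evalRingHom, Polynomial.coe_aeval_eq_eval]
  rw [b.repr_sum_self, hc]

-- K is infinite, so evaluations suffice; there both sides are determinants, and the determinant
-- over K is the norm of the determinant over L.
attribute [local instance] Polynomial.algebra in
theorem charpoly_restrictScalars [Infinite K] {V : Type*} [AddCommGroup V] [Module K V]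
    [Module L V] [IsScalarTower K L V] [FiniteDimensional L V] [FiniteDimensional K V]
    (f : Module.End L V) :
    (f.restrictScalars K : Module.End K V).charpoly = Algebra.norm K[X] f.charpoly := by
  refine Polynomial.funext fun x => ?_
  rw [eval_norm_polynomial, eval_charpoly_eq_det, eval_charpoly_eq_det,
    ← LinearMap.det_restrictScalars]
  congr 1
  ext v
  simp

-- The quadratic is the characteristic polynomial of a companion matrix, so its norm is again a
-- characteristic polynomial, over K.
attribute [local instance] Polynomial.algebra in
theorem norm_monic_quadratic [Infinite K] (t n : L) :
    (Algebra.norm K[X] (Polynomial.X ^ 2 - Polynomial.C t * Polynomial.X + Polynomial.C n)).Monic := by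
  have h : (Matrix.toLin' !![0, -n; 1, t]).charpoly =
      Polynomial.X ^ 2 - Polynomial.C t * Polynomial.X + Polynomial.C n := by
    rw [Matrix.charpoly_toLin', Matrix.charpoly_fin_two]
    simp
  rw [← h, ← charpoly_restrictScalars]
  exact LinearMap.charpoly_monic _

end NormPolynomial

/-! ### The order as a ℤ-lattice -/

section Lattice

variable {F : Type*} [Field F] [NumberField F] {B : Type*} [Ring B] [Algebra F B]
  {O : Subalgebra (𝓞 F) B}

theorem exists_int_smul_mem (hO : IsOrder O) (x : B) : ∃ n : ℤ, n ≠ 0 ∧ n • x ∈ O := by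
  obtain ⟨s, hs, hsx⟩ := exists_smul_mem hO x
  have hN : Algebra.norm ℤ s ≠ 0 := Algebra.norm_ne_zero_iff.mpr hs
  refine ⟨Algebra.norm ℤ s, hN, ?_⟩
  obtain ⟨t, ht⟩ : s ∣ algebraMap ℤ (𝓞 F) (Algebra.norm ℤ s) := by
    have := Ideal.absNorm_mem (Ideal.span {s})
    rw [Ideal.absNorm_span_singleton, Ideal.mem_span_singleton] at this
    rcases Int.natAbs_eq (Algebra.norm ℤ s) with h | h
    · rw [h]; simpa using this
    · rw [h]; simpa using this
  have : Algebra.norm ℤ s • x = t • s • x := by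
    rw [← mul_smul, mul_comm, ← ht]
    simp [← Int.cast_smul_eq_zsmul (𝓞 F)]
  rw [this]; exact O.smul_mem hsx t

theorem finite_int_order (hO : IsOrder O) : Module.Finite ℤ O := by
  have : Module.Finite (𝓞 F) O := Module.Finite.iff_fg.mpr hO.1
  exact Module.Finite.trans (𝓞 F) O

theorem free_int_order (hO : IsOrder O) : Module.Free ℤ O := by
  have := finite_int_order hO
  have : Module.IsTorsionFree ℤ B := Module.IsTorsionFree.trans_faithfulSMul ℤ F B
  have : Module.IsTorsionFree ℤ O := inferInstanceAs (Module.IsTorsionFree ℤ (Subalgebra.toSubmodule O))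
  exact Module.free_of_finite_type_torsion_free'

variable (O) in
/-- The inclusion of an order, as a `ℤ`-linear map. -/
def orderSubtype : O →ₗ[ℤ] B := O.val.toLinearMap.restrictScalars ℤ

theorem isLocalizedModule_orderSubtype [Algebra ℚ B] (hO : IsOrder O) :
    IsLocalizedModule (nonZeroDivisors ℤ) (orderSubtype O) where
  map_units n := by
    have hn : ((n : ℤ) : ℚ) ≠ 0 := by simp
    rw [Module.End.isUnit_iff]
    constructor
    · intro x y hxy
      have hxy' : (n : ℤ) • x = (n : ℤ) • y := hxy
      rw [← Int.cast_smul_eq_zsmul ℚ, ← Int.cast_smul_eq_zsmul ℚ] at hxy'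
      exact smul_right_injective B hn hxy'
    · intro x
      refine ⟨((n : ℤ) : ℚ)⁻¹ • x, ?_⟩
      show (n : ℤ) • ((n : ℤ) : ℚ)⁻¹ • x = x
      rw [← Int.cast_smul_eq_zsmul ℚ, smul_smul, mul_inv_cancel₀ hn, one_smul]
  surj x := by
    obtain ⟨n, hn, hx⟩ := exists_int_smul_mem hO x
    exact ⟨(⟨n • x, hx⟩, ⟨n, mem_nonZeroDivisors_of_ne_zero hn⟩), rfl⟩
  exists_of_eq {x y} h := ⟨1, by rw [Subtype.ext h]⟩

variable {ι : Type*}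

/-- A `ℤ`-basis of an order is a `ℚ`-basis of the algebra. -/
def latticeBasis [Algebra ℚ B] (hO : IsOrder O) (b : Module.Basis ι ℤ O) : Module.Basis ι ℚ B :=
  haveI := isLocalizedModule_orderSubtype hO
  b.ofIsLocalizedModule ℚ (nonZeroDivisors ℤ) (orderSubtype O)

theorem latticeBasis_apply [Algebra ℚ B] (hO : IsOrder O) (b : Module.Basis ι ℤ O) (i : ι) :
    latticeBasis hO b i = b i := by
  have := isLocalizedModule_orderSubtype hO
  exact b.ofIsLocalizedModule_apply ℚ (nonZeroDivisors ℤ) (orderSubtype O) i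

theorem latticeBasis_repr [Algebra ℚ B] (hO : IsOrder O) (b : Module.Basis ι ℤ O) (x : O) (i : ι) :
    (latticeBasis hO b).repr (x : B) i = b.repr x i := by
  have := isLocalizedModule_orderSubtype hO
  exact b.ofIsLocalizedModule_repr_apply ℚ (nonZeroDivisors ℤ) (orderSubtype O) x i

theorem toMatrix_latticeBasis [Algebra ℚ B] [Fintype ι] [DecidableEq ι] (hO : IsOrder O)
    (b : Module.Basis ι ℤ O) (x : O) :
    LinearMap.toMatrix (latticeBasis hO b) (latticeBasis hO b) (LinearMap.mulLeft ℚ (x : B)) =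
      (Algebra.leftMulMatrix b x).map (Int.castRingHom ℚ) := by
  ext i j
  rw [LinearMap.toMatrix_apply, latticeBasis_apply, Matrix.map_apply,
    Algebra.leftMulMatrix_eq_repr_mul]
  exact latticeBasis_repr hO b (x * b j) i

theorem card_eq_finrank [Fintype ι] (hO : IsOrder O) (b : Module.Basis ι ℤ O) :
    Fintype.card ι = Module.finrank ℚ F * Module.finrank F B := by
  let _ : Algebra ℚ B := Algebra.compHom B (algebraMap ℚ F)
  have : IsScalarTower ℚ F B := IsScalarTower.of_algebraMap_eq' rfl
  rw [Module.finrank_mul_finrank, Module.finrank_eq_card_basis (latticeBasis hO b)]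

/-- Over ℚ, left multiplication has characteristic polynomial g², with g the norm of the reduced
one. As g is a monic divisor of a monic integral polynomial, Gauss's lemma makes it integral. -/
theorem exists_isAbsRedCharpoly [Fintype ι] [DecidableEq ι] [Module.Finite F B] [IsQuat F B]
    (hO : IsOrder O) (b : Module.Basis ι ℤ O) (x : O) :
    ∃ P : ℤ[X], IsAbsRedCharpoly F (x : B) P ∧ P.Monic ∧
      (Algebra.leftMulMatrix b x).charpoly = P ^ 2 := by
  let _ : Algebra ℚ B := Algebra.compHom B (algebraMap ℚ F)
  have : IsScalarTower ℚ F B := IsScalarTower.of_algebraMap_eq' rfl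
  have : FiniteDimensional ℚ B := Module.Finite.trans F B
  let _ := Polynomial.algebra ℚ F
  set g : ℚ[X] := Algebra.norm ℚ[X] (redCharpoly F (x : B)) with hg
  have hgm : g.Monic := norm_monic_quadratic _ _
  have hQ : (Algebra.leftMulMatrix b x).charpoly.map (Int.castRingHom ℚ) = g ^ 2 := by
    rw [← Matrix.charpoly_map, ← toMatrix_latticeBasis hO b, LinearMap.charpoly_toMatrix]
    have : LinearMap.mulLeft ℚ (x : B) = (LinearMap.mulLeft F (x : B)).restrictScalars ℚ := rfl
    rw [this, charpoly_restrictScalars, IsQuat.charpoly, map_pow]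
  obtain ⟨P, hP⟩ := IsIntegrallyClosed.eq_map_mul_C_of_dvd ℚ
    (f := (Algebra.leftMulMatrix b x).charpoly) (Matrix.charpoly_monic _) (g := g) (by
      have : (Algebra.leftMulMatrix b x).charpoly.map (algebraMap ℤ ℚ) = g ^ 2 := hQ
      rw [this]; exact dvd_pow_self g two_ne_zero)
  rw [hgm.leadingCoeff, map_one, mul_one] at hP
  have hinj : Function.Injective (Int.castRingHom ℚ) := Int.cast_injective
  have hP' : P.map (Int.castRingHom ℚ) = g := hP
  refine ⟨P, hP', ?_, ?_⟩
  · exact Polynomial.monic_of_injective hinj (by rw [hP']; exact hgm)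
  · apply Polynomial.map_injective _ hinj
    rw [hQ, Polynomial.map_pow, hP']

/-- The characteristic polynomial of left multiplication depends only on the reduced
characteristic polynomial. -/
theorem charpoly_leftMulMatrix_congr [Fintype ι] [DecidableEq ι] [Module.Finite F B] [IsQuat F B]
    (hO : IsOrder O) (b : Module.Basis ι ℤ O) {x y : O}
    (h : redCharpoly F (x : B) = redCharpoly F (y : B)) :
    (Algebra.leftMulMatrix b x).charpoly = (Algebra.leftMulMatrix b y).charpoly := by
  obtain ⟨P, hP, -, hx⟩ := exists_isAbsRedCharpoly hO b x
  obtain ⟨Q, hQ, -, hy⟩ := exists_isAbsRedCharpoly hO b y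
  have : P = Q := by
    apply Polynomial.map_injective (Int.castRingHom ℚ) Int.cast_injective
    rw [IsAbsRedCharpoly] at hP hQ
    rw [hP, hQ, h]
  rw [hx, hy, this]

end Lattice

/-! ### Matrices of left and right multiplication -/

section MatLift

variable (p : ℕ) [Fact p.Prime] {ι : Type*} [Fintype ι] [DecidableEq ι]

/-- Integral matrices as `p`-adic matrices. -/
def padicMatrix : Matrix ι ι ℤ →+* Matrix ι ι ℤ_[p] := (Int.castRingHom ℤ_[p]).mapMatrix

theorem padicMatrix_transpose (M : Matrix ι ι ℤ) :
    padicMatrix p Mᵀ = (padicMatrix p M)ᵀ := rfl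

variable {S : Type*} [Ring S]

/-- The `ℤ_p`-linear extension of a ring homomorphism to integral matrices. -/
def matLift (l : S →+* Matrix ι ι ℤ) : S ⊗[ℤ] ℤ_[p] →+* Matrix ι ι ℤ_[p] :=
  (Algebra.TensorProduct.lift ((padicMatrix p).comp l).toIntAlgHom
    (algebraMap ℤ_[p] (Matrix ι ι ℤ_[p])).toIntAlgHom
    (fun _ z => (Algebra.commutes z _).symm)).toRingHom

theorem matLift_tmul (l : S →+* Matrix ι ι ℤ) (x : S) (z : ℤ_[p]) :
    matLift p l (x ⊗ₜ[ℤ] z) = z • padicMatrix p (l x) := by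
  have : matLift p l (x ⊗ₜ[ℤ] z) = padicMatrix p (l x) * algebraMap ℤ_[p] _ z :=
    Algebra.TensorProduct.lift_tmul _ _ _ _ _
  rw [this, ← Algebra.commutes, ← Algebra.smul_def]

theorem padicMatrix_eq_zero {x : Matrix ι ι ℤ_[p]} (h : (p : Matrix ι ι ℤ_[p]) * x = 0) :
    x = 0 := by
  have hp : (p : ℤ_[p]) ≠ 0 := by simpa using (Fact.out : p.Prime).ne_zero
  have h1 : (p : ℤ_[p]) • x = 0 := by
    rw [← h, ← nsmul_eq_mul, Nat.cast_smul_eq_nsmul]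
  exact (smul_eq_zero.mp h1).resolve_left hp

end MatLift

section RightMul

variable {S : Type*} [Ring S] {ι : Type*} [Fintype ι] [DecidableEq ι] (b : Module.Basis ι ℤ S)

/-- The matrix of right multiplication. -/
def rightMulMatrix : S →+ Matrix ι ι ℤ where
  toFun x := LinearMap.toMatrix b b (LinearMap.mulRight ℤ x)
  map_zero' := by simp
  map_add' x y := by
    rw [← map_add]; congr 1; ext z; simp [mul_add]

theorem rightMulMatrix_mul (x y : S) :
    rightMulMatrix b (x * y) = rightMulMatrix b y * rightMulMatrix b x := by
  show LinearMap.toMatrix b b (LinearMap.mulRight ℤ (x * y)) =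
    LinearMap.toMatrix b b (LinearMap.mulRight ℤ y) *
      LinearMap.toMatrix b b (LinearMap.mulRight ℤ x)
  rw [← LinearMap.toMatrix_mul]
  congr 1; ext z; simp [mul_assoc]

theorem commute_leftMulMatrix_rightMulMatrix (x y : S) :
    Commute (Algebra.leftMulMatrix b x) (rightMulMatrix b y) := by
  show LinearMap.toMatrix b b (LinearMap.mulLeft ℤ x) *
    LinearMap.toMatrix b b (LinearMap.mulRight ℤ y) =
    LinearMap.toMatrix b b (LinearMap.mulRight ℤ y) *
    LinearMap.toMatrix b b (LinearMap.mulLeft ℤ x)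
  rw [← LinearMap.toMatrix_mul, ← LinearMap.toMatrix_mul]
  congr 1; ext z; simp [mul_assoc]

theorem rightMulMatrix_eq_leftMulMatrix {x : S} (hx : ∀ y, Commute x y) :
    rightMulMatrix b x = Algebra.leftMulMatrix b x := by
  show LinearMap.toMatrix b b (LinearMap.mulRight ℤ x) =
    LinearMap.toMatrix b b (LinearMap.mulLeft ℤ x)
  congr 1; ext z; simp [(hx z).eq]

end RightMul

/-! ### Frobenius and Verschiebung as right multiplications -/

section FrobeniusMatrix

variable {F : Type*} [Field F] [NumberField F] {B : Type*} [Ring B] [Algebra F B]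
  [Module.Finite F B] [IsQuat F B] {O : Subalgebra (𝓞 F) B}
  {ι : Type*} [Fintype ι] [DecidableEq ι]

/-- The canonical involution of an order. -/
def orderInv (hO : IsOrder O) (x : O) : O := ⟨canonInv F (x : B), canonInv_mem_order hO x.2⟩

variable (p : ℕ) [Fact p.Prime]

/-- Right multiplication by an element `ϖ` of `O ⊗ ℤ_p` of reduced norm `p` with `ϖ² ∈ p O ⊗ ℤ_p`,
and by its conjugate. -/
theorem exists_frobenius_matrix (hmax : IsMaximalOrder O) (b : Module.Basis ι ℤ O) :
    ∃ Φ Ψ X Y : Matrix ι ι ℤ_[p],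
      (∀ x, Commute (padicMatrix p (Algebra.leftMulMatrix b x)) Φ) ∧
      (∀ x, Commute (padicMatrix p (Algebra.leftMulMatrix b x)) Ψ) ∧
      Φ * Ψ = (p : Matrix ι ι ℤ_[p]) ∧ Ψ * Φ = (p : Matrix ι ι ℤ_[p]) ∧
      Φ = Ψ * X ∧ Ψ = Φ * Y ∧ Commute Φ Y ∧ Commute Ψ X ∧
      ∀ G : Matrix ι ι ℤ, (∀ x, (rightMulMatrix b x)ᵀ * G =
          G * rightMulMatrix b (orderInv hmax.prop x)) →
        Φᵀ * padicMatrix p G = padicMatrix p G * Ψ := by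
  have hp0 : ((p : ℕ) : 𝓞 F) ≠ 0 := by simpa using (Fact.out : p.Prime).ne_zero
  obtain ⟨q₀, hq₀, y₀, hy₀, ⟨t₀, ht₀⟩, ⟨r₀, hr₀⟩, ⟨a₀, ha₀, hqq⟩, b₀, hb₀, hqyq⟩ :=
    exists_norm_approx_order hmax hp0
  obtain ⟨n₀, hn₀⟩ := exists_redNorm_eq hmax.prop hy₀
  have hH := henselianRing_padic_tensor p (𝓞 F)
  -- t is chosen so that Nr(1 + t y) is inverse to 1 + p r₀, the unit by which Nr q₀ differs from p.
  obtain ⟨t, ht⟩ := exists_root_of_henselianRing (p : ℤ_[p] ⊗[ℤ] 𝓞 F) (1 ⊗ₜ r₀) (1 ⊗ₜ t₀) (1 ⊗ₜ n₀)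
  let L : O → Matrix ι ι ℤ_[p] := fun x => padicMatrix p (Algebra.leftMulMatrix b x)
  let R : O → Matrix ι ι ℤ_[p] := fun x => padicMatrix p (rightMulMatrix b x)
  have hLR : ∀ x y, Commute (L x) (R y) := fun x y =>
    (commute_leftMulMatrix_rightMulMatrix b x y).map (padicMatrix p)
  have hRmul : ∀ x y, R (x * y) = R y * R x := fun x y => by
    simp only [R, rightMulMatrix_mul, map_mul]
  have hRadd : ∀ x y, R (x + y) = R x + R y := fun x y => by simp only [R, map_add]
  let c : 𝓞 F →+* Matrix ι ι ℤ := (Algebra.leftMulMatrix b).toRingHom.comp (algebraMap (𝓞 F) O)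
  have hcR : ∀ s, padicMatrix p (c s) = R (algebraMap (𝓞 F) O s) := fun s => by
    have := rightMulMatrix_eq_leftMulMatrix b (x := algebraMap (𝓞 F) O s)
      (fun y => Algebra.commutes s y)
    simp only [R, this]; rfl
  have hcL : ∀ s, padicMatrix p (c s) = L (algebraMap (𝓞 F) O s) := fun s => rfl
  let τ : ℤ_[p] ⊗[ℤ] 𝓞 F →+* Matrix ι ι ℤ_[p] :=
    (matLift p c).comp (Algebra.TensorProduct.comm ℤ ℤ_[p] (𝓞 F)).toRingHom
  have hτ : ∀ z s, τ (z ⊗ₜ s) = z • padicMatrix p (c s) := fun z s => matLift_tmul p c s z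
  have hτ1 : ∀ s, τ (1 ⊗ₜ s) = padicMatrix p (c s) := fun s => by rw [hτ, one_smul]
  have hτR : ∀ u x, Commute (τ u) (R x) := by
    intro u x
    induction u using TensorProduct.induction_on with
    | zero => rw [map_zero]; exact Commute.zero_left _
    | tmul z s => rw [hτ, hcL]; exact (hLR _ _).smul_left z
    | add u w hu hw => rw [map_add]; exact hu.add_left hw
  have hτL : ∀ u x, Commute (τ u) (L x) := by
    intro u x
    induction u using TensorProduct.induction_on with
    | zero => rw [map_zero]; exact Commute.zero_left _
    | tmul z s => rw [hτ, hcR]; exact (hLR _ _).symm.smul_left z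
    | add u w hu hw => rw [map_add]; exact hu.add_left hw
  -- In the centralizer of the image of 𝓞 F ⊗ ℤ_p the scalars become central, as the correction
  -- lemmas require; right multiplications lie in it.
  let Z : Subring (Matrix ι ι ℤ_[p]) := Subring.centralizer (Set.range τ)
  have hZ : ∀ x, x ∈ Z ↔ ∀ u, τ u * x = x * τ u := fun x => by
    simp [Z, Subring.mem_centralizer_iff]
  have hRZ : ∀ x, R x ∈ Z := fun x => (hZ _).mpr fun u => (hτR u x).eq
  have hτZ : ∀ u, τ u ∈ Z := fun u => (hZ _).mpr fun w => by rw [← map_mul, mul_comm, map_mul]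
  let R' : O → Z := fun x => ⟨R x, hRZ x⟩
  let τ' : ℤ_[p] ⊗[ℤ] 𝓞 F → Z := fun u => ⟨τ u, hτZ u⟩
  have hcen : ∀ u (x : Z), Commute (τ' u) x := fun u x => Subtype.ext ((hZ _).mp x.2 u)
  have hpc : ∀ x : Z, Commute ((p : ℕ) : Z) x := fun x => Nat.cast_commute p x
  let q : O := ⟨q₀, hq₀⟩
  let y : O := ⟨y₀, hy₀⟩
  let q' : O := orderInv hmax.prop q
  let y' : O := orderInv hmax.prop y
  have hscal : ∀ (x z : O) (s : 𝓞 F), (x * z : B) = (s : F) • (1 : B) → R' z * R' x = τ' (1 ⊗ₜ s) := by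
    intro x z s h
    apply Subtype.ext
    show R z * R x = τ (1 ⊗ₜ s)
    rw [hτ1, hcR, ← hRmul]
    congr 1
    apply Subtype.ext
    show (x * z : B) = algebraMap (𝓞 F) B s
    rw [h, ← integer_smul_eq, Algebra.algebraMap_eq_smul_one]
  have hnorm : τ' (1 ⊗ₜ ((p : 𝓞 F) + (p : 𝓞 F) ^ 2 * r₀)) =
      (p : Z) * (1 + (p : Z) * τ' (1 ⊗ₜ r₀)) := by
    apply Subtype.ext
    show τ (1 ⊗ₜ ((p : 𝓞 F) + (p : 𝓞 F) ^ 2 * r₀)) =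
      (p : Matrix ι ι ℤ_[p]) * (1 + (p : Matrix ι ι ℤ_[p]) * τ (1 ⊗ₜ r₀))
    simp only [hτ1, map_add, map_mul, map_pow, map_natCast]
    rw [mul_add, mul_one, sq, mul_assoc]
  have hnq : (redNorm F q₀ : F) = ((p + p ^ 2 * r₀ : 𝓞 F) : F) := by
    rw [hr₀]; simp
  have hnq1 := hscal q q' _ (by rw [← hnq]; exact IsQuat.mul_canonInv q₀)
  have hnq2 := hscal q' q _ (by rw [← hnq]; exact canonInv_mul_self q₀)
  have hny := hscal y' y _ (by rw [hn₀]; exact canonInv_mul_self y₀)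
  have hTy : R' y + R' y' = τ' (1 ⊗ₜ (1 + p * t₀)) := by
    apply Subtype.ext
    show R y + R y' = τ (1 ⊗ₜ (1 + p * t₀))
    rw [hτ1, hcR, ← hRadd]
    congr 1
    apply Subtype.ext
    show y₀ + canonInv F y₀ = algebraMap (𝓞 F) B (1 + p * t₀)
    rw [canonInv_def, add_sub_cancel, ht₀, Algebra.algebraMap_eq_smul_one, integer_smul_eq]
    simp
  have heq : (1 + (p : Z) * τ' (1 ⊗ₜ r₀)) *
      (1 + τ' t * τ' (1 ⊗ₜ (1 + p * t₀)) + τ' t ^ 2 * τ' (1 ⊗ₜ n₀)) = 1 := by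
    apply Subtype.ext
    have h1 : (1 : ℤ_[p] ⊗[ℤ] 𝓞 F) + (p : ℤ_[p] ⊗[ℤ] 𝓞 F) * (1 ⊗ₜ t₀) =
        1 ⊗ₜ (1 + p * t₀) := by
      rw [TensorProduct.tmul_add, ← Algebra.TensorProduct.one_def, ← nsmul_eq_mul, ← nsmul_eq_mul,
        TensorProduct.tmul_smul]
    rw [h1] at ht
    have := congrArg τ ht
    show (1 + (p : Matrix ι ι ℤ_[p]) * τ (1 ⊗ₜ r₀)) *
      (1 + τ t * τ (1 ⊗ₜ (1 + p * t₀)) + τ t ^ 2 * τ (1 ⊗ₜ n₀)) = 1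
    simpa only [map_mul, map_add, map_one, map_pow, map_natCast] using this
  rw [hnorm] at hnq1 hnq2
  -- Right multiplication reverses products, so the relation for q̄ q supplies R(q) R(q̄) and
  -- conversely.
  obtain ⟨hΦΨ, hΨΦ⟩ := correction_mul (p := (p : Z)) (hcen (1 ⊗ₜ r₀)) (hcen t) hpc (hcen _)
    (hcen _) hnq2 hnq1 hTy hny heq
  have hR3 : ∀ {x z w : O}, (x * z * x : B) = (p : 𝓞 F) • (w : B) →
      R' x * R' z * R' x = (p : Z) * R' w := by
    intro x z w h
    apply Subtype.ext
    show R x * R z * R x = (p : Matrix ι ι ℤ_[p]) * R w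
    rw [mul_assoc, ← hRmul, ← hRmul]
    have : x * z * x = (p : ℕ) • w := by
      apply Subtype.ext
      show (x * z * x : B) = ((p • w : O) : B)
      rw [h]; simp [← Nat.cast_smul_eq_nsmul (𝓞 F)]
    show padicMatrix p (rightMulMatrix b (x * z * x)) = _
    rw [this, map_nsmul, map_nsmul, nsmul_eq_mul]
  have hR2 : ∀ {x w : O}, (x * x : B) = (p : 𝓞 F) • (w : B) → R' x * R' x = (p : Z) * R' w := by
    intro x w h
    have := hR3 (x := x) (z := 1) (w := w) (by simpa using h)
    have h1 : R' 1 = 1 := by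
      apply Subtype.ext
      show R 1 = 1
      have := hcR 1
      simpa using this.symm
    rwa [h1, mul_one] at this
  have hconj : ∀ {u w : B}, u = (p : 𝓞 F) • w → canonInv F u = (p : 𝓞 F) • canonInv F w := by
    rintro u w rfl
    rw [integer_smul_eq, integer_smul_eq, canonInv_smul]
  obtain ⟨X₁, hX₁, -⟩ := correction_sq (q := R' q) (y := R' y) (t := τ' t) (p := (p : Z))
    (a := R' ⟨a₀, ha₀⟩) (b := R' ⟨b₀, hb₀⟩) (hcen t) hpc (hR2 hqq) (hR3 hqyq)
  obtain ⟨-, -, hY₁⟩ := correction_sq (q := R' q') (y := R' y') (t := τ' t) (p := (p : Z))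
    (a := R' (orderInv hmax.prop ⟨a₀, ha₀⟩)) (b := R' (orderInv hmax.prop ⟨b₀, hb₀⟩)) (hcen t) hpc
    (hR2 (by
      show canonInv F q₀ * canonInv F q₀ = (p : 𝓞 F) • canonInv F a₀
      rw [← hconj hqq, IsQuat.canonInv_mul])) (hR3 (by
      show canonInv F q₀ * canonInv F y₀ * canonInv F q₀ = (p : 𝓞 F) • canonInv F b₀
      rw [← hconj hqyq, IsQuat.canonInv_mul, IsQuat.canonInv_mul, mul_assoc]))
  have hp0' : ∀ x : Z, (p : Z) * x = 0 → x = 0 := fun x hx =>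
    Subtype.ext (padicMatrix_eq_zero p (congrArg Subtype.val hx))
  set Φ := R' q * (1 + τ' t * R' y) with hΦ
  set Ψ := (1 + τ' t * R' y') * R' q' with hΨ
  set Y₁ := (1 + τ' t * R' y') *
    (R' (orderInv hmax.prop ⟨a₀, ha₀⟩) + τ' t * R' (orderInv hmax.prop ⟨b₀, hb₀⟩))
  have hLΦ : ∀ x, Commute (L x) Φ.1 := fun x =>
    (hLR x q).mul_right ((Commute.one_right _).add_right ((hτL t x).symm.mul_right (hLR x y)))
  have hLΨ : ∀ x, Commute (L x) Ψ.1 := fun x =>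
    ((Commute.one_right _).add_right ((hτL t x).symm.mul_right (hLR x y'))).mul_right (hLR x q')
  refine ⟨Φ.1, Ψ.1, X₁.1, Y₁.1, hLΦ, hLΨ, congrArg Subtype.val hΦΨ, congrArg Subtype.val hΨΦ,
    congrArg Subtype.val (eq_mul_of_sq_eq hpc hp0' hΨΦ hX₁),
    congrArg Subtype.val (eq_mul_of_sq_eq hpc hp0' hΦΨ hY₁),
    congrArg Subtype.val (commute_of_sq_eq hpc hp0' hΦΨ hΨΦ hY₁),
    congrArg Subtype.val (commute_of_sq_eq hpc hp0' hΨΦ hΦΨ hX₁), fun G hG => ?_⟩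
  have hGR : ∀ x, (R x)ᵀ * padicMatrix p G = padicMatrix p G * R (orderInv hmax.prop x) := fun x => by
    simp only [R, ← padicMatrix_transpose, ← map_mul, hG x]
  -- Scalars are fixed by the canonical involution, hence self-adjoint for G. Then the adjoint of Φ
  -- is the right multiplication by the conjugate, namely Ψ.
  have hGτ : ∀ u, (τ u)ᵀ * padicMatrix p G = padicMatrix p G * τ u := by
    intro u
    induction u using TensorProduct.induction_on with
    | zero => simp
    | tmul z s =>
      have hs : orderInv hmax.prop (algebraMap (𝓞 F) O s) = algebraMap (𝓞 F) O s := by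
        apply Subtype.ext
        show canonInv F (algebraMap (𝓞 F) B s) = algebraMap (𝓞 F) B s
        rw [Algebra.algebraMap_eq_smul_one, integer_smul_eq, canonInv_smul_one]
      rw [hτ, hcR, Matrix.transpose_smul, Matrix.smul_mul, hGR, hs, Matrix.mul_smul]
    | add u w hu hw => rw [map_add, Matrix.transpose_add, add_mul, mul_add, hu, hw]
  have h1 : (1 + τ t * R y)ᵀ * padicMatrix p G = padicMatrix p G * (1 + τ t * R y') := by
    rw [(hτR t y').eq, Matrix.transpose_add, Matrix.transpose_one, Matrix.transpose_mul, add_mul,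
      mul_add, one_mul, mul_one, mul_assoc, hGτ, ← mul_assoc, hGR, mul_assoc]
  show (R q * (1 + τ t * R y))ᵀ * padicMatrix p G = padicMatrix p G * ((1 + τ t * R y') * R q')
  rw [Matrix.transpose_mul, mul_assoc, hGR, ← mul_assoc, h1, mul_assoc]

end FrobeniusMatrix

/-! ### Prescribed valuations and local generators of the inverse different -/

section Approximation

variable {F : Type*} [Field F] [NumberField F]

theorem exists_crt (S : Finset (HeightOneSpectrum (𝓞 F))) (n : ℕ)
    (x : HeightOneSpectrum (𝓞 F) → 𝓞 F) : ∃ y : 𝓞 F, ∀ v ∈ S, y - x v ∈ v.asIdeal ^ n := by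
  obtain ⟨y, hy⟩ := IsDedekindDomain.exists_forall_sub_mem_ideal (s := S)
    (fun u : HeightOneSpectrum (𝓞 F) => u.asIdeal) (fun _ => n) (fun u _ => u.prime)
    (fun u _ w _ huw h => huw (HeightOneSpectrum.ext h)) (fun u => x u.1)
  exact ⟨y, fun v hv => hy v hv⟩

theorem exists_integer_uniformizer (v : HeightOneSpectrum (𝓞 F)) :
    ∃ t : 𝓞 F, v.valuation F (t : F) = exp (-1 : ℤ) := by
  obtain ⟨t, ht⟩ := v.intValuation_exists_uniformizer
  exact ⟨t, (v.valuation_of_algebraMap (K := F) t).trans ht⟩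

/-- The Chinese remainder theorem gives, for each v in S, an element uniformizing at v and a unit at
the rest of S. Modulus v² is needed to fix the valuation at v. -/
theorem exists_valuation_eq (S : Finset (HeightOneSpectrum (𝓞 F)))
    (k : HeightOneSpectrum (𝓞 F) → ℤ) :
    ∃ μ : F, μ ≠ 0 ∧ ∀ v ∈ S, v.valuation F μ = exp (k v) := by
  classical
  have h1 : ∀ v : HeightOneSpectrum (𝓞 F), ∃ t : 𝓞 F, (v ∈ S → v.valuation F (t : F) = exp (-1 : ℤ)) ∧
      (t : F) ≠ 0 ∧ ∀ u ∈ S, u ≠ v → u.valuation F (t : F) = 1 := by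
    intro v
    obtain ⟨t₀, ht₀⟩ := exists_integer_uniformizer v
    obtain ⟨t, ht⟩ := exists_crt (insert v S) 2 (fun u => if u = v then t₀ else 1)
    have hlt : ∀ u ∈ insert v S, u.valuation F ((t - if u = v then t₀ else 1 : 𝓞 F) : F) ≤ exp (-2 : ℤ) :=
      fun u hu => (val_integer_le_exp_iff u _ 2).mpr (ht u hu)
    have hv : v.valuation F (t : F) = exp (-1 : ℤ) := by
      have := hlt v (Finset.mem_insert_self v S)
      rw [if_pos rfl] at this
      have h2 : v.valuation F ((t - t₀ : 𝓞 F) : F) < v.valuation F (t₀ : F) := by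
        rw [ht₀]; exact this.trans_lt (by rw [WithZero.exp_lt_exp]; norm_num)
      have h3 := (v.valuation F).map_add_eq_of_lt_left h2
      rw [← ht₀, ← h3]; congr 1; simp
    refine ⟨t, fun _ => hv, fun h0 => ?_, fun u hu huv => ?_⟩
    · rw [h0, map_zero] at hv; exact WithZero.coe_ne_zero hv.symm
    · have := hlt u (Finset.mem_insert_of_mem hu)
      rw [if_neg huv] at this
      refine val_eq_one_of_sub_lt (x := (1 : F)) (map_one _) ?_
      rw [Valuation.map_sub_swap]
      have h4 : u.valuation F ((t - 1 : 𝓞 F) : F) < 1 := this.trans_lt (by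
        rw [← WithZero.exp_zero, WithZero.exp_lt_exp]; norm_num)
      simpa using h4
  choose t ht ht0 htu using h1
  refine ⟨∏ v ∈ S, (t v : F) ^ (-k v), Finset.prod_ne_zero_iff.mpr fun v _ => zpow_ne_zero _ (ht0 v),
    fun v hv => ?_⟩
  rw [map_prod, Finset.prod_eq_single_of_mem v hv]
  · rw [map_zpow₀, ht v hv, ← WithZero.exp_zsmul]; simp
  · intro u hu huv
    rw [map_zpow₀, htu u v hv huv.symm, one_zpow]

/-- Elements of the inverse different. -/
def IsTraceDual (x : F) : Prop := ∀ c : 𝓞 F, ∃ n : ℤ, (n : ℚ) = Algebra.trace ℚ F (c * x)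

/-- The discriminant of an integral basis clears the denominators of the inverse different. -/
theorem exists_smul_isTraceDual_integer : ∃ a : 𝓞 F, a ≠ 0 ∧ ∀ x : F, IsTraceDual x →
    ∃ y : 𝓞 F, (y : F) = a * x := by
  classical
  let b := NumberField.integralBasis F
  have hint : ∀ i, IsIntegral ℤ (b i) := fun i => by
    rw [NumberField.integralBasis_apply]; exact NumberField.RingOfIntegers.isIntegral_coe _
  have hd : IsIntegral ℤ (Algebra.discr ℚ b) := Algebra.discr_isIntegral ℚ hint
  obtain ⟨a, ha⟩ := IsIntegrallyClosed.isIntegral_iff.mp hd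
  refine ⟨a, ?_, fun x hx => ?_⟩
  · have h0 := Algebra.discr_not_zero_of_basis ℚ b
    rw [← ha] at h0
    simpa using h0
  · have hx' : x ∈ Submodule.traceDual ℤ ℚ (1 : Submodule (𝓞 F) F) := by
      rw [Submodule.mem_traceDual]
      intro c hc
      obtain ⟨c, rfl⟩ := Submodule.mem_one.mp hc
      obtain ⟨n, hn⟩ := hx c
      exact ⟨n, by rw [Algebra.traceForm_apply, mul_comm]; exact hn⟩
    have h1 := isIntegral_discr_mul_of_mem_traceDual (A := ℤ) (K := ℚ) (1 : Submodule (𝓞 F) F) hint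
      (Submodule.mem_one.mpr ⟨1, map_one _⟩) hx'
    refine ⟨⟨_, h1⟩, ?_⟩
    show Algebra.discr ℚ b • (1 : F) * x = _
    rw [← ha, Algebra.smul_def]
    simp

theorem IsTraceDual.smul {x : F} (hx : IsTraceDual x) (c : 𝓞 F) : IsTraceDual ((c : F) * x) :=
  fun e => by
    obtain ⟨n, hn⟩ := hx (e * c)
    exact ⟨n, by rw [hn]; congr 1; push_cast; ring⟩

theorem IsTraceDual.add {x y : F} (hx : IsTraceDual x) (hy : IsTraceDual y) : IsTraceDual (x + y) :=
  fun e => by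
    obtain ⟨n, hn⟩ := hx e
    obtain ⟨m, hm⟩ := hy e
    exact ⟨n + m, by push_cast; rw [hn, hm, mul_add, map_add]⟩

theorem isTraceDual_zero : IsTraceDual (0 : F) := fun e => ⟨0, by simp⟩

theorem isTraceDual_one : IsTraceDual (1 : F) := fun e =>
  ⟨Algebra.trace ℤ (𝓞 F) e, by rw [mul_one]; exact Algebra.coe_trace_int e⟩

/-- Local generators of the inverse different. -/
theorem exists_isTraceDual_le (S : Finset (HeightOneSpectrum (𝓞 F))) :
    ∃ d : F, IsTraceDual d ∧ ∀ v ∈ S, ∀ x, IsTraceDual x → v.valuation F x ≤ v.valuation F d := by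
  classical
  obtain ⟨a, ha, hax⟩ := exists_smul_isTraceDual_integer (F := F)
  have ha0 : (a : F) ≠ 0 := by simpa using ha
  have h1 : ∀ v : HeightOneSpectrum (𝓞 F), ∃ d : F, IsTraceDual d ∧
      ∀ x, IsTraceDual x → v.valuation F x ≤ v.valuation F d := by
    intro v
    have hw : v.valuation F (a : F) ≠ 0 := by simpa using ha0
    -- The exponents of v on the inverse different are bounded above, by the common denominator a,
    -- so the largest is attained.
    obtain ⟨m, ⟨d, hd, hdm⟩, hm⟩ := Int.exists_greatest_of_bdd
      (P := fun n => ∃ x : F, IsTraceDual x ∧ v.valuation F x = exp n)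
      ⟨-log (v.valuation F (a : F)), by
        rintro n ⟨x, hx, hn⟩
        obtain ⟨y, hy⟩ := hax x hx
        have := val_integer_le_one v y
        rw [hy, map_mul, hn, ← WithZero.exp_log hw, ← WithZero.exp_add, ← WithZero.exp_zero,
          WithZero.exp_le_exp] at this
        omega⟩
      ⟨0, 1, isTraceDual_one, by simp⟩
    refine ⟨d, hd, fun x hx => ?_⟩
    by_cases hx0 : v.valuation F x = 0
    · rw [hx0]; exact zero_le
    · rw [hdm, ← WithZero.exp_log hx0, WithZero.exp_le_exp]
      exact hm _ ⟨x, hx, (WithZero.exp_log hx0).symm⟩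
  choose d hd hdmax using h1
  -- The weight e v is a unit at v and a non-unit at the other places of S, so in the weighted sum
  -- the term d v dominates at v.
  have h2 : ∀ v : HeightOneSpectrum (𝓞 F), ∃ e : 𝓞 F, ∀ u ∈ S, e - (if u = v then 1 else 0) ∈ u.asIdeal := by
    intro v
    obtain ⟨e, he⟩ := exists_crt S 1 (fun u => if u = v then 1 else 0)
    exact ⟨e, fun u hu => by simpa using he u hu⟩
  choose e he using h2
  have hsum : ∀ T : Finset (HeightOneSpectrum (𝓞 F)), IsTraceDual (∑ v ∈ T, (e v : F) * d v) := by
    intro T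
    induction T using Finset.induction_on with
    | empty => simpa using isTraceDual_zero
    | insert v T hv ih => rw [Finset.sum_insert hv]; exact ((hd v).smul _).add ih
  have hpos : ∀ v : HeightOneSpectrum (𝓞 F), 0 < v.valuation F (d v) := fun v =>
    lt_of_lt_of_le (by rw [map_one]; exact zero_lt_one) (hdmax v 1 isTraceDual_one)
  refine ⟨∑ v ∈ S, (e v : F) * d v, hsum S, fun v hv x hx => (hdmax v x hx).trans ?_⟩
  have hev : v.valuation F (e v : F) = 1 := by
    rw [val_integer_eq_one_iff]
    intro hmem
    have h3 := he v v hv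
    rw [if_pos rfl] at h3
    have : (1 : 𝓞 F) ∈ v.asIdeal := by simpa using sub_mem hmem h3
    exact v.isPrime.ne_top ((Ideal.eq_top_iff_one _).mpr this)
  have hrest : v.valuation F (∑ u ∈ S.erase v, (e u : F) * d u) < v.valuation F ((e v : F) * d v) := by
    rw [map_mul, hev, one_mul]
    refine Valuation.map_sum_lt _ (hpos v).ne' fun u hu => ?_
    obtain ⟨huv, hu⟩ := Finset.mem_erase.mp hu
    have h3 := he u v hv
    rw [if_neg huv.symm, sub_zero, ← val_integer_lt_one_iff (F := F)] at h3
    rw [map_mul]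
    calc v.valuation F (e u : F) * v.valuation F (d u)
        ≤ v.valuation F (e u : F) * v.valuation F (d v) :=
          mul_le_mul_right (hdmax v _ (hd u)) _
      _ < 1 * v.valuation F (d v) := mul_lt_mul_of_pos_right h3 (hpos v)
      _ = v.valuation F (d v) := one_mul _
  rw [← Finset.add_sum_erase S _ hv, (v.valuation F).map_add_eq_of_lt_left hrest, map_mul, hev, one_mul]

end Approximation

/-! ### The polarization form and its perfectness above p -/

section Form

variable {F : Type*} [Field F] [NumberField F] [NumberField.IsTotallyReal F] {B : Type*} [Ring B]
  [Algebra F B] [Algebra.IsCentral F B] [IsSimpleRing B] [Module.Finite F B] [IsQuat F B]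
  [StarRing B] {O : Subalgebra (𝓞 F) B} {γ : Bˣ}

theorem redNorm_unit_ne_zero (γ : Bˣ) : redNorm F (γ : B) ≠ 0 := by
  intro h
  have := IsQuat.redNorm_mul (F := F) (γ : B) ((γ⁻¹ : Bˣ) : B)
  rw [γ.mul_inv, IsQuat.redNorm_one, h, zero_mul] at this
  exact one_ne_zero this

theorem inv_eq_quatInv (γ : Bˣ) : ((γ⁻¹ : Bˣ) : B) = quatInv (F := F) (γ : B) := by
  have := mul_quatInv (redNorm_unit_ne_zero (F := F) γ)
  rw [← γ.inv_mul_cancel_left (quatInv (F := F) (γ : B)), this, mul_one]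

theorem redTrace_star (hγ : IsTwistingElement F γ) (x : B) :
    redTrace F (star x) = redTrace F x := by
  rw [hγ.2, mul_assoc, redTrace_mul_comm, mul_assoc, γ.inv_mul, mul_one, redTrace_canonInv]

theorem redNorm_star (hγ : IsTwistingElement F γ) (x : B) :
    redNorm F (star x) = redNorm F x := by
  have h1 := IsQuat.redNorm_mul (F := F) (γ : B) ((γ⁻¹ : Bˣ) : B)
  rw [γ.mul_inv, IsQuat.redNorm_one] at h1
  rw [hγ.2, IsQuat.redNorm_mul, IsQuat.redNorm_mul, redNorm_canonInv, mul_right_comm, ← h1, one_mul]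

theorem redCharpoly_star (hγ : IsTwistingElement F γ) (x : B) :
    redCharpoly F (star x) = redCharpoly F x := by
  rw [redCharpoly, redCharpoly, redTrace_star hγ, redNorm_star hγ]

theorem inv_mul_star (hγ : IsTwistingElement F γ) (x : B) :
    ((γ⁻¹ : Bˣ) : B) * star x = canonInv F x * ((γ⁻¹ : Bˣ) : B) := by
  rw [hγ.2, mul_assoc, γ.inv_mul_cancel_left]

theorem star_twisting_inv (hγ : IsTwistingElement F γ) :
    star ((γ⁻¹ : Bˣ) : B) = -((γ⁻¹ : Bˣ) : B) := by
  have h1 : star (γ : B) = -(γ : B) := by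
    rw [hγ.2, eq_neg_of_add_eq_zero_left hγ.1, mul_neg, neg_mul, mul_assoc, γ.mul_inv, mul_one]
  have h2 : star ((γ⁻¹ : Bˣ) : B) * star (γ : B) = 1 := by
    rw [← star_mul, γ.mul_inv, star_one]
  rw [h1, mul_neg, neg_eq_iff_eq_neg] at h2
  rw [← mul_one (star ((γ⁻¹ : Bˣ) : B)), ← γ.mul_inv, ← mul_assoc, h2, neg_one_mul]

/-- The polarization form attached to `δ : F`, `(x, y) ↦ Tr_{F/ℚ}(T(δ γ⁻¹ x^* y))`, before taking
the trace to `ℚ`. -/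
def polForm (γ : Bˣ) (x y : B) : F := redTrace F (((γ⁻¹ : Bˣ) : B) * star x * y)

theorem polForm_mul_left (γ : Bˣ) (c x y : B) :
    polForm (F := F) γ (c * x) y = polForm γ x (star c * y) := by
  simp only [polForm, star_mul, mul_assoc]

/-- γ⁻¹ exchanges * and the canonical involution: γ⁻¹ c^* = c̄ γ⁻¹, and c̄ then cycles through the
trace. Hence Verschiebung has to be right multiplication by the conjugate. -/
theorem polForm_mul_right (hγ : IsTwistingElement F γ) (c x y : B) :
    polForm (F := F) γ (x * c) y = polForm γ x (y * canonInv F c) := by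
  simp only [polForm, star_mul]
  rw [← mul_assoc, inv_mul_star hγ, mul_assoc, mul_assoc, redTrace_mul_comm]
  simp only [mul_assoc]

/-- The reduced trace is invariant under *, and (γ⁻¹)^* = -γ⁻¹. -/
theorem polForm_swap (hγ : IsTwistingElement F γ) (x y : B) :
    polForm (F := F) γ y x = -polForm γ x y := by
  have h := redTrace_star hγ (((γ⁻¹ : Bˣ) : B) * star y * x)
  rw [polForm, ← h, star_mul, star_mul, star_star, star_twisting_inv hγ, mul_neg, mul_neg,
    redTrace_neg, ← mul_assoc, redTrace_mul_comm, ← mul_assoc, polForm]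

theorem polForm_smul_right (γ : Bˣ) (c : F) (x y : B) :
    polForm (F := F) γ x (c • y) = c * polForm γ x y := by
  rw [polForm, mul_smul_comm, redTrace_smul, polForm]

theorem polForm_add_left (γ : Bˣ) (x x' y : B) :
    polForm (F := F) γ (x + x') y = polForm γ x y + polForm γ x' y := by
  simp only [polForm, star_add, mul_add, add_mul, redTrace_add]

theorem polForm_add_right (γ : Bˣ) (x y y' : B) :
    polForm (F := F) γ x (y + y') = polForm γ x y + polForm γ x y' := by
  simp only [polForm, mul_add, redTrace_add]

/-- Conjugation by γ⁻¹ is the composite of * and the canonical involution, both of which preserve O.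
-/
theorem conj_mem_locAt (hO' : IsOrder O) (hO : ∀ b ∈ O, star b ∈ O) (hγ : IsTwistingElement F γ)
    {v : HeightOneSpectrum (𝓞 F)} {x : B} (hx : x ∈ locAt O v) :
    quatInv (F := F) (γ : B) * x * γ ∈ locAt O v := by
  obtain ⟨s, hs, hsx⟩ := hx
  refine ⟨s, hs, ?_⟩
  have h1 : s • (quatInv (F := F) (γ : B) * x * γ) = canonInv F (star (s • x)) := by
    have h2 : s • x = star (star (s • x)) := (star_star _).symm
    rw [hγ.2 (star (s • x))] at h2
    rw [← inv_eq_quatInv, ← smul_mul_assoc, ← mul_smul_comm, h2]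
    simp only [mul_assoc, γ.inv_mul, γ.inv_mul_cancel_left, mul_one]
    rw [← mul_assoc, ← hγ.2, star_star]
  rw [h1]
  exact canonInv_mem_order hO' (hO _ hsx)

/-- The scaling factor making the polarization form perfect above `p`. -/
theorem exists_polForm_scaling (hmax : IsMaximalOrder O) (hO : ∀ b ∈ O, star b ∈ O)
    (hγ : IsTwistingElement F γ)
    (hodd : ∀ v : HeightOneSpectrum (𝓞 F), NoIdempotent (v.valuation F) (locAt O v) →
      ∃ k : ℤ, v.valuation F (redNorm F (γ : B)) = exp (2 * k + 1))
    (p : ℕ) [Fact p.Prime] :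
    ∃ δ : F, (∀ x ∈ O, ∀ y ∈ O, ∃ n : ℤ, (n : ℚ) = Algebra.trace ℚ F (δ * polForm γ x y)) ∧
      ∀ x ∈ O, (∀ y ∈ O, ∃ n : ℤ, (p * n : ℚ) = Algebra.trace ℚ F (δ * polForm γ x y)) →
        ∃ x' ∈ O, x = (p : ℕ) • x' := by
  have hpp : p.Prime := Fact.out
  have hp0 : ((p : ℕ) : 𝓞 F) ≠ 0 := by simpa using hpp.ne_zero
  have hp0F : ((p : ℕ) : F) ≠ 0 := by simpa using hpp.ne_zero
  have hpF : (((p : ℕ) : 𝓞 F) : F) = (p : F) := map_natCast (algebraMap (𝓞 F) F) p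
  obtain ⟨S, hS⟩ := finite_places_over hp0
  rw [hpF] at hS
  choose π hπ using fun v : HeightOneSpectrum (𝓞 F) => exists_isFiniteDVR v
  have hloc := fun v => localOrder_locAt hmax (hπ v)
  choose c hc0 hc using fun v => (hloc v).exists_dual_scaling (redNorm_unit_ne_zero (F := F) γ)
    (fun x hx => conj_mem_locAt hmax.prop hO hγ hx) (hodd v)
  -- μ cancels the local scaling factors c v at all places above p.
  obtain ⟨μ, hμ0, hμ⟩ := exists_valuation_eq S (fun v => -log (v.valuation F (c v)))
  have hμc : ∀ v ∈ S, v.valuation F μ = (v.valuation F (c v))⁻¹ := fun v hv => by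
    have : v.valuation F (c v) ≠ 0 := by simpa using hc0 v
    rw [hμ v hv, WithZero.exp_neg, WithZero.exp_log this]
  obtain ⟨N, hN0, hN⟩ := exists_int_smul_mem hmax.prop (μ • ((γ⁻¹ : Bˣ) : B))
  -- N clears the denominators of μγ⁻¹; only its prime-to-p part N' is used, to get integrality away
  -- from p without changing valuations above p.
  obtain ⟨e, N', hN', hNe⟩ : ∃ (e : ℕ) (N' : ℤ), ¬ (p : ℤ) ∣ N' ∧ N = (p : ℤ) ^ e * N' := by
    have hfin : FiniteMultiplicity (p : ℤ) N := FiniteMultiplicity.of_prime_left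
      (Nat.prime_iff_prime_int.mp hpp) hN0
    obtain ⟨N', h1, h2⟩ := hfin.exists_eq_pow_mul_and_not_dvd
    exact ⟨_, N', h2, h1⟩
  have hNv : ∀ v : HeightOneSpectrum (𝓞 F), v.valuation F (p : F) < 1 → v.valuation F (N' : F) = 1 := by
    intro v hv
    have hcop : IsCoprime (p : ℤ) N' := (Nat.prime_iff_prime_int.mp hpp).coprime_iff_not_dvd.mpr hN'
    obtain ⟨a, b, hab⟩ := hcop
    have hint : ∀ z : ℤ, v.valuation F (z : F) ≤ 1 := fun z => by
      have := val_integer_le_one v (z : 𝓞 F)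
      rwa [show (((z : ℤ) : 𝓞 F) : F) = z from map_intCast (algebraMap (𝓞 F) F) z] at this
    refine (hint N').eq_of_not_lt fun hlt => ?_
    have h1 : v.valuation F ((a : F) * p + b * N') < 1 :=
      val_add_lt_one (val_mul_lt_one (hint a) hv) (val_mul_lt_one (hint b) hlt)
    have h2 : (a : F) * p + b * N' = 1 := by exact_mod_cast congrArg (Int.cast : ℤ → F) hab
    rw [h2, map_one] at h1
    exact lt_irrefl _ h1
  -- Multiplying by a local generator d of the inverse different turns duality for Tr_{F/ℚ} into
  -- duality over 𝓞 F at the places above p; δ will be d N' μ.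
  obtain ⟨d, hd, hdmax⟩ := exists_isTraceDual_le S
  have hd0 : ∀ v ∈ S, 0 < v.valuation F d := fun v hv =>
    lt_of_lt_of_le (by rw [map_one]; exact zero_lt_one) (hdmax v hv 1 isTraceDual_one)
  obtain ⟨ν, hν⟩ : ∃ ν : F, ν = N' * μ := ⟨_, rfl⟩
  have hνc : ∀ v : HeightOneSpectrum (𝓞 F), v.valuation F (p : F) < 1 → v ∈ S ∧
      v.valuation F ν = (v.valuation F (c v))⁻¹ := fun v hv => by
    have hvS : v ∈ S := by
      by_contra hvS
      rw [hS v hvS] at hv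
      exact lt_irrefl _ hv
    exact ⟨hvS, by rw [hν, map_mul, hNv v hv, one_mul, hμc v hvS]⟩
  have hcpos : ∀ v : HeightOneSpectrum (𝓞 F), 0 < v.valuation F (c v) := fun v =>
    zero_lt_iff.mpr (by simpa using hc0 v)
  have hple : ∀ v : HeightOneSpectrum (𝓞 F), v.valuation F (p : F) = 1 ∨ v.valuation F (p : F) < 1 :=
    fun v => by
      have := val_integer_le_one v ((p : ℕ) : 𝓞 F)
      rw [hpF] at this
      exact this.eq_or_lt
  have hval : ∀ x ∈ O, ∀ y ∈ O, ∃ t : 𝓞 F, (t : F) = ν * polForm γ x y := by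
    intro x hx y hy
    obtain ⟨t, ht⟩ := HeightOneSpectrum.mem_integers_of_valuation_le_one F (ν * polForm γ x y) (by
      intro v
      rcases hple v with hv | hv
      · obtain ⟨t, ht⟩ := exists_redTrace_eq hmax.prop (mul_mem hN (mul_mem (hO x hx) hy))
        have h1 : (p : F) ^ e * (ν * polForm γ x y) = t := by
          rw [ht, ← Int.cast_smul_eq_zsmul F, smul_smul, smul_mul_assoc, redTrace_smul, polForm,
            hν, hNe, mul_assoc (((γ⁻¹ : Bˣ) : B))]
          push_cast
          ring
        have h2 := val_integer_le_one v t
        rwa [← h1, map_mul, map_pow, hv, one_pow, one_mul] at h2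
      · rw [map_mul, (hνc v hv).2, inv_mul_le_iff₀ (hcpos v), mul_one, polForm,
          inv_eq_quatInv (F := F)]
        exact (hc v _).mpr (mem_locAt_of_mem (hO x hx)) y (mem_locAt_of_mem hy))
    exact ⟨t, ht⟩
  refine ⟨d * ν, fun x hx y hy => ?_, fun x hx hxy => ?_⟩
  · obtain ⟨t, ht⟩ := hval x hx y hy
    obtain ⟨n, hn⟩ := hd t
    exact ⟨n, by rw [hn, mul_assoc, ← ht, mul_comm d]⟩
  · have hz : (p : F)⁻¹ • star x ∈ O := by
      refine mem_of_forall_mem_locAt fun v => ?_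
      rcases hple v with hv | hv
      · refine smul_mem_locAt ?_ (mem_locAt_of_mem (hO x hx))
        rw [map_inv₀, hv, inv_one]
      · have key : ∀ y ∈ O, v.valuation F (redTrace F (quatInv (F := F) (γ : B) *
            ((p : F)⁻¹ • star x) * y)) ≤ v.valuation F (c v) := by
          intro y hy
          have h1 : redTrace F (quatInv (F := F) (γ : B) * ((p : F)⁻¹ • star x) * y) =
              (p : F)⁻¹ * polForm γ x y := by
            rw [mul_smul_comm, smul_mul_assoc, redTrace_smul, polForm, inv_eq_quatInv (F := F)]
          -- O is stable under 𝓞 F, so divisibility by p of the pairing with all c₀ y says that the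
          -- pairing divided by p lies in the inverse different; maximality of d then bounds the
          -- factor after d.
          have h2 : IsTraceDual (d * (ν * ((p : F)⁻¹ * polForm γ x y))) := by
            intro c₀
            obtain ⟨n, hn⟩ := hxy (c₀ • y) (O.smul_mem hy c₀)
            refine ⟨n, ?_⟩
            have hpQ : (p : ℚ) ≠ 0 := by simpa using hpp.ne_zero
            have h3 : (p : ℚ) • ((c₀ : F) * (d * (ν * ((p : F)⁻¹ * polForm γ x y)))) =
                d * ν * polForm γ x (c₀ • y) := by
              rw [Algebra.smul_def, map_natCast, integer_smul_eq, polForm_smul_right]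
              field_simp
            rw [← h3, map_smul, smul_eq_mul] at hn
            exact mul_left_cancel₀ hpQ hn
          have h4 := hdmax v (hνc v hv).1 _ h2
          rw [map_mul] at h4
          have h5 := (mul_le_iff_le_one_right (hd0 v (hνc v hv).1)).mp h4
          rwa [← h1, map_mul, (hνc v hv).2, inv_mul_le_iff₀ (hcpos v), mul_one] at h5
        refine (hc v _).mp ?_
        rintro l ⟨s, hs, hsl⟩
        have h6 := key _ hsl
        rwa [integer_smul_eq, mul_smul_comm, redTrace_smul, map_mul,
          (val_integer_eq_one_iff v s).mpr hs, one_mul] at h6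
    refine ⟨star ((p : F)⁻¹ • star x), hO _ hz, ?_⟩
    have h7 : (p : ℕ) • ((p : F)⁻¹ • star x) = star x := by
      rw [← Nat.cast_smul_eq_nsmul F, smul_smul, mul_inv_cancel₀ hp0F, one_smul]
    rw [← star_nsmul, h7, star_star]

variable {ι : Type*} [Fintype ι] [DecidableEq ι]

/-- The Gram matrix of a polarization form perfect above `p`. -/
theorem exists_gram_matrix (hmax : IsMaximalOrder O) (hO : ∀ b ∈ O, star b ∈ O)
    (hγ : IsTwistingElement F γ)
    (hodd : ∀ v : HeightOneSpectrum (𝓞 F), NoIdempotent (v.valuation F) (locAt O v) →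
      ∃ k : ℤ, v.valuation F (redNorm F (γ : B)) = exp (2 * k + 1))
    (p : ℕ) [Fact p.Prime] (b : Module.Basis ι ℤ O) :
    ∃ G : Matrix ι ι ℤ, Gᵀ = -G ∧
      (∀ x, (Algebra.leftMulMatrix b x)ᵀ * G = G * Algebra.leftMulMatrix b (orderStar O hO x)) ∧
      (∀ x, (rightMulMatrix b x)ᵀ * G = G * rightMulMatrix b (orderInv hmax.prop x)) ∧
      ¬ (p : ℤ) ∣ G.det := by
  have hpp : p.Prime := Fact.out
  obtain ⟨δ, hδ, hperf⟩ := exists_polForm_scaling hmax hO hγ hodd p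
  choose E hE using fun x y : O => hδ x x.2 y y.2
  have hinj : ∀ {m n : ℤ}, (m : ℚ) = n → m = n := fun h => by exact_mod_cast h
  have haddl : ∀ x x' y, E (x + x') y = E x y + E x' y := fun x x' y => hinj (by
    push_cast
    rw [hE, hE, hE, ← map_add, ← mul_add, ← polForm_add_left]; rfl)
  have haddr : ∀ x y y', E x (y + y') = E x y + E x y' := fun x y y' => hinj (by
    push_cast
    rw [hE, hE, hE, ← map_add, ← mul_add, ← polForm_add_right]; rfl)
  let Eh : O →+ O →+ ℤ := AddMonoidHom.mk' (fun x => AddMonoidHom.mk' (E x) (haddr x))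
    (fun x x' => by ext y; exact haddl x x' y)
  let EB : LinearMap.BilinForm ℤ O := LinearMap.mk₂ ℤ E haddl
    (fun n x y => by
      have := congrArg (fun f : O →+ ℤ => f y) (map_zsmul Eh n x)
      exact this)
    haddr (fun n x y => map_zsmul (Eh x) n y)
  have hEB : ∀ x y, EB x y = E x y := fun x y => rfl
  have hG : ∀ i j, LinearMap.toMatrix₂ b b EB i j = E (b i) (b j) := fun i j =>
    LinearMap.toMatrix₂_apply _ _ _ _ _
  refine ⟨LinearMap.toMatrix₂ b b EB, ?_, fun x => ?_, fun x => ?_, fun hdvd => ?_⟩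
  · ext i j
    rw [Matrix.transpose_apply, Matrix.neg_apply, hG, hG]
    apply hinj
    push_cast
    rw [hE, hE, polForm_swap hγ, mul_neg, map_neg]
  · show (LinearMap.toMatrix b b (LinearMap.mulLeft ℤ x))ᵀ * _ =
      _ * LinearMap.toMatrix b b (LinearMap.mulLeft ℤ (orderStar O hO x))
    rw [← LinearMap.toMatrix₂_comp, ← LinearMap.toMatrix₂_compl₂]
    congr 1
    ext u w
    apply hinj
    show (E (x * u) w : ℚ) = E u (orderStar O hO x * w)
    rw [hE, hE]
    exact congrArg (fun z => Algebra.trace ℚ F (δ * z)) (polForm_mul_left γ (x : B) u w)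
  · show (LinearMap.toMatrix b b (LinearMap.mulRight ℤ x))ᵀ * _ =
      _ * LinearMap.toMatrix b b (LinearMap.mulRight ℤ (orderInv hmax.prop x))
    rw [← LinearMap.toMatrix₂_comp, ← LinearMap.toMatrix₂_compl₂]
    congr 1
    ext u w
    apply hinj
    show (E (u * x) w : ℚ) = E u (w * orderInv hmax.prop x)
    rw [hE, hE]
    exact congrArg (fun z => Algebra.trace ℚ F (δ * z)) (polForm_mul_right hγ (x : B) u w)
  -- If p divided the determinant, a nonzero kernel vector modulo p would lift to some x pairing
  -- with O into pℤ; then x ∈ p O, so the vector was zero.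
  · have hdet : ((LinearMap.toMatrix₂ b b EB).map (Int.castRingHom (ZMod p))).det = 0 := by
      rw [← RingHom.mapMatrix_apply, ← RingHom.map_det]
      exact (ZMod.intCast_zmod_eq_zero_iff_dvd _ p).mpr hdvd
    obtain ⟨w, hw0, hw⟩ := Matrix.exists_vecMul_eq_zero_iff.mpr hdet
    choose u hu using fun i => ZMod.intCast_surjective (w i)
    let x : O := ∑ i, u i • b i
    have hxb : ∀ j, (p : ℤ) ∣ E x (b j) := by
      intro j
      rw [← ZMod.intCast_zmod_eq_zero_iff_dvd]
      have h1 := congrFun hw j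
      rw [Matrix.vecMul, dotProduct] at h1
      have h2 : E x (b j) = ∑ i, u i * E (b i) (b j) := by
        rw [← hEB]
        simp only [x, map_sum, map_smul, LinearMap.sum_apply, LinearMap.smul_apply, smul_eq_mul, hEB]
      rw [h2]
      push_cast
      rw [Pi.zero_apply] at h1
      rw [← h1]
      refine Finset.sum_congr rfl fun i _ => ?_
      rw [hu, Matrix.map_apply, hG]
      simp
    have hxy : ∀ y, (p : ℤ) ∣ E x y := by
      intro y
      rw [← b.sum_repr y, ← hEB]
      simp only [map_sum, map_smul, smul_eq_mul]
      exact Finset.dvd_sum fun j _ => Dvd.dvd.mul_left (hxb j) _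
    obtain ⟨x', hx', hxx'⟩ := hperf x x.2 fun y hy => by
      obtain ⟨n, hn⟩ := hxy ⟨y, hy⟩
      refine ⟨n, ?_⟩
      rw [← hE x ⟨y, hy⟩, hn]
      push_cast; ring
    have hx2 : x = (p : ℤ) • (⟨x', hx'⟩ : O) := by
      apply Subtype.ext
      rw [hxx']
      simp
    apply hw0
    funext i
    have h3 : b.repr x i = u i := by simp only [x]; rw [b.repr_sum_self]
    rw [← hu i, ← h3, hx2, map_smul, Finsupp.smul_apply, smul_eq_mul]
    push_cast
    simp

end Form

/-! ### Reduced trace and norm after extension of the base field -/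

section BaseChange

variable {F : Type*} [Field F] [CharZero F] {B : Type*} [Ring B] [Algebra F B] [Module.Finite F B]
  [IsQuat F B] {K : Type*} [Field K] [Algebra F K]

variable (F B) in
/-- The canonical involution as a linear map. -/
def canonInvLin : B →ₗ[F] B where
  toFun := canonInv F
  map_add' := canonInv_add
  map_smul' := canonInv_smul

variable (F B K) in
/-- The canonical involution of `K ⊗ B`. -/
def bcInv : K ⊗[F] B →ₗ[K] K ⊗[F] B := (canonInvLin F B).baseChange K

variable (F B K) in
/-- The reduced trace of `K ⊗ B`. -/
def bcTrace : K ⊗[F] B →ₗ[K] K :=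
  (TensorProduct.AlgebraTensorModule.rid F K K).toLinearMap ∘ₗ (redTraceLin F B).baseChange K

variable (F) in
/-- The reduced norm of `K ⊗ B`. -/
def bcNorm (x : K ⊗[F] B) : K := 2⁻¹ * bcTrace F B K (x * bcInv F B K x)

theorem bcInv_tmul (a : K) (b : B) : bcInv F B K (a ⊗ₜ b) = a ⊗ₜ canonInv F b := rfl

theorem bcTrace_tmul (a : K) (b : B) : bcTrace F B K (a ⊗ₜ b) = a * algebraMap F K (redTrace F b) := by
  have : bcTrace F B K (a ⊗ₜ b) = redTrace F b • a := rfl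
  rw [this, Algebra.smul_def, mul_comm]

theorem two_ne_zero_bc (F K : Type*) [Field F] [CharZero F] [Field K] [Algebra F K] :
    (2 : K) ≠ 0 := by
  rw [← map_ofNat (algebraMap F K) 2]
  exact (map_ne_zero _).mpr two_ne_zero

theorem bcInv_mul (x y : K ⊗[F] B) : bcInv F B K (x * y) = bcInv F B K y * bcInv F B K x := by
  induction x using TensorProduct.induction_on with
  | zero => simp
  | add x x' hx hx' => rw [add_mul, map_add, hx, hx', map_add, mul_add]
  | tmul a b =>
    induction y using TensorProduct.induction_on with
    | zero => simp
    | add y y' hy hy' => rw [mul_add, map_add, hy, hy', map_add, add_mul]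
    | tmul c d =>
      rw [Algebra.TensorProduct.tmul_mul_tmul, bcInv_tmul, bcInv_tmul, bcInv_tmul,
        Algebra.TensorProduct.tmul_mul_tmul, IsQuat.canonInv_mul, mul_comm]

theorem bcInv_bcInv (x : K ⊗[F] B) : bcInv F B K (bcInv F B K x) = x := by
  induction x using TensorProduct.induction_on with
  | zero => simp
  | add x x' hx hx' => rw [map_add, map_add, hx, hx']
  | tmul a b => rw [bcInv_tmul, bcInv_tmul, canonInv_canonInv]

theorem bcTrace_mul_comm (x y : K ⊗[F] B) : bcTrace F B K (x * y) = bcTrace F B K (y * x) := by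
  induction x using TensorProduct.induction_on with
  | zero => simp
  | add x x' hx hx' => rw [add_mul, map_add, hx, hx', mul_add, map_add]
  | tmul a b =>
    induction y using TensorProduct.induction_on with
    | zero => simp
    | add y y' hy hy' => rw [mul_add, map_add, hy, hy', add_mul, map_add]
    | tmul c d =>
      rw [Algebra.TensorProduct.tmul_mul_tmul, Algebra.TensorProduct.tmul_mul_tmul, bcTrace_tmul,
        bcTrace_tmul, redTrace_mul_comm, mul_comm a c]

theorem tmul_one_eq_smul (a : K) : a ⊗ₜ[F] (1 : B) = a • (1 : K ⊗[F] B) := by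
  rw [Algebra.TensorProduct.one_def, TensorProduct.smul_tmul', smul_eq_mul, mul_one]

theorem tmul_smul_one (a : K) (c : F) :
    a ⊗ₜ[F] (c • (1 : B)) = (a * algebraMap F K c) • (1 : K ⊗[F] B) := by
  rw [TensorProduct.tmul_smul, TensorProduct.smul_tmul', tmul_one_eq_smul, Algebra.smul_def c a, mul_comm]

/-- This polarized form is additive in each variable, so pure tensors suffice; x = y recovers the
norm identity, which is quadratic. -/
theorem mul_bcInv_add (x y : K ⊗[F] B) :
    x * bcInv F B K y + y * bcInv F B K x = bcTrace F B K (x * bcInv F B K y) • 1 := by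
  induction x using TensorProduct.induction_on with
  | zero => simp
  | add x x' hx hx' => rw [add_mul, map_add, mul_add, add_add_add_comm, hx, hx', map_add, add_smul]
  | tmul a b =>
    induction y using TensorProduct.induction_on with
    | zero => simp
    | add y y' hy hy' => rw [map_add, mul_add, add_mul, add_add_add_comm, hy, hy', map_add, add_smul]
    | tmul c d =>
      have h : canonInv F (b * canonInv F d) = d * canonInv F b := by
        rw [IsQuat.canonInv_mul, canonInv_canonInv]
      rw [bcInv_tmul, bcInv_tmul, Algebra.TensorProduct.tmul_mul_tmul,
        Algebra.TensorProduct.tmul_mul_tmul, mul_comm c a, ← TensorProduct.tmul_add, ← h,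
        add_canonInv, bcTrace_tmul, tmul_smul_one]

theorem mul_bcInv (x : K ⊗[F] B) : x * bcInv F B K x = bcNorm F x • 1 := by
  have h := mul_bcInv_add x x
  have h2 : (2 : K) ≠ 0 := two_ne_zero_bc F K
  rw [bcNorm, mul_smul, ← h, ← two_smul K, smul_smul, inv_mul_cancel₀ h2, one_smul]

theorem bcNorm_bcInv (x : K ⊗[F] B) : bcNorm F (bcInv F B K x) = bcNorm F x := by
  rw [bcNorm, bcInv_bcInv, bcTrace_mul_comm, bcNorm]

theorem bcInv_mul_self (x : K ⊗[F] B) : bcInv F B K x * x = bcNorm F x • 1 := by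
  have := mul_bcInv (bcInv F B K x)
  rwa [bcInv_bcInv, bcNorm_bcInv] at this

theorem bcNorm_add (x y : K ⊗[F] B) :
    bcNorm F (x + y) = bcNorm F x + bcNorm F y + bcTrace F B K (x * bcInv F B K y) := by
  have h2 : (2 : K) ≠ 0 := two_ne_zero_bc F K
  have h : bcTrace F B K (y * bcInv F B K x) = bcTrace F B K (x * bcInv F B K y) := by
    have := congrArg (bcTrace F B K) (mul_bcInv_add y x)
    rw [add_comm, mul_bcInv_add] at this
    have h1 : bcTrace F B K (1 : K ⊗[F] B) = 2 := by
      rw [Algebra.TensorProduct.one_def, bcTrace_tmul, IsQuat.redTrace_one, map_ofNat, one_mul]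
    simp only [map_smul, h1, smul_eq_mul] at this
    exact (mul_right_cancel₀ h2 this).symm
  rw [bcNorm, bcNorm, bcNorm, map_add, add_mul, mul_add, mul_add, map_add, map_add, map_add, h]
  field_simp
  ring

theorem bcNorm_smul (a : K) (x : K ⊗[F] B) : bcNorm F (a • x) = a ^ 2 * bcNorm F x := by
  rw [bcNorm, map_smul, smul_mul_smul_comm, map_smul, smul_eq_mul, bcNorm]; ring

theorem bcNorm_tmul (b : B) : bcNorm F ((1 : K) ⊗ₜ[F] b) = algebraMap F K (redNorm F b) := by
  have h2 : (2 : K) ≠ 0 := two_ne_zero_bc F K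
  rw [bcNorm, bcInv_tmul, Algebra.TensorProduct.tmul_mul_tmul, bcTrace_tmul,
    redTrace_mul_canonInv_self, map_mul, map_ofNat, one_mul, one_mul, inv_mul_cancel_left₀ h2]

variable [Nontrivial B]

theorem smul_one_injective_bc {a c : K} (h : a • (1 : K ⊗[F] B) = c • 1) : a = c := by
  have := congrArg (bcTrace F B K) h
  have h1 : bcTrace F B K (1 : K ⊗[F] B) = 2 := by
    rw [Algebra.TensorProduct.one_def, bcTrace_tmul, IsQuat.redTrace_one, map_ofNat, one_mul]
  simp only [map_smul, h1, smul_eq_mul] at this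
  exact mul_right_cancel₀ (two_ne_zero_bc F K) this

theorem bcNorm_mul (x y : K ⊗[F] B) : bcNorm F (x * y) = bcNorm F x * bcNorm F y := by
  apply smul_one_injective_bc (F := F) (B := B)
  rw [← mul_bcInv, bcInv_mul, mul_assoc, ← mul_assoc y, mul_bcInv, smul_mul_assoc, one_mul,
    mul_smul_comm, mul_bcInv, smul_smul, mul_comm]

theorem bcNorm_one : bcNorm F (1 : K ⊗[F] B) = 1 := by
  rw [Algebra.TensorProduct.one_def, bcNorm_tmul, IsQuat.redNorm_one, map_one]

theorem isUnit_of_bcNorm_ne_zero {x : K ⊗[F] B} (hx : bcNorm F x ≠ 0) : IsUnit x := by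
  refine ⟨⟨x, (bcNorm F x)⁻¹ • bcInv F B K x, ?_, ?_⟩, rfl⟩
  · rw [mul_smul_comm, mul_bcInv, smul_smul, inv_mul_cancel₀ hx, one_smul]
  · rw [smul_mul_assoc, bcInv_mul_self, smul_smul, inv_mul_cancel₀ hx, one_smul]

theorem bcNorm_units_ne_zero (u : (K ⊗[F] B)ˣ) : bcNorm F (u : K ⊗[F] B) ≠ 0 := by
  intro h
  have := bcNorm_mul (F := F) (u : K ⊗[F] B) ((u⁻¹ : (K ⊗[F] B)ˣ) : K ⊗[F] B)
  rw [u.mul_inv, bcNorm_one, h, zero_mul] at this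
  exact one_ne_zero this

theorem units_inv_eq (u : (K ⊗[F] B)ˣ) :
    ((u⁻¹ : (K ⊗[F] B)ˣ) : K ⊗[F] B) = (bcNorm F (u : K ⊗[F] B))⁻¹ • bcInv F B K u := by
  have h : (u : K ⊗[F] B) * ((bcNorm F (u : K ⊗[F] B))⁻¹ • bcInv F B K u) = 1 := by
    rw [mul_smul_comm, mul_bcInv, smul_smul, inv_mul_cancel₀ (bcNorm_units_ne_zero u), one_smul]
  rw [← u.inv_mul_cancel_left ((bcNorm F (u : K ⊗[F] B))⁻¹ • bcInv F B K u), h, mul_one]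

/-- The reduced norm of `K ⊗ B` as a homomorphism on units. -/
def bcNormUnits : (K ⊗[F] B)ˣ →* Kˣ :=
  Units.map { toFun := bcNorm F, map_one' := bcNorm_one, map_mul' := bcNorm_mul }

end BaseChange

/-! ### Orders at ramified places and valuations of reduced norms -/

section Completion

variable {F : Type*} [Field F] [NumberField F] {B : Type*} [Ring B] [Nontrivial B] [Algebra F B]
  [Module.Finite F B] [IsQuat F B] {O : Subalgebra (𝓞 F) B} {v : HeightOneSpectrum (𝓞 F)}

theorem valued_algebraMap (v : HeightOneSpectrum (𝓞 F)) (c : F) :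
    Valued.v (algebraMap F (v.adicCompletion F) c) = v.valuation F c :=
  v.valuedAdicCompletion_eq_valuation' c

/-- Bilinearity reduces the bound to generators from O. It controls the cross term in
`bcNorm_le_one`. -/
theorem bcTrace_mul_bcInv_le (hO : IsOrder O) {x y : LocalAlgebra F B v} (hx : x ∈ localOrder O v)
    (hy : y ∈ localOrder O v) : Valued.v (bcTrace F B _ (x * bcInv F B _ y)) ≤ 1 := by
  induction hx using Submodule.span_induction with
  | zero => simp
  | add x x' _ _ hx hx' =>
    rw [add_mul, map_add]; exact (Valuation.map_add_le _ hx hx')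
  | smul a x _ hx =>
    have : a • x = (a : v.adicCompletion F) • x := rfl
    rw [this, smul_mul_assoc, map_smul, smul_eq_mul, map_mul]
    exact mul_le_one' a.2 hx
  | mem x hx =>
    obtain ⟨b, hb, rfl⟩ := hx
    induction hy using Submodule.span_induction with
    | zero => simp
    | add y y' _ _ hy hy' =>
      rw [map_add, mul_add, map_add]; exact (Valuation.map_add_le _ hy hy')
    | smul a y _ hy =>
      have : a • y = (a : v.adicCompletion F) • y := rfl
      rw [this, map_smul, mul_smul_comm, map_smul, smul_eq_mul, map_mul]
      exact mul_le_one' a.2 hy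
    | mem y hy =>
      obtain ⟨c, hc, rfl⟩ := hy
      obtain ⟨t, ht⟩ := exists_redTrace_eq hO (mul_mem hb (canonInv_mem_order hO hc))
      show Valued.v (bcTrace F B _ (((1 : v.adicCompletion F) ⊗ₜ[F] b) * bcInv F B _ (1 ⊗ₜ[F] c))) ≤ 1
      rw [bcInv_tmul, Algebra.TensorProduct.tmul_mul_tmul, bcTrace_tmul, one_mul, one_mul, ← ht,
        valued_algebraMap]
      exact val_integer_le_one v t

theorem bcNorm_le_one (hO : IsOrder O) {x : LocalAlgebra F B v} (hx : x ∈ localOrder O v) :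
    Valued.v (bcNorm F x) ≤ 1 := by
  induction hx using Submodule.span_induction with
  | zero => rw [bcNorm]; simp
  | add x y hx' hy' hx hy =>
    rw [bcNorm_add]
    exact Valuation.map_add_le _ (Valuation.map_add_le _ hx hy) (bcTrace_mul_bcInv_le hO hx' hy')
  | smul a x _ hx =>
    have : a • x = (a : v.adicCompletion F) • x := rfl
    rw [this, bcNorm_smul, map_mul, map_pow]
    exact mul_le_one' (pow_le_one' a.2 2) hx
  | mem x hx =>
    obtain ⟨b, hb, rfl⟩ := hx
    obtain ⟨t, ht⟩ := exists_redNorm_eq hO hb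
    show Valued.v (bcNorm F ((1 : v.adicCompletion F) ⊗ₜ[F] b)) ≤ 1
    rw [bcNorm_tmul, ← ht, valued_algebraMap]
    exact val_integer_le_one v t

theorem bcInv_mem_localOrder (hO : IsOrder O) {x : LocalAlgebra F B v} (hx : x ∈ localOrder O v) :
    bcInv F B _ x ∈ localOrder O v := by
  induction hx using Submodule.span_induction with
  | zero => simp
  | add x y _ _ hx hy => rw [map_add]; exact add_mem hx hy
  | smul a x _ hx =>
    have : a • x = (a : v.adicCompletion F) • x := rfl
    rw [this, map_smul]
    exact (localOrder O v).smul_mem a hx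
  | mem x hx =>
    obtain ⟨b, hb, rfl⟩ := hx
    exact Submodule.subset_span ⟨canonInv F b, canonInv_mem_order hO hb, rfl⟩

/-- The inverse is the conjugate divided by the norm, and conjugation preserves the local order. -/
theorem isLocalUnit_iff (hO : IsOrder O) {u : (LocalAlgebra F B v)ˣ} :
    IsLocalUnit O v u ↔ (u : LocalAlgebra F B v) ∈ localOrder O v ∧
      Valued.v (bcNorm F (u : LocalAlgebra F B v)) = 1 := by
  constructor
  · rintro ⟨hu, hu'⟩
    refine ⟨hu, le_antisymm (bcNorm_le_one hO hu) ?_⟩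
    have h1 := bcNorm_mul (F := F) (u : LocalAlgebra F B v) ((u⁻¹ : (LocalAlgebra F B v)ˣ) : LocalAlgebra F B v)
    rw [u.mul_inv, bcNorm_one] at h1
    have h2 := congrArg Valued.v h1
    rw [map_one, map_mul] at h2
    rw [h2]
    exact mul_le_of_le_one_right' (bcNorm_le_one hO hu')
  · rintro ⟨hu, hn⟩
    refine ⟨hu, ?_⟩
    rw [units_inv_eq]
    have hle : Valued.v (bcNorm F (u : LocalAlgebra F B v))⁻¹ ≤ 1 := by rw [map_inv₀, hn, inv_one]
    exact (localOrder O v).smul_mem (⟨_, hle⟩ : v.adicCompletionIntegers F)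
      (bcInv_mem_localOrder hO hu)

/-- Uniformizers have reduced norm of valuation one. -/
theorem valued_bcNorm_uniformizer (hmax : IsMaximalOrder O) (v : HeightOneSpectrum (𝓞 F))
    (hR : NoIdempotent (v.valuation F) (locAt O v)) {ϖ : (LocalAlgebra F B v)ˣ}
    (hϖ : IsUniformizer O v ϖ) : Valued.v (bcNorm F (ϖ : LocalAlgebra F B v)) = exp (-1 : ℤ) := by
  have hO := hmax.prop
  have h1O : (1 : LocalAlgebra F B v) ∈ localOrder O v :=
    Submodule.subset_span ⟨1, one_mem O, rfl⟩
  obtain ⟨hϖO, hϖu⟩ := (hϖ ϖ).mpr ⟨1, h1O, by rw [mul_one]⟩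
  have hlt : Valued.v (bcNorm F (ϖ : LocalAlgebra F B v)) < 1 :=
    lt_of_le_of_ne (bcNorm_le_one hO hϖO) fun h1 =>
      hϖu ⟨ϖ, (isLocalUnit_iff hO).mpr ⟨hϖO, h1⟩, rfl⟩
  obtain ⟨π, hπ⟩ := exists_isFiniteDVR v
  -- s z ∈ O has uniformizing norm, so it is not a local unit and ϖ divides it; this bounds the norm
  -- of ϖ from below.
  obtain ⟨z, ⟨s, hs, hsz⟩, hz⟩ := (localOrder_locAt hmax hπ).exists_norm_eq hR
  have hNz : Valued.v (bcNorm F ((1 : v.adicCompletion F) ⊗ₜ[F] (s • z))) = exp (-1 : ℤ) := by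
    rw [bcNorm_tmul, valued_algebraMap, integer_smul_eq, redNorm_smul, map_mul, map_pow,
      (val_integer_eq_one_iff v s).mpr hs, one_pow, one_mul, hz]
  obtain ⟨y, hy, hzy⟩ := (hϖ ((1 : v.adicCompletion F) ⊗ₜ[F] (s • z))).mp
    ⟨Submodule.subset_span ⟨s • z, hsz, rfl⟩, fun ⟨u, hu, hus⟩ => by
      have h2 := ((isLocalUnit_iff hO).mp hu).2
      rw [hus, hNz, ← WithZero.exp_zero, WithZero.exp_inj] at h2
      norm_num at h2⟩
  rw [hzy, bcNorm_mul, map_mul] at hNz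
  refine le_antisymm ?_ ?_
  · have h0 : Valued.v (bcNorm F (ϖ : LocalAlgebra F B v)) ≠ 0 := by
      simpa using bcNorm_units_ne_zero (F := F) ϖ
    rw [← WithZero.exp_log h0, ← WithZero.exp_zero, WithZero.exp_lt_exp] at hlt
    rw [← WithZero.exp_log h0, WithZero.exp_le_exp]
    omega
  · rw [← hNz]
    exact mul_le_of_le_one_right' (bcNorm_le_one hO hy)

theorem valuation_redNorm_of_hasOrd (hmax : IsMaximalOrder O) (v : HeightOneSpectrum (𝓞 F))
    (hR : NoIdempotent (v.valuation F) (locAt O v)) {γ : Bˣ} {n : ℤ}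
    (h : HasOrd O v (toLocal v γ) n) : v.valuation F (redNorm F (γ : B)) = exp (-n) := by
  obtain ⟨ϖ, u, hϖ, hu, hγ⟩ := h
  have h1 : bcNormUnits (F := F) (toLocal v γ) = bcNormUnits (F := F) ϖ ^ n * bcNormUnits (F := F) u := by
    rw [hγ, map_mul, map_zpow]
  have h2 := congrArg (fun x : (v.adicCompletion F)ˣ => Valued.v (x : v.adicCompletion F)) h1
  have h3 : ((bcNormUnits (F := F) (toLocal v γ) : (v.adicCompletion F)ˣ) : v.adicCompletion F) =
      algebraMap F _ (redNorm F (γ : B)) := bcNorm_tmul (γ : B)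
  have h4 : ∀ x : (LocalAlgebra F B v)ˣ, ((bcNormUnits (F := F) x : (v.adicCompletion F)ˣ) :
      v.adicCompletion F) = bcNorm F (x : LocalAlgebra F B v) := fun x => rfl
  simp only [h3, valued_algebraMap, Units.val_mul, Units.val_zpow_eq_zpow_val, map_mul, map_zpow₀, h4,
    valued_bcNorm_uniformizer hmax v hR hϖ, ((isLocalUnit_iff hmax.prop).mp hu).2, mul_one] at h2
  rw [h2, ← WithZero.exp_zsmul]
  simp

end Completion

/-! ### Absence of idempotents implies ramification -/

section Ramified

variable {F : Type*} [Field F] [NumberField F] {B : Type*} [Ring B] [Nontrivial B] [Algebra F B]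
  [Module.Finite F B] [IsQuat F B] {O : Subalgebra (𝓞 F) B} {v : HeightOneSpectrum (𝓞 F)}

theorem isOpen_valued_le {c : F} (hc : c ≠ 0) :
    IsOpen {y : v.adicCompletion F | Valued.v y ≤ v.valuation F c} := by
  have h1 : IsOpen {y : v.adicCompletion F | Valued.v y ≤ 1} := Valued.isOpen_integer (v.adicCompletion F)
  have h2 : Continuous fun y : v.adicCompletion F => (algebraMap F (v.adicCompletion F) c)⁻¹ * y :=
    continuous_const.mul continuous_id
  convert h1.preimage h2 using 1
  ext y
  have hc' : 0 < v.valuation F c := zero_lt_iff.mpr (by simpa using hc)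
  simp only [Set.mem_preimage, Set.mem_ofPred_eq]
  rw [map_mul, map_inv₀, valued_algebraMap, inv_mul_le_iff₀ hc', mul_one]

theorem exists_repr_le (hO : IsOrder O) {ι : Type*} [Fintype ι] (e : Module.Basis ι F B) :
    ∃ K : ℤᵐ⁰, ∀ x ∈ locAt O v, ∀ i, v.valuation F (e.repr x i) ≤ K := by
  classical
  obtain ⟨G, hG⟩ := hO.1
  obtain ⟨K, hK⟩ := ((G ×ˢ (Finset.univ : Finset ι)).image
    fun gi => v.valuation F (e.repr gi.1 gi.2)).exists_le
  refine ⟨K, ?_⟩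
  rintro x ⟨s, hs, hsx⟩ i
  have hx : ∀ y ∈ Submodule.span (𝓞 F) (G : Set B), v.valuation F (e.repr y i) ≤ K := by
    intro y hy
    induction hy using Submodule.span_induction with
    | zero => simp
    | mem y hy => exact hK _ (Finset.mem_image.mpr ⟨(y, i), by simpa using hy, rfl⟩)
    | add y z _ _ hy hz => rw [map_add, Finsupp.add_apply]; exact Valuation.map_add_le _ hy hz
    | smul a y _ hy =>
      rw [integer_smul_eq, map_smul, Finsupp.smul_apply, smul_eq_mul, map_mul]
      exact mul_le_of_le_one_of_le (val_integer_le_one v a) hy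
  have h1 := hx (s • x) (hG ▸ hsx)
  rwa [integer_smul_eq, map_smul, Finsupp.smul_apply, smul_eq_mul, map_mul,
    (val_integer_eq_one_iff v s).mpr hs, one_mul] at h1

theorem continuous_bcNorm {ι : Type*} [Fintype ι] (e : ι → B) :
    Continuous fun a : ι → v.adicCompletion F =>
      bcNorm F (∑ i, a i • ((1 : v.adicCompletion F) ⊗ₜ[F] e i)) := by
  have : (fun a : ι → v.adicCompletion F =>
      bcNorm F (∑ i, a i • ((1 : v.adicCompletion F) ⊗ₜ[F] e i))) = fun a =>
      2⁻¹ * ∑ i, ∑ j, a i * (a j * bcTrace F B _ (((1 : v.adicCompletion F) ⊗ₜ[F] e i) *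
        bcInv F B _ ((1 : v.adicCompletion F) ⊗ₜ[F] e j))) := by
    funext a
    rw [bcNorm]
    simp only [map_sum, map_smul, Finset.sum_mul, Finset.mul_sum, smul_mul_assoc, mul_smul_comm,
      smul_eq_mul]
    rw [Finset.sum_comm]
    simp only [mul_left_comm]
  rw [this]
  exact continuous_const.mul (continuous_finsetSum _ fun i _ => continuous_finsetSum _ fun j _ =>
    (continuous_apply i).mul ((continuous_apply j).mul continuous_const))

/-- If the reduction of the local order has no nontrivial idempotents, the algebra is ramified. -/
theorem isRamified_of_noIdempotent (hmax : IsMaximalOrder O) (v : HeightOneSpectrum (𝓞 F))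
    (hR : NoIdempotent (v.valuation F) (locAt O v)) : IsRamified B v := by
  intro x hx
  refine isUnit_of_bcNorm_ne_zero fun hN => hx ?_
  obtain ⟨π, hπ⟩ := exists_isFiniteDVR v
  have hloc := localOrder_locAt hmax hπ
  let e := Module.finBasis F B
  let E := Algebra.TensorProduct.basis (v.adicCompletion F) e
  obtain ⟨K, hK⟩ := exists_repr_le (v := v) hmax.prop e
  set a := fun i => E.repr x i with ha
  have hxa : ∑ i, a i • ((1 : v.adicCompletion F) ⊗ₜ[F] e i) = x := by
    have := E.sum_repr x
    simpa only [E, Algebra.TensorProduct.basis_apply] using this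
  -- An x of norm zero in the completion is approximated by elements of B of norm at most that of π
  -- ^ (2M). These lie in π ^ M times the local order, so the coordinates of x are small; letting M
  -- grow gives x = 0.
  have key : ∀ (M : ℕ) i, Valued.v (a i) ≤ v.valuation F (π ^ M) * max K 1 := by
    intro M i
    have hc : π ^ M ≠ 0 := pow_ne_zero M hπ.ne_zero
    let U : Set (Fin (Module.finrank F B) → v.adicCompletion F) :=
      {α | Valued.v (bcNorm F (∑ i, α i • ((1 : v.adicCompletion F) ⊗ₜ[F] e i))) ≤
        v.valuation F ((π ^ M) ^ 2)} ∩
      {α | Valued.v (α i - a i) ≤ v.valuation F (π ^ M)}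
    have hcont : Continuous fun α : Fin (Module.finrank F B) → v.adicCompletion F => α i - a i :=
      (continuous_apply i).sub continuous_const
    have hU : IsOpen U :=
      ((isOpen_valued_le (pow_ne_zero 2 hc)).preimage (continuous_bcNorm e)).inter
        ((isOpen_valued_le hc).preimage hcont)
    have haU : a ∈ U := by
      constructor
      · show Valued.v (bcNorm F (∑ i, a i • ((1 : v.adicCompletion F) ⊗ₜ[F] e i))) ≤ _
        rw [hxa, hN, map_zero]; exact zero_le
      · show Valued.v (a i - a i) ≤ _
        rw [sub_self, map_zero]; exact zero_le
    obtain ⟨α, hα1, hα2⟩ := (DenseRange.piMap fun _ : Fin (Module.finrank F B) =>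
      HeightOneSpectrum.denseRange_algebraMap (R := 𝓞 F) F v).exists_mem_open hU ⟨a, haU⟩
    have hα1' : v.valuation F (redNorm F (∑ i, α i • e i)) ≤ v.valuation F (π ^ M) ^ 2 := by
      rw [← valued_algebraMap, ← bcNorm_tmul, ← map_pow]
      have hα0 : Valued.v (bcNorm F (∑ i, algebraMap F (v.adicCompletion F) (α i) •
          ((1 : v.adicCompletion F) ⊗ₜ[F] e i))) ≤ v.valuation F ((π ^ M) ^ 2) := hα1
      convert hα0 using 3
      rw [TensorProduct.tmul_sum]
      refine Finset.sum_congr rfl fun j _ => ?_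
      rw [TensorProduct.tmul_smul, algebraMap_smul]
    have hα3 := hloc.mem_scaled_of_norm_le' hR hc hα1'
    have hα4 := hK _ (mem_scaled.mp hα3) i
    rw [map_smul, Finsupp.smul_apply, e.repr_sum_self, smul_eq_mul, map_mul, map_inv₀,
      inv_mul_le_iff₀ (zero_lt_iff.mpr (by simpa using hc))] at hα4
    have hα5 : Valued.v (algebraMap F (v.adicCompletion F) (α i) - a i) ≤ v.valuation F (π ^ M) := hα2
    have h6 : a i = algebraMap F (v.adicCompletion F) (α i) -
        (algebraMap F (v.adicCompletion F) (α i) - a i) := by ring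
    rw [h6]
    refine (Valuation.map_sub _ _ _).trans (max_le ?_ ?_)
    · rw [valued_algebraMap]
      exact hα4.trans (mul_le_mul_right (le_max_left _ _) _)
    · exact hα5.trans (le_mul_of_one_le_right' (le_max_right _ _))
  have ha0 : ∀ i, a i = 0 := by
    intro i
    by_contra hne
    have h0 : Valued.v (a i) ≠ 0 := by simpa using hne
    have hK0 : max K 1 ≠ 0 := (lt_of_lt_of_le zero_lt_one (le_max_right K 1)).ne'
    have := key (log (max K 1) - log (Valued.v (a i)) + 1).toNat i
    rw [hπ.pow, ← WithZero.exp_log h0, ← WithZero.exp_log hK0, ← WithZero.exp_add,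
      WithZero.exp_le_exp, WithZero.exp_log h0, WithZero.exp_log hK0] at this
    have h7 := Int.self_le_toNat (log (max K 1) - log (Valued.v (a i)) + 1)
    omega
  rw [← hxa]
  exact Finset.sum_eq_zero fun i _ => by rw [ha0 i, zero_smul]

/-- The parity condition in terms of the reduced norm of the twisting element. -/
theorem exists_odd_valuation (hmax : IsMaximalOrder O) {γ : Bˣ}
    (hγ : ∀ v : HeightOneSpectrum (𝓞 F), IsRamified B v → ∃ n : ℤ, Odd n ∧ HasOrd O v (toLocal v γ) n)
    (v : HeightOneSpectrum (𝓞 F)) (hR : NoIdempotent (v.valuation F) (locAt O v)) :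
    ∃ k : ℤ, v.valuation F (redNorm F (γ : B)) = exp (2 * k + 1) := by
  obtain ⟨n, ⟨k, rfl⟩, hn⟩ := hγ v (isRamified_of_noIdempotent hmax v hR)
  exact ⟨-k - 1, by rw [valuation_redNorm_of_hasOrd hmax v hR hn]; congr 1; ring⟩

end Ramified

/-! ### Square roots of characteristic polynomials -/

section SquareCharpoly

variable {K V Q : Type*} [Field K] [Infinite K] [AddCommGroup V] [Module K V]
  [FiniteDimensional K V] [AddCommGroup Q] [Module K Q]

theorem charpoly_eq_charpoly_restrict_mul (f : Module.End K V) (N : Submodule K V)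
    (h : N ≤ N.comap f) :
    f.charpoly = (f.restrict h).charpoly * (N.mapQ N f h).charpoly := by
  refine Polynomial.funext fun x => ?_
  have hx : N ≤ N.comap (x • LinearMap.id - f) := fun v hv => by
    simpa using N.sub_mem (N.smul_mem x hv) (h hv)
  rw [Polynomial.eval_mul, eval_charpoly_eq_det, eval_charpoly_eq_det, eval_charpoly_eq_det,
    LinearMap.det_eq_det_mul_det N _ hx]
  congr 2
  ext v
  simp

/-- If `ker g = range g = ker π`, the operator induced on the image of `π` by an operator commuting
with `g` has half of its characteristic polynomial. -/
theorem charpoly_eq_sq_of_ker_eq_range [FiniteDimensional K Q] {f g : Module.End K V}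
    {π : V →ₗ[K] Q}
    {f' : Module.End K Q} (hfg : ∀ v, f (g v) = g (f v)) (hg : LinearMap.ker g = LinearMap.range g)
    (hπ : Function.Surjective π) (hker : LinearMap.ker π = LinearMap.range g)
    (hf' : ∀ v, π (f v) = f' (π v)) : f.charpoly = f'.charpoly ^ 2 := by
  have h : LinearMap.range g ≤ (LinearMap.range g).comap f := by
    rintro _ ⟨v, rfl⟩
    exact ⟨f v, (hfg v).symm⟩
  -- The range of g is both a subspace and, through g itself, a copy of V / range g = V / ker g. So
  -- f acts in the same way on the subspace and on the quotient.
  let e₁ : (V ⧸ LinearMap.range g) ≃ₗ[K] LinearMap.range g :=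
    (Submodule.quotEquivOfEq _ _ hg.symm).trans g.quotKerEquivRange
  let e₂ : (V ⧸ LinearMap.range g) ≃ₗ[K] Q :=
    (Submodule.quotEquivOfEq _ _ hker.symm).trans (π.quotKerEquivOfSurjective hπ)
  have h₁ : e₁.conj ((LinearMap.range g).mapQ _ f h) = f.restrict h := by
    ext x
    obtain ⟨y, rfl⟩ := e₁.surjective x
    obtain ⟨v, rfl⟩ := Submodule.mkQ_surjective _ y
    rw [LinearEquiv.conj_apply_apply, LinearEquiv.symm_apply_apply]
    exact (hfg v).symm
  have h₂ : e₂.conj ((LinearMap.range g).mapQ _ f h) = f' := by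
    ext x
    obtain ⟨y, rfl⟩ := e₂.surjective x
    obtain ⟨v, rfl⟩ := Submodule.mkQ_surjective _ y
    rw [LinearEquiv.conj_apply_apply, LinearEquiv.symm_apply_apply]
    exact hf' v
  rw [charpoly_eq_charpoly_restrict_mul f _ h, ← h₁, ← h₂, LinearEquiv.charpoly_conj,
    LinearEquiv.charpoly_conj, sq]

end SquareCharpoly

/-! ### Semilinear maps over the Witt vectors -/

section Witt

variable (p : ℕ) [Fact p.Prime] (k : Type*) [Field k] [CharP k p] [IsAlgClosed k]

theorem padicToWitt_injective : Function.Injective (padicToWitt p k) :=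
  (WittVector.map_injective _ (ZMod.castHom (dvd_refl p) k).injective).comp
    (WittVector.equiv p).symm.injective

instance charZero_wittVector : CharZero (WittVector p k) :=
  charZero_of_injective_ringHom (padicToWitt_injective p k)

/-- The Witt coordinates lie in the prime field. Hence p-adic matrices commute with σ, and
identities over ℤ_p pass to semilinear operators. -/
theorem frob_padicToWitt (z : ℤ_[p]) : frob p k (padicToWitt p k z) = padicToWitt p k z := by
  show WittVector.frobenius (WittVector.map _ _) = WittVector.map _ _
  ext n
  rw [WittVector.coeff_frobenius_charP, WittVector.map_coeff, ← map_pow, ZMod.pow_card]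

theorem frobInv_padicToWitt (z : ℤ_[p]) :
    frobInv p k (padicToWitt p k z) = padicToWitt p k z := by
  have := congrArg (frobInv p k) (frob_padicToWitt p k z)
  rw [← this]
  exact ((WittVector.frobeniusEquiv p k).symm_apply_apply _)

theorem frob_frobInv (x : WittVector p k) : frob p k (frobInv p k x) = x :=
  (WittVector.frobeniusEquiv p k).apply_symm_apply x

theorem frobInv_frob (x : WittVector p k) : frobInv p k (frob p k x) = x :=
  (WittVector.frobeniusEquiv p k).symm_apply_apply x

variable {ι : Type*} [Fintype ι] [DecidableEq ι]

/-- `p`-adic matrices as matrices over the Witt vectors. -/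
def wittMatrix : Matrix ι ι ℤ_[p] →+* Matrix ι ι (WittVector p k) := (padicToWitt p k).mapMatrix

theorem wittMatrix_transpose (A : Matrix ι ι ℤ_[p]) :
    wittMatrix p k Aᵀ = (wittMatrix p k A)ᵀ := rfl

variable {p k}

theorem comp_wittMatrix_mulVec {τ : WittVector p k →+* WittVector p k}
    (hτ : ∀ z, τ (padicToWitt p k z) = padicToWitt p k z) (A : Matrix ι ι ℤ_[p])
    (x : ι → WittVector p k) : τ ∘ (wittMatrix p k A *ᵥ x) = wittMatrix p k A *ᵥ (τ ∘ x) := by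
  funext i
  show τ ((wittMatrix p k A *ᵥ x) i) = _
  rw [RingHom.map_mulVec]
  congr 1
  exact Matrix.ext fun i j => hτ _

/-- The semilinear map given by a `p`-adic matrix. -/
def semiMulVec (τ : WittVector p k →+* WittVector p k) (A : Matrix ι ι ℤ_[p]) :
    (ι → WittVector p k) →ₛₗ[τ] (ι → WittVector p k) where
  toFun x := wittMatrix p k A *ᵥ (τ ∘ x)
  map_add' x y := by
    rw [← Matrix.mulVec_add]; congr 1; funext i; simp
  map_smul' c x := by
    rw [← Matrix.mulVec_smul]; congr 1; funext i; simp

theorem semiMulVec_apply (τ : WittVector p k →+* WittVector p k) (A : Matrix ι ι ℤ_[p])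
    (x : ι → WittVector p k) : semiMulVec τ A x = wittMatrix p k A *ᵥ (τ ∘ x) := rfl

theorem wittMatrix_natCast_mulVec (x : ι → WittVector p k) :
    wittMatrix p k (p : Matrix ι ι ℤ_[p]) *ᵥ x = (p : WittVector p k) • x := by
  rw [map_natCast, Matrix.natCast_mulVec]

theorem range_semiMulVec {τ τ' : WittVector p k →+* WittVector p k} (hτ : ∀ x, τ (τ' x) = x)
    (A : Matrix ι ι ℤ_[p]) [RingHomSurjective τ] :
    LinearMap.range (semiMulVec τ A) = LinearMap.range (wittMatrix p k A).mulVecLin := by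
  ext y
  constructor
  · rintro ⟨x, rfl⟩
    exact ⟨τ ∘ x, rfl⟩
  · rintro ⟨x, rfl⟩
    refine ⟨τ' ∘ x, ?_⟩
    rw [semiMulVec_apply]
    have : τ ∘ τ' ∘ x = x := by funext i; exact hτ _
    rw [this]; rfl

theorem isPerfPair_toLinearMap₂' {R : Type*} [CommRing R] {E : Matrix ι ι R} (hE : IsUnit E.det) :
    (Matrix.toLinearMap₂' R E).IsPerfPair := by
  have hE' : IsUnit E := (Matrix.isUnit_iff_isUnit_det _).mpr hE
  have hd : ∀ x y, Matrix.toLinearMap₂' R E x y = (x ᵥ* E) ⬝ᵥ y := fun x y => by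
    rw [Matrix.toLinearMap₂'_apply', Matrix.dotProduct_mulVec]
  refine LinearMap.IsPerfPair.of_bijective _ ⟨fun x x' h => ?_, fun φ => ?_⟩
  · apply Matrix.vecMul_injective_of_isUnit hE'
    refine dotProduct_eq _ _ fun y => ?_
    have := LinearMap.congr_fun h y
    rwa [hd, hd] at this
  · obtain ⟨x, hx⟩ := (Matrix.vecMul_surjective_iff_isUnit.mpr hE')
      (fun i => φ (Pi.single i 1))
    refine ⟨x, LinearMap.pi_ext' fun i => LinearMap.ext_ring ?_⟩
    have hx' : x ᵥ* E = fun i => φ (Pi.single i 1) := hx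
    show Matrix.toLinearMap₂' R E x (Pi.single i 1) = φ (Pi.single i 1)
    rw [hd, hx', dotProduct_single, mul_one]

end Witt

/-! ### Pairs of matrices modelling Frobenius and Verschiebung -/

section FrobeniusPair

variable {p : ℕ} [Fact p.Prime] {ι : Type*} [Fintype ι] [DecidableEq ι]

variable (p) in
/-- Matrices with product `p`, each of which is a multiple of the other on both sides. -/
structure IsFrobeniusPair (Φ Ψ : Matrix ι ι ℤ_[p]) : Prop where
  mul : Φ * Ψ = (p : Matrix ι ι ℤ_[p])
  mul' : Ψ * Φ = (p : Matrix ι ι ℤ_[p])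
  left_dvd : ∃ X, Φ = Ψ * X
  left_dvd' : ∃ Y, Ψ = Φ * Y
  right_dvd : ∃ X, Φ = X * Ψ
  right_dvd' : ∃ Y, Ψ = Y * Φ

theorem IsFrobeniusPair.transpose {Φ Ψ : Matrix ι ι ℤ_[p]} (h : IsFrobeniusPair p Φ Ψ) :
    IsFrobeniusPair p Ψᵀ Φᵀ where
  mul := by rw [← Matrix.transpose_mul, h.mul, Matrix.transpose_natCast]
  mul' := by rw [← Matrix.transpose_mul, h.mul', Matrix.transpose_natCast]
  left_dvd := h.right_dvd'.imp' Matrix.transpose fun Y hY => by rw [← Matrix.transpose_mul, ← hY]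
  left_dvd' := h.right_dvd.imp' Matrix.transpose fun Y hY => by rw [← Matrix.transpose_mul, ← hY]
  right_dvd := h.left_dvd'.imp' Matrix.transpose fun Y hY => by rw [← Matrix.transpose_mul, ← hY]
  right_dvd' := h.left_dvd.imp' Matrix.transpose fun Y hY => by rw [← Matrix.transpose_mul, ← hY]

theorem fromBlocks_natCast (n : ℕ) :
    Matrix.fromBlocks (n : Matrix ι ι ℤ_[p]) 0 0 (n : Matrix ι ι ℤ_[p]) =
      (n : Matrix (ι ⊕ ι) (ι ⊕ ι) ℤ_[p]) := by
  rw [← Matrix.diagonal_natCast, ← Matrix.diagonal_natCast, Matrix.fromBlocks_diagonal]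
  congr 1
  funext i
  rcases i with i | i <;> rfl

theorem IsFrobeniusPair.fromBlocks {Φ Ψ Φ' Ψ' : Matrix ι ι ℤ_[p]} (h : IsFrobeniusPair p Φ Ψ)
    (h' : IsFrobeniusPair p Φ' Ψ') :
    IsFrobeniusPair p (Matrix.fromBlocks Φ 0 0 Φ') (Matrix.fromBlocks Ψ 0 0 Ψ') where
  mul := by
    rw [Matrix.fromBlocks_multiply]
    simp only [h.mul, h'.mul, mul_zero, zero_mul, add_zero, zero_add]
    exact fromBlocks_natCast p
  mul' := by
    rw [Matrix.fromBlocks_multiply]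
    simp only [h.mul', h'.mul', mul_zero, zero_mul, add_zero, zero_add]
    exact fromBlocks_natCast p
  left_dvd := by
    obtain ⟨X, hX⟩ := h.left_dvd
    obtain ⟨X', hX'⟩ := h'.left_dvd
    exact ⟨Matrix.fromBlocks X 0 0 X', by simp [Matrix.fromBlocks_multiply, ← hX, ← hX']⟩
  left_dvd' := by
    obtain ⟨X, hX⟩ := h.left_dvd'
    obtain ⟨X', hX'⟩ := h'.left_dvd'
    exact ⟨Matrix.fromBlocks X 0 0 X', by simp [Matrix.fromBlocks_multiply, ← hX, ← hX']⟩
  right_dvd := by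
    obtain ⟨X, hX⟩ := h.right_dvd
    obtain ⟨X', hX'⟩ := h'.right_dvd
    exact ⟨Matrix.fromBlocks X 0 0 X', by simp [Matrix.fromBlocks_multiply, ← hX, ← hX']⟩
  right_dvd' := by
    obtain ⟨X, hX⟩ := h.right_dvd'
    obtain ⟨X', hX'⟩ := h'.right_dvd'
    exact ⟨Matrix.fromBlocks X 0 0 X', by simp [Matrix.fromBlocks_multiply, ← hX, ← hX']⟩

variable (ι) in
/-- Block-diagonal matrices with equal blocks. -/
def blockCopies (R o : Type*) [CommRing R] [Fintype o] [DecidableEq o] :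
    Matrix ι ι R →+* Matrix (ι × o) (ι × o) R :=
  (Matrix.blockDiagonalRingHom ι o R).comp (RingHom.pi fun _ => RingHom.id _)

theorem blockCopies_apply {R o : Type*} [CommRing R] [Fintype o] [DecidableEq o]
    (A : Matrix ι ι R) : blockCopies ι R o A = Matrix.blockDiagonal fun _ => A := rfl

theorem blockCopies_transpose {R o : Type*} [CommRing R] [Fintype o] [DecidableEq o]
    (A : Matrix ι ι R) : blockCopies ι R o Aᵀ = (blockCopies ι R o A)ᵀ :=
  (Matrix.blockDiagonal_transpose fun _ : o => A).symm

theorem IsFrobeniusPair.blockCopies {o : Type*} [Fintype o] [DecidableEq o]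
    {Φ Ψ : Matrix ι ι ℤ_[p]} (h : IsFrobeniusPair p Φ Ψ) :
    IsFrobeniusPair p (blockCopies ι ℤ_[p] o Φ) (SuperspecialTypeC.blockCopies ι ℤ_[p] o Ψ) where
  mul := by rw [← map_mul, h.mul, map_natCast]
  mul' := by rw [← map_mul, h.mul', map_natCast]
  left_dvd := h.left_dvd.imp' _ fun Y hY => by rw [← map_mul, ← hY]
  left_dvd' := h.left_dvd'.imp' _ fun Y hY => by rw [← map_mul, ← hY]
  right_dvd := h.right_dvd.imp' _ fun Y hY => by rw [← map_mul, ← hY]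
  right_dvd' := h.right_dvd'.imp' _ fun Y hY => by rw [← map_mul, ← hY]

end FrobeniusPair

/-! ### Matrix models over ℤ_p, their copies and hyperbolic sums -/

section Model

/-- A superspecial Dieudonné module over `ℤ_p` with a principal polarization and an action of `R`
compatible with a map `s` on `R`, in coordinates. -/
structure MatrixModel (p : ℕ) [Fact p.Prime] (R : Type*) [Ring R] [Algebra ℤ_[p] R] (s : R → R)
    (ι : Type*) [Fintype ι] [DecidableEq ι] where
  act : R →+* Matrix ι ι ℤ_[p]
  act_algebraMap : ∀ z, act (algebraMap ℤ_[p] R z) = algebraMap ℤ_[p] _ z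
  frob : Matrix ι ι ℤ_[p]
  ver : Matrix ι ι ℤ_[p]
  pair : IsFrobeniusPair p frob ver
  act_frob : ∀ a, Commute (act a) frob
  act_ver : ∀ a, Commute (act a) ver
  form : Matrix ι ι ℤ_[p]
  form_transpose : formᵀ = -form
  isUnit_form : IsUnit form.det
  frob_form : frobᵀ * form = form * ver
  act_form : ∀ a, (act a)ᵀ * form = form * act (s a)

variable {p : ℕ} [Fact p.Prime] {R : Type*} [Ring R] [Algebra ℤ_[p] R] {s : R → R}
  {ι : Type*} [Fintype ι] [DecidableEq ι]

/-- The direct sum of copies of a model. -/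
def MatrixModel.copies (D : MatrixModel p R s ι) (o : Type*) [Fintype o] [DecidableEq o] :
    MatrixModel p R s (ι × o) where
  act := (blockCopies ι ℤ_[p] o).comp D.act
  act_algebraMap z := by
    rw [RingHom.comp_apply, D.act_algebraMap]
    simp only [Matrix.algebraMap_eq_diagonal, blockCopies_apply]
    rw [Matrix.blockDiagonal_diagonal]
    rfl
  frob := blockCopies ι ℤ_[p] o D.frob
  ver := blockCopies ι ℤ_[p] o D.ver
  pair := D.pair.blockCopies
  act_frob a := (D.act_frob a).map (blockCopies ι ℤ_[p] o)
  act_ver a := (D.act_ver a).map (blockCopies ι ℤ_[p] o)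
  form := blockCopies ι ℤ_[p] o D.form
  form_transpose := by rw [← blockCopies_transpose, D.form_transpose, map_neg]
  isUnit_form := by
    rw [blockCopies_apply, Matrix.det_blockDiagonal, Finset.prod_const]
    exact D.isUnit_form.pow _
  frob_form := by rw [← blockCopies_transpose, ← map_mul, D.frob_form, map_mul]
  act_form a := by
    simp only [RingHom.comp_apply]
    rw [← blockCopies_transpose, ← map_mul, D.act_form, map_mul]

theorem MatrixModel.charpoly_copies (D : MatrixModel p R s ι) (o : Type*) [Fintype o]
    [DecidableEq o] (a : R) :
    ((D.copies o).act a).charpoly = (D.act a).charpoly ^ Fintype.card o :=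
  charpoly_blockDiagonal_const _

/-- The sum of two ring homomorphisms to matrices. -/
def blockSum (f g : R →+* Matrix ι ι ℤ_[p]) : R →+* Matrix (ι ⊕ ι) (ι ⊕ ι) ℤ_[p] where
  toFun a := Matrix.fromBlocks (f a) 0 0 (g a)
  map_one' := by simp
  map_zero' := by simp
  map_mul' a b := by simp [Matrix.fromBlocks_multiply]
  map_add' a b := by simp [Matrix.fromBlocks_add]

/-- The sum of a representation and its dual, with the standard alternating form. -/
def MatrixModel.hyperbolic (f g : R →+* Matrix ι ι ℤ_[p])
    (hf : ∀ z, f (algebraMap ℤ_[p] R z) = algebraMap ℤ_[p] _ z)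
    (hg : ∀ z, g (algebraMap ℤ_[p] R z) = algebraMap ℤ_[p] _ z)
    (hfg : ∀ a, g (s a) = (f a)ᵀ) (hgf : ∀ a, f (s a) = (g a)ᵀ)
    {Φ Ψ : Matrix ι ι ℤ_[p]} (h : IsFrobeniusPair p Φ Ψ)
    (hfΦ : ∀ a, Commute (f a) Φ) (hfΨ : ∀ a, Commute (f a) Ψ) :
    MatrixModel p R s (ι ⊕ ι) where
  act := blockSum f g
  act_algebraMap z := by
    show Matrix.fromBlocks _ 0 0 _ = _
    rw [hf, hg, Matrix.algebraMap_eq_diagonal, Matrix.algebraMap_eq_diagonal,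
      Matrix.fromBlocks_diagonal]
    congr 1
    funext i
    rcases i with i | i <;> rfl
  frob := Matrix.fromBlocks Φ 0 0 Ψᵀ
  ver := Matrix.fromBlocks Ψ 0 0 Φᵀ
  pair := h.fromBlocks h.transpose
  act_frob a := by
    -- g is the transpose of f precomposed with s, so commutation of Ψ with f transposes to g.
    have : g a * Ψᵀ = Ψᵀ * g a := by
      rw [← Matrix.transpose_transpose (g a), ← hgf, ← Matrix.transpose_mul, ← (hfΨ _).eq,
        Matrix.transpose_mul]
    show Matrix.fromBlocks _ 0 0 _ * _ = _ * Matrix.fromBlocks _ 0 0 _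
    simp [Matrix.fromBlocks_multiply, (hfΦ a).eq, this]
  act_ver a := by
    have : g a * Φᵀ = Φᵀ * g a := by
      rw [← Matrix.transpose_transpose (g a), ← hgf, ← Matrix.transpose_mul, ← (hfΦ _).eq,
        Matrix.transpose_mul]
    show Matrix.fromBlocks _ 0 0 _ * _ = _ * Matrix.fromBlocks _ 0 0 _
    simp [Matrix.fromBlocks_multiply, (hfΨ a).eq, this]
  form := Matrix.fromBlocks 0 1 (-1) 0
  form_transpose := by simp [Matrix.fromBlocks_transpose, Matrix.fromBlocks_neg]
  isUnit_form := by
    rw [← Matrix.isUnit_iff_isUnit_det]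
    refine IsUnit.of_mul_eq_one (Matrix.fromBlocks 0 (-1) 1 0) ?_
    simp [Matrix.fromBlocks_multiply]
  frob_form := by simp [Matrix.fromBlocks_multiply, Matrix.fromBlocks_transpose]
  act_form a := by
    show (Matrix.fromBlocks _ 0 0 _)ᵀ * _ = _ * Matrix.fromBlocks _ 0 0 _
    simp [Matrix.fromBlocks_multiply, Matrix.fromBlocks_transpose, hfg, hgf]

end Model

/-! ### From matrix models to Dieudonné modules -/

namespace MatrixModel

variable {p : ℕ} [Fact p.Prime] {R : Type*} [Ring R] [Algebra ℤ_[p] R] {s : R → R}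
  {ι : Type*} [Fintype ι] [DecidableEq ι] (D : MatrixModel p R s ι)
  (k : Type*) [Field k] [CharP k p] [IsAlgClosed k]

/-- The Dieudonné module of a model. -/
def dieudonneModule : DieudonneModule p k (ι → WittVector p k) where
  free := inferInstance
  finite := inferInstance
  F := semiMulVec (SuperspecialTypeC.frob p k) D.frob
  V := semiMulVec (frobInv p k) D.ver
  F_V x := by
    rw [semiMulVec_apply, semiMulVec_apply, comp_wittMatrix_mulVec (frob_padicToWitt p k),
      Matrix.mulVec_mulVec, ← map_mul, D.pair.mul, wittMatrix_natCast_mulVec]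
    congr 1
    funext i
    exact frob_frobInv p k _
  V_F x := by
    rw [semiMulVec_apply, semiMulVec_apply, comp_wittMatrix_mulVec (frobInv_padicToWitt p k),
      Matrix.mulVec_mulVec, ← map_mul, D.pair.mul', wittMatrix_natCast_mulVec]
    congr 1
    funext i
    exact frobInv_frob p k _

/-- The action on the Dieudonné module of a model. -/
def action : (D.dieudonneModule k).Action R where
  act := ((Matrix.toLinAlgEquiv' (R := WittVector p k) (n := ι)).toRingEquiv :
    Matrix ι ι (WittVector p k) →+* Module.End (WittVector p k) (ι → WittVector p k)).comp
      ((wittMatrix p k).comp D.act)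
  act_padic z x := by
    show wittMatrix p k (D.act _) *ᵥ x = _
    have : wittMatrix p k (D.act (algebraMap ℤ_[p] R z)) =
        algebraMap (WittVector p k) (Matrix ι ι (WittVector p k)) (padicToWitt p k z) := by
      rw [D.act_algebraMap, Matrix.algebraMap_eq_diagonal, Matrix.algebraMap_eq_diagonal]
      show (Matrix.diagonal _).map _ = _
      rw [Matrix.diagonal_map (map_zero _)]
      rfl
    rw [this, Algebra.algebraMap_eq_smul_one, Matrix.smul_mulVec, Matrix.one_mulVec]
  act_F b x := by
    show wittMatrix p k (D.act b) *ᵥ semiMulVec (SuperspecialTypeC.frob p k) D.frob x =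
      semiMulVec (SuperspecialTypeC.frob p k) D.frob (wittMatrix p k (D.act b) *ᵥ x)
    rw [semiMulVec_apply, semiMulVec_apply, comp_wittMatrix_mulVec (frob_padicToWitt p k),
      Matrix.mulVec_mulVec, Matrix.mulVec_mulVec, ← map_mul, ← map_mul, (D.act_frob b).eq]
  act_V b x := by
    show wittMatrix p k (D.act b) *ᵥ semiMulVec (frobInv p k) D.ver x =
      semiMulVec (frobInv p k) D.ver (wittMatrix p k (D.act b) *ᵥ x)
    rw [semiMulVec_apply, semiMulVec_apply, comp_wittMatrix_mulVec (frobInv_padicToWitt p k),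
      Matrix.mulVec_mulVec, Matrix.mulVec_mulVec, ← map_mul, ← map_mul, (D.act_ver b).eq]

theorem rangeF_eq : (D.dieudonneModule k).rangeF =
    LinearMap.range (wittMatrix p k D.frob).mulVecLin :=
  range_semiMulVec (frob_frobInv p k) D.frob

theorem rangeV_eq : (D.dieudonneModule k).rangeV =
    LinearMap.range (wittMatrix p k D.ver).mulVecLin :=
  range_semiMulVec (frobInv_frob p k) D.ver

theorem range_frob_eq_range_ver : LinearMap.range (wittMatrix p k D.frob).mulVecLin =
    LinearMap.range (wittMatrix p k D.ver).mulVecLin := by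
  obtain ⟨X, hX⟩ := D.pair.left_dvd
  obtain ⟨Y, hY⟩ := D.pair.left_dvd'
  apply le_antisymm
  · conv_lhs => rw [hX, map_mul, Matrix.mulVecLin_mul]
    exact LinearMap.range_comp_le_range _ _
  · conv_lhs => rw [hY, map_mul, Matrix.mulVecLin_mul]
    exact LinearMap.range_comp_le_range _ _

theorem isSuperspecial : (D.dieudonneModule k).IsSuperspecial := by
  have h : (D.dieudonneModule k).rangeF = (D.dieudonneModule k).rangeV := by
    rw [rangeF_eq, rangeV_eq, range_frob_eq_range_ver]
  exact ⟨DieudonneModule.quotDim (D.dieudonneModule k).rangeV, by rw [h], rfl, by rw [h, sup_idem]⟩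

/-- The polarization of the Dieudonné module of a model. -/
def polarization : (D.dieudonneModule k).PrincipalPolarization where
  form := Matrix.toLinearMap₂' (WittVector p k) (wittMatrix p k D.form)
  alt := by
    refine LinearMap.isAlt_iff_eq_neg_flip.mpr (LinearMap.ext₂ fun x y => ?_)
    simp only [LinearMap.neg_apply, LinearMap.flip_apply, Matrix.toLinearMap₂'_apply']
    have h : wittMatrix p k D.formᵀ = -wittMatrix p k D.form := by rw [D.form_transpose, map_neg]
    rw [dotProduct_comm y, ← Matrix.vecMul_transpose _ x, ← wittMatrix_transpose, h,
      Matrix.vecMul_neg, neg_dotProduct, neg_neg, Matrix.dotProduct_mulVec]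
  F_left x y := by
    show Matrix.toLinearMap₂' (WittVector p k) (wittMatrix p k D.form)
        (semiMulVec (SuperspecialTypeC.frob p k) D.frob x) y =
      SuperspecialTypeC.frob p k (Matrix.toLinearMap₂' (WittVector p k) (wittMatrix p k D.form) x
        (semiMulVec (frobInv p k) D.ver y))
    have hy : SuperspecialTypeC.frob p k ∘ frobInv p k ∘ y = y := funext fun i => frob_frobInv p k _
    rw [Matrix.toLinearMap₂'_apply', Matrix.toLinearMap₂'_apply', semiMulVec_apply,
      semiMulVec_apply, RingHom.map_dotProduct, comp_wittMatrix_mulVec (frob_padicToWitt p k),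
      comp_wittMatrix_mulVec (frob_padicToWitt p k), hy, Matrix.mulVec_mulVec y, ← map_mul,
      ← D.frob_form, map_mul, wittMatrix_transpose, ← Matrix.mulVec_mulVec,
      Matrix.dotProduct_mulVec _ _ᵀ, Matrix.vecMul_transpose]
  perfect := isPerfPair_toLinearMap₂' (by
    have : (wittMatrix p k D.form).det = padicToWitt p k D.form.det := (RingHom.map_det _ _).symm
    rw [this]
    exact D.isUnit_form.map _)

theorem form_act (b : R) (x y : ι → WittVector p k) :
    (D.polarization k).form ((D.action k).act b x) y =
      (D.polarization k).form x ((D.action k).act (s b) y) := by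
  show Matrix.toLinearMap₂' (WittVector p k) (wittMatrix p k D.form)
      (wittMatrix p k (D.act b) *ᵥ x) y =
    Matrix.toLinearMap₂' (WittVector p k) (wittMatrix p k D.form) x
      (wittMatrix p k (D.act (s b)) *ᵥ y)
  rw [Matrix.toLinearMap₂'_apply', Matrix.toLinearMap₂'_apply', Matrix.mulVec_mulVec, ← map_mul,
    ← D.act_form, map_mul, wittMatrix_transpose, ← Matrix.mulVec_mulVec,
    Matrix.dotProduct_mulVec x, Matrix.vecMul_transpose]

/-- If Ψx = p y, applying Φ and cancelling p gives x = Φy = ΨXy, so the kernel modulo p lies in the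
range. Conversely Ψ² = ΨΦY = pY vanishes modulo p. -/
theorem ker_baseChange_ver :
    LinearMap.ker ((wittMatrix p k D.ver).mulVecLin.baseChange k) =
      LinearMap.range ((wittMatrix p k D.ver).mulVecLin.baseChange k) := by
  have hp : ∀ x : ι → WittVector p k, (1 : k) ⊗ₜ[WittVector p k] ((p : WittVector p k) • x) = 0 := by
    intro x
    rw [TensorProduct.tmul_smul, TensorProduct.smul_tmul', Algebra.smul_def, map_natCast,
      CharP.cast_eq_zero, zero_mul, TensorProduct.zero_tmul]
  have hsurj : Function.Surjective (algebraMap (WittVector p k) k) :=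
    WittVector.constantCoeff_surjective p
  have hrep : ∀ t : k ⊗[WittVector p k] (ι → WittVector p k), ∃ x, t = 1 ⊗ₜ x := by
    intro t
    induction t using TensorProduct.induction_on with
    | zero => exact ⟨0, by simp⟩
    | tmul c x =>
      obtain ⟨w, rfl⟩ := hsurj c
      exact ⟨w • x, by rw [TensorProduct.tmul_smul, TensorProduct.smul_tmul', Algebra.smul_def,
        mul_one]⟩
    | add t u ht hu =>
      obtain ⟨x, rfl⟩ := ht
      obtain ⟨y, rfl⟩ := hu
      exact ⟨x + y, by rw [TensorProduct.tmul_add]⟩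
  have hzero : ∀ x : ι → WittVector p k, (1 : k) ⊗ₜ[WittVector p k] x = 0 →
      ∃ y, x = (p : WittVector p k) • y := by
    intro x hx
    have h1 : ∀ i, (p : WittVector p k) ∣ x i := by
      intro i
      have h2 := congrFun (congrArg (TensorProduct.piScalarRight (WittVector p k) k k ι) hx) i
      rw [map_zero, TensorProduct.piScalarRight_apply, TensorProduct.piScalarRightHom_tmul] at h2
      have h3 : x i ∈ RingHom.ker (WittVector.constantCoeff (p := p) (R := k)) := by
        have : (x i) • (1 : k) = 0 := h2
        rw [Algebra.smul_def, mul_one] at this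
        exact this
      rwa [WittVector.ker_constantCoeff, Ideal.mem_span_singleton] at h3
    choose y hy using h1
    exact ⟨y, funext hy⟩
  obtain ⟨X, hX⟩ := D.pair.left_dvd
  obtain ⟨Y, hY⟩ := D.pair.left_dvd'
  ext t
  obtain ⟨x, rfl⟩ := hrep t
  rw [LinearMap.mem_ker, LinearMap.baseChange_tmul]
  constructor
  · intro h
    obtain ⟨y, hy⟩ := hzero _ h
    refine ⟨1 ⊗ₜ (wittMatrix p k X *ᵥ y), ?_⟩
    rw [LinearMap.baseChange_tmul]
    congr 1
    rw [Matrix.mulVecLin_apply, Matrix.mulVec_mulVec, ← map_mul, ← hX]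
    have h4 := congrArg (wittMatrix p k D.frob *ᵥ ·) hy
    simp only [Matrix.mulVecLin_apply, Matrix.mulVec_mulVec, Matrix.mulVec_smul] at h4
    rw [← map_mul, D.pair.mul, wittMatrix_natCast_mulVec] at h4
    exact (smul_right_injective _ (WittVector.p_nonzero p k) h4).symm
  · rintro ⟨t, ht⟩
    obtain ⟨y, rfl⟩ := hrep t
    rw [← LinearMap.baseChange_tmul, ← ht, LinearMap.baseChange_tmul, LinearMap.baseChange_tmul]
    rw [Matrix.mulVecLin_apply, Matrix.mulVecLin_apply]
    have hvv : D.ver * D.ver = (p : Matrix ι ι ℤ_[p]) * Y := by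
      rw [← D.pair.mul', mul_assoc, ← hY]
    rw [Matrix.mulVec_mulVec, ← map_mul, hvv, map_mul, ← Matrix.mulVec_mulVec,
      wittMatrix_natCast_mulVec, hp]

/-- Modulo p, kernel and range of the matrix of V coincide and M / VM is the cokernel, so
`charpoly_eq_sq_of_ker_eq_range` applies to the action of b. -/
theorem lieCharpoly_sq (b : R) :
    (D.act b).charpoly.map ((algebraMap (WittVector p k) k).comp (padicToWitt p k)) =
      (D.action k).lieCharpoly b ^ 2 := by
  have hfin := (D.dieudonneModule k).finite
  have hinf : Infinite k := IsAlgClosed.instInfinite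
  have hex : Function.Exact ((wittMatrix p k D.ver).mulVecLin) (D.dieudonneModule k).rangeV.mkQ := by
    rw [LinearMap.exact_iff, Submodule.ker_mkQ, rangeV_eq]
  have hex' := lTensor_exact k hex (Submodule.mkQ_surjective _)
  have key := charpoly_eq_sq_of_ker_eq_range
    (f := (wittMatrix p k (D.act b)).mulVecLin.baseChange k)
    (g := (wittMatrix p k D.ver).mulVecLin.baseChange k)
    (π := (D.dieudonneModule k).rangeV.mkQ.baseChange k)
    (f' := (D.action k).onLie b) (fun v => by
      rw [← LinearMap.comp_apply, ← LinearMap.comp_apply, ← LinearMap.baseChange_comp,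
        ← LinearMap.baseChange_comp, ← Matrix.mulVecLin_mul, ← Matrix.mulVecLin_mul, ← map_mul,
        ← map_mul, (D.act_ver b).eq])
    (D.ker_baseChange_ver k)
    (LinearMap.lTensor_surjective k (Submodule.mkQ_surjective _))
    (by
      ext t
      exact hex' t)
    (fun v => by
      rw [DieudonneModule.Action.onLie, ← LinearMap.comp_apply, ← LinearMap.comp_apply,
        ← LinearMap.baseChange_comp, ← LinearMap.baseChange_comp, Submodule.mapQ_mkQ]
      rfl)
  rw [LinearMap.charpoly_baseChange, Matrix.charpoly_mulVecLin] at key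
  rw [DieudonneModule.Action.lieCharpoly, ← key, ← Polynomial.map_map]
  congr 1
  exact (Matrix.charpoly_map _ _).symm

end MatrixModel

/-! ### The models attached to the order -/

section OrderModel

variable {F : Type*} [Field F] [NumberField F] [NumberField.IsTotallyReal F]
  {B : Type*} [Ring B] [Algebra F B] [Algebra.IsCentral F B] [IsSimpleRing B] [Module.Finite F B]
  [IsQuat F B] [StarRing B]
  {O : Subalgebra (𝓞 F) B} {γ : Bˣ}
  {ι : Type*} [Fintype ι] [DecidableEq ι]

theorem matLift_algebraMap (p : ℕ) [Fact p.Prime] (l : O →+* Matrix ι ι ℤ) (z : ℤ_[p]) :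
    matLift p l (algebraMap ℤ_[p] (O ⊗[ℤ] ℤ_[p]) z) = algebraMap ℤ_[p] _ z := by
  have : matLift p l ((1 : O) ⊗ₜ[ℤ] z) = z • padicMatrix p (l 1) := matLift_tmul p l 1 z
  rw [map_one, map_one, ← Algebra.algebraMap_eq_smul_one] at this
  exact this

theorem matLift_padicStar (p : ℕ) [Fact p.Prime] (hO : ∀ b ∈ O, star b ∈ O)
    {l l' : O →+* Matrix ι ι ℤ} (h : ∀ x, l (orderStar O hO x) = (l' x)ᵀ) (a : O ⊗[ℤ] ℤ_[p]) :
    matLift p l (padicStar p O hO a) = (matLift p l' a)ᵀ := by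
  induction a using TensorProduct.induction_on with
  | zero => simp
  | tmul x z =>
    have : padicStar p O hO (x ⊗ₜ[ℤ] z) = orderStar O hO x ⊗ₜ[ℤ] z := rfl
    rw [this, matLift_tmul, matLift_tmul, h, padicMatrix_transpose, Matrix.transpose_smul]
  | add a c ha hc => rw [map_add, map_add, map_add, ha, hc, Matrix.transpose_add]

theorem commute_matLift (p : ℕ) [Fact p.Prime] {l : O →+* Matrix ι ι ℤ} {Φ : Matrix ι ι ℤ_[p]}
    (h : ∀ x, Commute (padicMatrix p (l x)) Φ) (a : O ⊗[ℤ] ℤ_[p]) : Commute (matLift p l a) Φ := by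
  induction a using TensorProduct.induction_on with
  | zero => rw [map_zero]; exact Commute.zero_left _
  | tmul x z => rw [matLift_tmul]; exact (h x).smul_left z
  | add a c ha hc => rw [map_add]; exact ha.add_left hc

theorem charpoly_matLift_tmul_one (p : ℕ) [Fact p.Prime] (l : O →+* Matrix ι ι ℤ) (x : O) :
    (matLift p l (x ⊗ₜ[ℤ] (1 : ℤ_[p]))).charpoly = (l x).charpoly.map (Int.castRingHom ℤ_[p]) := by
  rw [matLift_tmul, one_smul]
  exact Matrix.charpoly_map _ _

theorem exists_isFrobeniusPair (p : ℕ) [Fact p.Prime] (hmax : IsMaximalOrder O)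
    (b : Module.Basis ι ℤ O) :
    ∃ Φ Ψ : Matrix ι ι ℤ_[p], IsFrobeniusPair p Φ Ψ ∧
      (∀ x, Commute (padicMatrix p (Algebra.leftMulMatrix b x)) Φ) ∧
      (∀ x, Commute (padicMatrix p (Algebra.leftMulMatrix b x)) Ψ) ∧
      ∀ G : Matrix ι ι ℤ, (∀ x, (rightMulMatrix b x)ᵀ * G =
          G * rightMulMatrix b (orderInv hmax.prop x)) →
        Φᵀ * padicMatrix p G = padicMatrix p G * Ψ := by
  obtain ⟨Φ, Ψ, X, Y, h1, h2, h3, h4, h5, h6, h7, h8, h9⟩ := exists_frobenius_matrix p hmax b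
  exact ⟨Φ, Ψ, ⟨h3, h4, ⟨X, h5⟩, ⟨Y, h6⟩, ⟨X, by rw [← h8.eq]; exact h5⟩,
    ⟨Y, by rw [← h7.eq]; exact h6⟩⟩, h1, h2, h9⟩

/-- The order itself, polarized by a form perfect at `p`. -/
theorem exists_matrixModel (hmax : IsMaximalOrder O) (hO : ∀ b ∈ O, star b ∈ O)
    (hγ : IsTwistingElement F γ)
    (hodd : ∀ v : HeightOneSpectrum (𝓞 F), NoIdempotent (v.valuation F) (locAt O v) →
      ∃ k : ℤ, v.valuation F (redNorm F (γ : B)) = exp (2 * k + 1))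
    (p : ℕ) [Fact p.Prime] (b : Module.Basis ι ℤ O) :
    ∃ D : MatrixModel p (O ⊗[ℤ] ℤ_[p]) (padicStar p O hO) ι,
      ∀ x : O, (D.act (x ⊗ₜ[ℤ] (1 : ℤ_[p]))).charpoly =
        (Algebra.leftMulMatrix b x).charpoly.map (Int.castRingHom ℤ_[p]) := by
  obtain ⟨Φ, Ψ, hpair, hΦ, hΨ, hG⟩ := exists_isFrobeniusPair p hmax b
  obtain ⟨G, hGt, hGl, hGr, hdet⟩ := exists_gram_matrix hmax hO hγ hodd p b
  let l : O →+* Matrix ι ι ℤ := (Algebra.leftMulMatrix b).toRingHom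
  refine ⟨{
    act := matLift p l
    act_algebraMap := matLift_algebraMap p l
    frob := Φ
    ver := Ψ
    pair := hpair
    act_frob := commute_matLift p hΦ
    act_ver := commute_matLift p hΨ
    form := padicMatrix p G
    form_transpose := by rw [← padicMatrix_transpose, hGt, map_neg]
    isUnit_form := ?_
    frob_form := hG G hGr
    act_form := fun a => ?_ }, charpoly_matLift_tmul_one p l⟩
  · have : (padicMatrix p G).det = ((G.det : ℤ) : ℤ_[p]) :=
      (RingHom.map_det (Int.castRingHom ℤ_[p]) G).symm
    rw [this, PadicInt.isUnit_iff]
    refine le_antisymm (PadicInt.norm_le_one _) (not_lt.mp fun h => hdet ?_)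
    rwa [PadicInt.norm_int_lt_one_iff_dvd] at h
  · induction a using TensorProduct.induction_on with
    | zero => simp
    | tmul x z =>
      have : padicStar p O hO (x ⊗ₜ[ℤ] z) = orderStar O hO x ⊗ₜ[ℤ] z := rfl
      rw [this, matLift_tmul, matLift_tmul, Matrix.transpose_smul, Matrix.smul_mul, Matrix.mul_smul,
        ← padicMatrix_transpose, ← map_mul, ← map_mul]
      congr 2
      exact hGl x
    | add a c ha hc => simp only [map_add, Matrix.transpose_add, add_mul, mul_add, ha, hc]

/-- The sum of the order and its dual. -/
theorem exists_matrixModel_hyperbolic (hmax : IsMaximalOrder O) (hO : ∀ b ∈ O, star b ∈ O)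
    (hγ : IsTwistingElement F γ) (p : ℕ) [Fact p.Prime] (b : Module.Basis ι ℤ O) :
    ∃ D : MatrixModel p (O ⊗[ℤ] ℤ_[p]) (padicStar p O hO) (ι ⊕ ι),
      ∀ x : O, (D.act (x ⊗ₜ[ℤ] (1 : ℤ_[p]))).charpoly =
        ((Algebra.leftMulMatrix b x).charpoly.map (Int.castRingHom ℤ_[p])) ^ 2 := by
  obtain ⟨Φ, Ψ, hpair, hΦ, hΨ, -⟩ := exists_isFrobeniusPair p hmax b
  let l : O →+* Matrix ι ι ℤ := (Algebra.leftMulMatrix b).toRingHom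
  -- The dual representation: both * and transposition reverse products, so the composite is a ring
  -- homomorphism.
  let l' : O →+* Matrix ι ι ℤ :=
    { toFun := fun x => (l (orderStar O hO x))ᵀ
      map_one' := by
        have : orderStar O hO 1 = 1 := Subtype.ext (star_one B)
        rw [this, map_one, Matrix.transpose_one]
      map_zero' := by rw [map_zero, map_zero, Matrix.transpose_zero]
      map_mul' := fun x y => by
        have : orderStar O hO (x * y) = orderStar O hO y * orderStar O hO x :=
          Subtype.ext (star_mul (x : B) (y : B))
        rw [this, map_mul, Matrix.transpose_mul]
      map_add' := fun x y => by rw [map_add, map_add, Matrix.transpose_add] }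
  have hstar : ∀ x, orderStar O hO (orderStar O hO x) = x := fun x =>
    Subtype.ext (star_star (x : B))
  have h1 : ∀ x, l (orderStar O hO x) = (l' x)ᵀ := fun x => (Matrix.transpose_transpose _).symm
  have h2 : ∀ x, l' (orderStar O hO x) = (l x)ᵀ := fun x => by
    show (l (orderStar O hO (orderStar O hO x)))ᵀ = _
    rw [hstar]
  refine ⟨MatrixModel.hyperbolic (matLift p l) (matLift p l') (matLift_algebraMap p l)
    (matLift_algebraMap p l') (matLift_padicStar p hO h2) (matLift_padicStar p hO h1) hpair
    (commute_matLift p hΦ) (commute_matLift p hΨ), fun x => ?_⟩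
  show (Matrix.fromBlocks (matLift p l (x ⊗ₜ[ℤ] (1 : ℤ_[p]))) 0 0
    (matLift p l' (x ⊗ₜ[ℤ] (1 : ℤ_[p])))).charpoly = _
  rw [Matrix.charpoly_fromBlocks_zero₁₂, charpoly_matLift_tmul_one, charpoly_matLift_tmul_one, sq]
  congr 2
  show (l (orderStar O hO x))ᵀ.charpoly = _
  rw [Matrix.charpoly_transpose]
  exact charpoly_leftMulMatrix_congr hmax.prop b (redCharpoly_star hγ (x : B))

end OrderModel

/-! ### The determinant condition and the final assembly -/

section Conclusion

variable {F : Type*} [Field F] [NumberField F] {B : Type*} [Ring B] [Algebra F B]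
  [Module.Finite F B] [IsQuat F B] [StarRing B] {O : Subalgebra (𝓞 F) B}
  {ι : Type*} [Fintype ι] [DecidableEq ι]

theorem MatrixModel.determinantCondition {p : ℕ} [Fact p.Prime] {s : O ⊗[ℤ] ℤ_[p] → O ⊗[ℤ] ℤ_[p]}
    {κ : Type*} [Fintype κ] [DecidableEq κ] (D : MatrixModel p (O ⊗[ℤ] ℤ_[p]) s κ)
    (hO : IsOrder O) (b : Module.Basis ι ℤ O) (m : ℕ)
    (hD : ∀ x : O, (D.act (x ⊗ₜ[ℤ] (1 : ℤ_[p]))).charpoly =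
      ((Algebra.leftMulMatrix b x).charpoly.map (Int.castRingHom ℤ_[p])) ^ m)
    (k : Type*) [Field k] [CharP k p] [IsAlgClosed k] :
    DeterminantCondition O m (D.action k) := by
  intro x
  obtain ⟨P, hP, hmonic, hchar⟩ := exists_isAbsRedCharpoly hO b x
  refine ⟨P, hP, ?_⟩
  have h1 := D.lieCharpoly_sq k (x ⊗ₜ[ℤ] (1 : ℤ_[p]))
  rw [hD, hchar, Polynomial.map_pow, Polynomial.map_pow, Polynomial.map_pow, Polynomial.map_map,
    RingHom.ext_int (((algebraMap (WittVector p k) k).comp (padicToWitt p k)).comp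
      (Int.castRingHom ℤ_[p])) (Int.castRingHom k), pow_right_comm] at h1
  have hm1 : ((P.map (Int.castRingHom k)) ^ m).Monic := (hmonic.map _).pow m
  have hm2 : ((D.action k).lieCharpoly (x ⊗ₜ[ℤ] (1 : ℤ_[p]))).Monic := by
    have := (D.dieudonneModule k).finite
    exact LinearMap.charpoly_monic _
  rw [Polynomial.map_pow]
  -- Both roots are monic, so the negative sign can occur only when -1 = 1 in k, and then it is
  -- harmless.
  rcases sq_eq_sq_iff_eq_or_eq_neg.mp h1 with h | h
  · exact h.symm
  · have h3 := congrArg Polynomial.leadingCoeff h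
    rw [hm1.leadingCoeff, Polynomial.leadingCoeff_neg, hm2.leadingCoeff] at h3
    rw [h]
    have : (-1 : k[X]) = 1 := by
      rw [← Polynomial.C_1, ← Polynomial.C_neg, ← h3]
    rw [← neg_one_mul, this, one_mul]

theorem MatrixModel.exists_dieudonneModule {p : ℕ} [Fact p.Prime] (hO : ∀ b ∈ O, star b ∈ O)
    {κ : Type} [Fintype κ] [DecidableEq κ]
    (D : MatrixModel p (O ⊗[ℤ] ℤ_[p]) (padicStar p O hO) κ)
    (hO' : IsOrder O) (b : Module.Basis ι ℤ O) (m : ℕ)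
    (hκ : Fintype.card κ = 4 * Module.finrank ℚ F * m)
    (hD : ∀ x : O, (D.act (x ⊗ₜ[ℤ] (1 : ℤ_[p]))).charpoly =
      ((Algebra.leftMulMatrix b x).charpoly.map (Int.castRingHom ℤ_[p])) ^ m)
    (k : Type u) [Field k] [CharP k p] [IsAlgClosed k] :
    ∃ (M : Type u) (_ : AddCommGroup M) (_ : Module (WittVector p k) M)
      (D : DieudonneModule p k M) (ι : D.Action (O ⊗[ℤ] ℤ_[p])) (φ : D.PrincipalPolarization),
      Module.finrank (WittVector p k) M = 4 * Module.finrank ℚ F * m ∧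
      IsCompatible O hO ι φ ∧ D.IsSuperspecial ∧ DeterminantCondition O m ι :=
  ⟨κ → WittVector p k, inferInstance, inferInstance, D.dieudonneModule k, D.action k,
    D.polarization k, by rw [Module.finrank_pi, hκ], D.form_act k, D.isSuperspecial k,
    D.determinantCondition hO' b m hD k⟩

end Conclusion

end SuperspecialTypeC

end

open SuperspecialTypeC

theorem mainTheorem6 {F : Type*} [Field F] [NumberField F] [NumberField.IsTotallyReal F]
    {B : Type*} [Ring B] [Algebra F B] [Algebra.IsCentral F B] [IsSimpleRing B]
    (hB : Module.finrank F B = 4) (hind : IsTotallyIndefinite F B)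
    [StarRing B] (hpos : IsPositiveInvolution F B)
    (O : Subalgebra (𝓞 F) B) (hmax : IsMaximalOrder O) (hO : ∀ b ∈ O, star b ∈ O)
    (m : ℕ) (hm : 0 < m) (hpar : ParityCondition O m)
    (p : ℕ) [Fact p.Prime] (k : Type u) [Field k] [CharP k p] [IsAlgClosed k] :
    ∃ (M : Type u) (_ : AddCommGroup M) (_ : Module (WittVector p k) M)
      (D : DieudonneModule p k M) (ι : D.Action (O ⊗[ℤ] ℤ_[p])) (φ : D.PrincipalPolarization),
      Module.finrank (WittVector p k) M = 4 * Module.finrank ℚ F * m ∧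
      IsCompatible O hO ι φ ∧ D.IsSuperspecial ∧ DeterminantCondition O m ι := by
  have : Module.Finite F B := Module.finite_of_finrank_pos (by omega)
  obtain ⟨σ⟩ : Nonempty (F →+* ℂ) := inferInstance
  obtain ⟨ψ, hψ⟩ := exists_isSplittingOver hind (realEmb σ)
  have : IsQuat F B := hψ.isQuat hB
  obtain ⟨γ, hγ⟩ := exists_isTwistingElement hind hpos
  have := finite_int_order hmax.prop
  have := free_int_order hmax.prop
  let b := Module.finBasis ℤ O
  have hcard := card_eq_finrank hmax.prop b
  rw [hB] at hcard
  by_cases hme : Even m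
  -- For m = n + n, n copies of the hyperbolic model; the dual has the same characteristic
  -- polynomials since * preserves reduced ones.
  · obtain ⟨n, rfl⟩ := hme
    obtain ⟨D, hD⟩ := exists_matrixModel_hyperbolic hmax hO hγ p b
    refine (D.copies (Fin n)).exists_dieudonneModule hO hmax.prop b (n + n) ?_ (fun x => ?_) k
    · rw [Fintype.card_prod, Fintype.card_sum, hcard, Fintype.card_fin]
      ring
    · rw [D.charpoly_copies, hD, Fintype.card_fin, ← pow_mul, two_mul]
  -- For m odd, the parity condition at ramified places becomes oddness of the valuation of Nr γ
  -- wherever there is no idempotent, so the order itself carries a form perfect at p.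
  · have hγ' := hpar.resolve_left hme γ hγ
    obtain ⟨D, hD⟩ := exists_matrixModel hmax hO hγ (exists_odd_valuation hmax hγ') p b
    refine (D.copies (Fin m)).exists_dieudonneModule hO hmax.prop b m ?_ (fun x => ?_) k
    · rw [Fintype.card_prod, hcard, Fintype.card_fin]
      ring
    · rw [D.charpoly_copies, hD, Fintype.card_fin]
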